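/- **Setting.** Let $(\mathcal C,\otimes,1)$ be an abelian, closed symmetric monoidal category with all small limits and colimits, in which filtered colimits commute with finite limits. Call an object $M$ of a category *finitely generated* if $\mathrm{Hom}(M,-)$ commutes with colimits of small filtered systems of monomorphisms, and assume that every object of $\mathcal C$ is a directed colimit of finitely generated subobjects. For $A\in \mathrm{Comm}(\mathcal C)$ (the commutative monoid objects) let $A\text{-}\mathrm{Mod}$ be the symmetric monoidal category of $A$-modules, and let $\mathrm{Aff}=\mathrm{Comm}(\mathcal C)^{op}$, with objects written $\mathrm{Spec}(A)$. A morphism $A\to B$ in $\mathrm{Comm}(\mathcal C)$ is a Zariski open if it is a flat epimorphism of finite presentation. A family $\{\mathrm{Spec}(A_i)\to \mathrm{Spec}(A)\}$ of Zariski opens is a covering if it has a finite subfamily $J$ such that a morphism $g$ of $A$-modules is an isomorphism as soon as all $A_j\otimes_A g$, $j\in J$, are. Sheaves (of sets on $\mathrm{Aff}$) are taken for the resulting Zariski topology. A subfunctor of $\mathrm{Spec}(A)$ is a Zariski open if it is the sheaf image of $\coprod_i\mathrm{Spec}(A_i)$ for some family of Zariski opens $\mathrm{Spec}(A_i)\to\mathrm{Spec}(A)$;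 a morphism $Y\to X$ of sheaves is a Zariski open immersion if for every $\mathrm{Spec}(A)\to X$ the projection $Y\times_X\mathrm{Spec}(A)\to\mathrm{Spec}(A)$ is a monomorphism whose image is a Zariski open. An affine cover of a sheaf $X$ is a family of Zariski open immersions $X_i\to X$ with all $X_i$ affine and $\coprod X_i\to X$ an epimorphism of sheaves; $X$ is a scheme if it has an affine cover. Let $\mathrm{ZarAff}(X)$ be the category of Zariski open immersions $U\to X$ with $U$ affine, and $\mathcal O_X(\mathrm{Spec}(A)\to X)=A$. A quasi-coherent sheaf $\mathcal M$ on $X$ consists of an $\mathcal O_X(U)$-module $\mathcal M(U)$ for each $U\in\mathrm{ZarAff}(X)$, with compatible restriction maps, such that $\mathcal O_X(U')\otimes_{\mathcal O_X(U)}\mathcal M(U)\to\mathcal M(U')$ is an isomorphism for every $U'\to U$ in $\mathrm{ZarAff}(X)$. These form a symmetric monoidal category $\mathrm{QCoh}(X)$, with $(\mathcal M\otimes\mathcal N)(U)=\mathcal M(U)\otimes_{\mathcal O_X(U)}\mathcal N(U)$, and $\mathrm{QCoh}(\mathrm{Spec}(A))$ is identified with $A\text{-}\mathrm{Mod}$.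 For $i:U\to X$ in $\mathrm{ZarAff}(X)$ the pullback is $i^*:\mathrm{QCoh}(X)\to\mathrm{QCoh}(U)$, $\mathcal M\mapsto\mathcal M(U)$. The scheme $X$ is *quasi-compact* if every affine cover has a finite subcover, and *semi-separated* if $U\times_XV\in\mathrm{ZarAff}(X)$ for all $U,V\in\mathrm{ZarAff}(X)$. A commutative monoid $A$ is *Noetherian* if every finitely generated $A$-module is isomorphic to $\mathrm{colim}(0\leftarrow A^m\to A^n)$ for some morphism $A^m\to A^n$ with $m,n\ge1$; $X$ is *Noetherian* if $A$ is Noetherian for every $\mathrm{Spec}(A)\in\mathrm{ZarAff}(X)$. A *field object* is a Noetherian $K\in\mathrm{Comm}(\mathcal C)$, $K\neq0$, such that every monomorphism $I\to K$ in $K\text{-}\mathrm{Mod}$ is an isomorphism or zero. **Proposition.** Let $X$ be a quasi-compact, semi-separated and Noetherian scheme over $(\mathcal C,\otimes,1)$, let $K$ be a field object of $(\mathcal C,\otimes,1)$, and let $F:\mathrm{QCoh}(X)\to K\text{-}\mathrm{Mod}$ be a cocontinuous (strong) symmetric monoidal functor. Then there is a Zariski open immersion $i:U\to X$ with $U$ affine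 such that $F$ is $i$-local: $i^*$ has a right adjoint $i_*$ whose counit $i^*i_*\to \mathrm{id}$ is an isomorphism, and $F\eta:F\to F\,i_*i^*$ is an isomorphism, where $\eta$ is the unit of the adjunction. Moreover (equivalently), $F(g)$ is an isomorphism for every morphism $g$ of $\mathrm{QCoh}(X)$ such that $i^*(g)$ is an isomorphism. -/

import Mathlib

universe w v u v₁ u₁ v₂ u₂ v₃ u₃

namespace RelAG

open CategoryTheory MonoidalCategory Limits MonObj Opposite

section ModuleTensor

set_option linter.unusedSectionVars false

variable {D : Type u₁} [Category.{v₁} D] [MonoidalCategory D] [SymmetricCategory D]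

variable {A : D} [MonObj A] [IsCommMonObj A]

/-- The action `A ⊗ M ⟶ M` of a module object. -/
def act (M : Mod D A) : A ⊗ M.X ⟶ M.X := ModObj.smul (M := A) (X := M.X)

lemma one_act (M : Mod D A) : η[A] ▷ M.X ≫ act M = (λ_ M.X).hom :=
  ModObj.one_smul_self A M.X

lemma mul_act (M : Mod D A) :
    μ[A] ▷ M.X ≫ act M = (α_ A A M.X).hom ≫ A ◁ act M ≫ act M :=
  ModObj.mul_smul_self A M.X

lemma act_hom {M N : Mod D A} (f : M ⟶ N) : act M ≫ f.hom = A ◁ f.hom ≫ act N :=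
  IsModHom.smul_hom (A := A) (f := f.hom)

/-- Build a module object from its action. -/
@[reducible] def mkMod (X : D) (a : A ⊗ X ⟶ X) (h1 : η[A] ▷ X ≫ a = (λ_ X).hom)
    (h2 : μ[A] ▷ X ≫ a = (α_ A A X).hom ≫ A ◁ a ≫ a) : Mod D A :=
  letI : ModObj A X := { smul := a, one_smul := h1, mul_smul := h2 }
  ⟨X⟩

/-- Build a morphism of module objects. -/
def mkHom {M N : Mod D A} (f : M.X ⟶ N.X) (h : act M ≫ f = A ◁ f ≫ act N) : M ⟶ N :=
  letI : IsModHom A f := ⟨h⟩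
  ⟨f⟩

@[simp] lemma mkHom_hom {M N : Mod D A} (f : M.X ⟶ N.X) (h : act M ≫ f = A ◁ f ≫ act N) :
    (mkHom f h).hom = f := rfl

/-- The right action `M ⊗ A ⟶ M` on a module over a commutative monoid. -/
def ract (M : Mod D A) : M.X ⊗ A ⟶ M.X := (β_ M.X A).hom ≫ act M

lemma ract_one (M : Mod D A) : M.X ◁ η[A] ≫ ract M = (ρ_ M.X).hom := by
  simp [ract, one_act]

lemma ract_hom {M N : Mod D A} (f : M ⟶ N) : ract M ≫ f.hom = f.hom ▷ A ≫ ract N := by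
  simp [ract, act_hom]

lemma act_ract (M : Mod D A) :
    act M ▷ A ≫ ract M = (α_ A M.X A).hom ≫ A ◁ ract M ≫ act M := by
  have h : A ◁ act M ≫ act M = (α_ A A M.X).inv ≫ μ[A] ▷ M.X ≫ act M := by
    rw [mul_act, Iso.inv_hom_id_assoc]
  simp only [ract, whiskerLeft_comp, Category.assoc, h,
    BraidedCategory.braiding_naturality_left_assoc]
  rw [BraidedCategory.braiding_tensor_left_hom]
  simp only [Category.assoc, Iso.hom_inv_id_assoc]
  rw [← comp_whiskerRight_assoc, IsCommMonObj.mul_comm]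

lemma ract_mul (M : Mod D A) :
    M.X ◁ μ[A] ≫ ract M = (α_ M.X A A).inv ≫ ract M ▷ A ≫ ract M := by
  have h : ract M ▷ A ≫ ract M = (β_ M.X A).hom ▷ A ≫ act M ▷ A ≫ ract M := by
    rw [← comp_whiskerRight_assoc]; rfl
  rw [h, act_ract]
  have h2 : A ◁ act M ≫ act M = (α_ A A M.X).inv ≫ μ[A] ▷ M.X ≫ act M := by
    rw [mul_act, Iso.inv_hom_id_assoc]
  simp only [ract, whiskerLeft_comp, Category.assoc, h2,
    BraidedCategory.braiding_naturality_right_assoc]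
  rw [BraidedCategory.braiding_tensor_right_hom]
  simp

variable [HasCoequalizers D]

/-- The underlying object of `M ⊗_A N`: the coequalizer of the two actions
`(M ⊗ A) ⊗ N ⇉ M ⊗ N`. -/
noncomputable def tensorX (M N : Mod D A) : D :=
  coequalizer (ract M ▷ N.X) ((α_ M.X A N.X).hom ≫ M.X ◁ act N)

/-- The projection `M ⊗ N ⟶ M ⊗_A N`. -/
noncomputable def tπ (M N : Mod D A) : M.X ⊗ N.X ⟶ tensorX M N := coequalizer.π _ _

/-- Being balanced over `A`, for a morphism out of `M ⊗ N`. -/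
def Balanced (M N : Mod D A) {Z : D} (h : M.X ⊗ N.X ⟶ Z) : Prop :=
  ract M ▷ N.X ≫ h = (α_ M.X A N.X).hom ≫ M.X ◁ act N ≫ h

lemma tπ_condition (M N : Mod D A) :
    ract M ▷ N.X ≫ tπ M N = (α_ M.X A N.X).hom ≫ M.X ◁ act N ≫ tπ M N := by
  have h := coequalizer.condition (ract M ▷ N.X) ((α_ M.X A N.X).hom ≫ M.X ◁ act N)
  rw [Category.assoc] at h
  exact h

/-- The universal property of `M ⊗_A N`. -/
noncomputable def tdesc {M N : Mod D A} {Z : D} (h : M.X ⊗ N.X ⟶ Z) (w : Balanced M N h) :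
    tensorX M N ⟶ Z :=
  coequalizer.desc h (by rw [Category.assoc]; exact w)

@[simp]
lemma tπ_tdesc {M N : Mod D A} {Z : D} (h : M.X ⊗ N.X ⟶ Z) (w : Balanced M N h) :
    tπ M N ≫ tdesc h w = h := coequalizer.π_desc _ _

instance (M N : Mod D A) : Epi (tπ M N) := inferInstanceAs (Epi (coequalizer.π _ _))

lemma tensorX_hom_ext {M N : Mod D A} {Z : D} {f g : tensorX M N ⟶ Z}
    (h : tπ M N ≫ f = tπ M N ≫ g) : f = g := (cancel_epi _).1 h

variable [∀ X : D, PreservesFiniteColimits (tensorLeft X)]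

lemma epi_whiskerLeft (W : D) {X Y : D} (f : X ⟶ Y) [Epi f] : Epi (W ◁ f) := by
  have : PreservesColimitsOfShape WalkingSpan (tensorLeft W) := inferInstance
  have : (tensorLeft W).PreservesEpimorphisms :=
    preservesEpimorphisms_of_preservesColimitsOfShape _
  exact inferInstanceAs (Epi ((tensorLeft W).map f))

lemma epi_whiskerRight (W : D) {X Y : D} (f : X ⟶ Y) [Epi f] : Epi (f ▷ W) := by
  have : f ▷ W = (β_ _ _).hom ≫ W ◁ f ≫ (β_ _ _).hom := by
    rw [BraidedCategory.braiding_naturality_right, SymmetricCategory.symmetry_assoc]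
  have := epi_whiskerLeft W f
  rw [‹f ▷ W = _›]
  infer_instance

attribute [local instance] epi_whiskerLeft epi_whiskerRight

/-- The cofork defining `M ⊗_A N`, tensored on the left with `W`, is again a coequalizer. -/
noncomputable def isColimitWhiskerLeft (W : D) (M N : Mod D A) :
    IsColimit (Cofork.ofπ (f := W ◁ (ract M ▷ N.X)) (g := W ◁ ((α_ M.X A N.X).hom ≫ M.X ◁ act N))
      (W ◁ tπ M N) (by simp only [← whiskerLeft_comp]; rw [tπ_condition]; simp)) :=
  isColimitOfHasCoequalizerOfPreservesColimit (tensorLeft W) _ _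

/-- Descent of morphisms along `W ⊗ (M ⊗ N) ⟶ W ⊗ (M ⊗_A N)`. -/
noncomputable def tdescL {W : D} {M N : Mod D A} {Z : D} (h : W ⊗ (M.X ⊗ N.X) ⟶ Z)
    (w : W ◁ (ract M ▷ N.X) ≫ h = W ◁ (α_ M.X A N.X).hom ≫ W ◁ (M.X ◁ act N) ≫ h) :
    W ⊗ tensorX M N ⟶ Z :=
  Cofork.IsColimit.desc (isColimitWhiskerLeft W M N) h (by simpa using w)

@[simp]
lemma tπ_tdescL {W : D} {M N : Mod D A} {Z : D} (h : W ⊗ (M.X ⊗ N.X) ⟶ Z)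
    (w : W ◁ (ract M ▷ N.X) ≫ h = W ◁ (α_ M.X A N.X).hom ≫ W ◁ (M.X ◁ act N) ≫ h) :
    W ◁ tπ M N ≫ tdescL h w = h :=
  Cofork.IsColimit.π_desc' (isColimitWhiskerLeft W M N) h (by simpa using w)

/-- Descent of morphisms along `(M ⊗ N) ⊗ W ⟶ (M ⊗_A N) ⊗ W`. -/
noncomputable def tdescR {W : D} {M N : Mod D A} {Z : D} (h : (M.X ⊗ N.X) ⊗ W ⟶ Z)
    (w : (ract M ▷ N.X) ▷ W ≫ h = (α_ M.X A N.X).hom ▷ W ≫ (M.X ◁ act N) ▷ W ≫ h) :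
    tensorX M N ⊗ W ⟶ Z :=
  (β_ _ _).hom ≫ tdescL ((β_ _ _).hom ≫ h) (by
    simp only [BraidedCategory.braiding_naturality_right_assoc, w])

@[simp]
lemma tπ_tdescR {W : D} {M N : Mod D A} {Z : D} (h : (M.X ⊗ N.X) ⊗ W ⟶ Z)
    (w : (ract M ▷ N.X) ▷ W ≫ h = (α_ M.X A N.X).hom ▷ W ≫ (M.X ◁ act N) ▷ W ≫ h) :
    tπ M N ▷ W ≫ tdescR h w = h := by
  rw [tdescR, BraidedCategory.braiding_naturality_left_assoc, tπ_tdescL,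
    SymmetricCategory.symmetry_assoc]

/-- The action of `A` on `M ⊗_A N`. -/
noncomputable def tact (M N : Mod D A) : A ⊗ tensorX M N ⟶ tensorX M N :=
  tdescL ((α_ A M.X N.X).inv ≫ act M ▷ N.X ≫ tπ M N) (by
    have e1 : A ◁ (ract M ▷ N.X) ≫ (α_ A M.X N.X).inv ≫ act M ▷ N.X ≫ tπ M N =
        (α_ A (M.X ⊗ A) N.X).inv ≫ (A ◁ ract M ≫ act M) ▷ N.X ≫ tπ M N := by
      simp
    have e2 : A ◁ ract M ≫ act M = (α_ A M.X A).inv ≫ act M ▷ A ≫ ract M := by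
      rw [act_ract, Iso.inv_hom_id_assoc]
    rw [e1, e2]
    simp only [comp_whiskerRight, Category.assoc, tπ_condition]
    rw [associator_naturality_left_assoc, ← whisker_exchange_assoc]
    monoidal)

lemma tπ_tact (M N : Mod D A) :
    A ◁ tπ M N ≫ tact M N = (α_ A M.X N.X).inv ≫ act M ▷ N.X ≫ tπ M N := by
  simp [tact]

/-- The tensor product `M ⊗_A N` of modules over a commutative monoid. -/
noncomputable def tensorMod (M N : Mod D A) : Mod D A :=
  mkMod (tensorX M N) (tact M N)
    (by
      rw [← cancel_epi (𝟙_ D ◁ tπ M N), whisker_exchange_assoc, tπ_tact,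
        associator_inv_naturality_left_assoc, ← comp_whiskerRight_assoc, one_act]
      simp)
    (by
      rw [← cancel_epi ((A ⊗ A) ◁ tπ M N), whisker_exchange_assoc, tπ_tact,
        associator_inv_naturality_left_assoc, ← comp_whiskerRight_assoc, mul_act,
        associator_naturality_right_assoc, ← whiskerLeft_comp_assoc, tπ_tact]
      simp only [comp_whiskerRight, whiskerLeft_comp, Category.assoc, tπ_tact]
      monoidal)

/-- The universal balanced morphism `M ⊗ N ⟶ M ⊗_A N`. -/
noncomputable def ten (M N : Mod D A) : M.X ⊗ N.X ⟶ (tensorMod M N).X := tπ M N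

lemma ten_condition (M N : Mod D A) :
    ract M ▷ N.X ≫ ten M N = (α_ M.X A N.X).hom ≫ M.X ◁ act N ≫ ten M N :=
  tπ_condition M N

lemma ten_act (M N : Mod D A) :
    A ◁ ten M N ≫ act (tensorMod M N) = (α_ A M.X N.X).inv ≫ act M ▷ N.X ≫ ten M N :=
  tπ_tact M N

instance (M N : Mod D A) : Epi (ten M N) := inferInstanceAs (Epi (tπ M N))

/-- Descent of balanced morphisms along `M ⊗ N ⟶ M ⊗_A N`. -/
noncomputable def desc {M N : Mod D A} {Z : D} (h : M.X ⊗ N.X ⟶ Z) (w : Balanced M N h) :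
    (tensorMod M N).X ⟶ Z := tdesc h w

@[simp]
lemma ten_desc {M N : Mod D A} {Z : D} (h : M.X ⊗ N.X ⟶ Z) (w : Balanced M N h) :
    ten M N ≫ desc h w = h := tπ_tdesc h w

/-- Descent of balanced morphisms along `W ⊗ (M ⊗ N) ⟶ W ⊗ (M ⊗_A N)`. -/
noncomputable def descL {W : D} {M N : Mod D A} {Z : D} (h : W ⊗ (M.X ⊗ N.X) ⟶ Z)
    (w : W ◁ (ract M ▷ N.X) ≫ h = W ◁ (α_ M.X A N.X).hom ≫ W ◁ (M.X ◁ act N) ≫ h) :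
    W ⊗ (tensorMod M N).X ⟶ Z := tdescL h w

@[simp]
lemma ten_descL {W : D} {M N : Mod D A} {Z : D} (h : W ⊗ (M.X ⊗ N.X) ⟶ Z)
    (w : W ◁ (ract M ▷ N.X) ≫ h = W ◁ (α_ M.X A N.X).hom ≫ W ◁ (M.X ◁ act N) ≫ h) :
    W ◁ ten M N ≫ descL h w = h := tπ_tdescL h w

/-- Descent of balanced morphisms along `(M ⊗ N) ⊗ W ⟶ (M ⊗_A N) ⊗ W`. -/
noncomputable def descR {W : D} {M N : Mod D A} {Z : D} (h : (M.X ⊗ N.X) ⊗ W ⟶ Z)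
    (w : (ract M ▷ N.X) ▷ W ≫ h = (α_ M.X A N.X).hom ▷ W ≫ (M.X ◁ act N) ▷ W ≫ h) :
    (tensorMod M N).X ⊗ W ⟶ Z := tdescR h w

@[simp]
lemma ten_descR {W : D} {M N : Mod D A} {Z : D} (h : (M.X ⊗ N.X) ⊗ W ⟶ Z)
    (w : (ract M ▷ N.X) ▷ W ≫ h = (α_ M.X A N.X).hom ▷ W ≫ (M.X ◁ act N) ▷ W ≫ h) :
    ten M N ▷ W ≫ descR h w = h := tπ_tdescR h w

lemma tensorMod_hom_ext {M N : Mod D A} {Z : D} {f g : (tensorMod M N).X ⟶ Z}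
    (h : ten M N ≫ f = ten M N ≫ g) : f = g := (cancel_epi _).1 h

lemma ten_ract (M N : Mod D A) :
    ten M N ▷ A ≫ ract (tensorMod M N) = (α_ M.X N.X A).hom ≫ M.X ◁ ract N ≫ ten M N := by
  have h2 : act M ▷ N.X = (β_ A M.X).hom ▷ N.X ≫ ract M ▷ N.X := by
    rw [← comp_whiskerRight, ract, SymmetricCategory.symmetry_assoc]
  rw [ract, BraidedCategory.braiding_naturality_left_assoc, ten_act, h2,
    BraidedCategory.braiding_tensor_left_hom]
  simp only [Category.assoc, ten_condition, Iso.hom_inv_id_assoc]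
  rw [← comp_whiskerRight_assoc, SymmetricCategory.symmetry]
  simp [ract]

/-- The map on tensor products induced by two linear maps. -/
noncomputable def tmap {M M' N N' : Mod D A} (f : M ⟶ M') (g : N ⟶ N') :
    tensorMod M N ⟶ tensorMod M' N' :=
  mkHom (desc ((f.hom ⊗ₘ g.hom) ≫ ten M' N') (by
    have e1 : ract M ▷ N.X ≫ (f.hom ⊗ₘ g.hom) =
        ((f.hom ▷ A) ⊗ₘ g.hom) ≫ ract M' ▷ N'.X := by
      simp only [MonoidalCategory.tensorHom_def, Category.assoc, ← comp_whiskerRight_assoc,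
        ract_hom, whisker_exchange]
    have e2 : M.X ◁ act N ≫ (f.hom ⊗ₘ g.hom) =
        (f.hom ⊗ₘ (A ◁ g.hom)) ≫ M'.X ◁ act N' := by
      simp only [MonoidalCategory.tensorHom_def, Category.assoc, ← whiskerLeft_comp,
        ← act_hom, whisker_exchange_assoc]
    unfold Balanced
    rw [reassoc_of% e1, reassoc_of% e2, ten_condition, ← tensorHom_id, ← id_tensorHom A,
      associator_naturality_assoc])) (by
    rw [← cancel_epi (A ◁ ten M N), reassoc_of% @ten_act, ten_desc, ← whiskerLeft_comp_assoc, ten_desc,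
      whiskerLeft_comp_assoc, ten_act]
    have e1 : act M ▷ N.X ≫ (f.hom ⊗ₘ g.hom) =
        ((A ◁ f.hom) ⊗ₘ g.hom) ≫ act M' ▷ N'.X := by
      simp only [MonoidalCategory.tensorHom_def, Category.assoc, ← comp_whiskerRight_assoc,
        act_hom, whisker_exchange]
    rw [reassoc_of% e1, ← id_tensorHom, ← id_tensorHom, associator_inv_naturality_assoc])

@[simp]
lemma ten_tmap {M M' N N' : Mod D A} (f : M ⟶ M') (g : N ⟶ N') :
    ten M N ≫ (tmap f g).hom = (f.hom ⊗ₘ g.hom) ≫ ten M' N' := by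
  rw [tmap, mkHom_hom, ten_desc]

/-- Auxiliary morphism for the associativity isomorphism. -/
noncomputable def assocHomAux (M N P : Mod D A) :
    (tensorMod M N).X ⊗ P.X ⟶ (tensorMod M (tensorMod N P)).X :=
  descR ((α_ M.X N.X P.X).hom ≫ M.X ◁ ten N P ≫ ten M (tensorMod N P)) (by
    rw [associator_naturality_left_assoc, ← whisker_exchange_assoc, ten_condition,
      associator_naturality_right_assoc, ← whiskerLeft_comp_assoc, ten_act]
    monoidal)

lemma ten_assocHomAux (M N P : Mod D A) :
    ten M N ▷ P.X ≫ assocHomAux M N P =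
      (α_ M.X N.X P.X).hom ≫ M.X ◁ ten N P ≫ ten M (tensorMod N P) := ten_descR _ _

/-- The associativity isomorphism, forward direction. -/
noncomputable def assocHom (M N P : Mod D A) :
    (tensorMod (tensorMod M N) P).X ⟶ (tensorMod M (tensorMod N P)).X :=
  desc (assocHomAux M N P) (by
    unfold Balanced
    rw [← cancel_epi ((ten M N ▷ A) ▷ P.X), ← comp_whiskerRight_assoc, ten_ract,
      associator_naturality_left_assoc, ← whisker_exchange_assoc, ten_assocHomAux]
    simp only [comp_whiskerRight, Category.assoc, ten_assocHomAux]
    rw [associator_naturality_middle_assoc, ← whiskerLeft_comp_assoc, ten_condition]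
    monoidal)

lemma ten_assocHom (M N P : Mod D A) :
    ten M N ▷ P.X ≫ ten (tensorMod M N) P ≫ assocHom M N P =
      (α_ M.X N.X P.X).hom ≫ M.X ◁ ten N P ≫ ten M (tensorMod N P) := by
  rw [assocHom, ten_desc, ten_assocHomAux]

/-- Auxiliary morphism for the inverse of the associativity isomorphism. -/
noncomputable def assocInvAux (M N P : Mod D A) :
    M.X ⊗ (tensorMod N P).X ⟶ (tensorMod (tensorMod M N) P).X :=
  descL ((α_ M.X N.X P.X).inv ≫ ten M N ▷ P.X ≫ ten (tensorMod M N) P) (by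
    have e : (M.X ◁ ract N) ▷ P.X ≫ ten M N ▷ P.X =
        (α_ M.X N.X A).inv ▷ P.X ≫ (ten M N ▷ A) ▷ P.X ≫ ract (tensorMod M N) ▷ P.X := by
      simp only [← comp_whiskerRight, ten_ract, Iso.inv_hom_id_assoc]
    rw [associator_inv_naturality_middle_assoc, associator_inv_naturality_right_assoc,
      whisker_exchange_assoc, reassoc_of% e, ten_condition]
    monoidal)

lemma ten_assocInvAux (M N P : Mod D A) :
    M.X ◁ ten N P ≫ assocInvAux M N P =
      (α_ M.X N.X P.X).inv ≫ ten M N ▷ P.X ≫ ten (tensorMod M N) P := ten_descL _ _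

/-- The associativity isomorphism, backward direction. -/
noncomputable def assocInv (M N P : Mod D A) :
    (tensorMod M (tensorMod N P)).X ⟶ (tensorMod (tensorMod M N) P).X :=
  desc (assocInvAux M N P) (by
    unfold Balanced
    rw [← cancel_epi ((M.X ⊗ A) ◁ ten N P), whisker_exchange_assoc, ten_assocInvAux,
      associator_naturality_right_assoc, ← whiskerLeft_comp_assoc, ten_act,
      associator_inv_naturality_left_assoc, ← comp_whiskerRight_assoc, ten_condition]
    simp only [whiskerLeft_comp, Category.assoc, ten_assocInvAux]
    monoidal)

lemma ten_assocInv (M N P : Mod D A) :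
    M.X ◁ ten N P ≫ ten M (tensorMod N P) ≫ assocInv M N P =
      (α_ M.X N.X P.X).inv ≫ ten M N ▷ P.X ≫ ten (tensorMod M N) P := by
  rw [assocInv, ten_desc, ten_assocInvAux]

/-- An isomorphism of modules from mutually inverse morphisms in the ambient category, one of
which is linear. -/
def mkIso {M N : Mod D A} (f : M.X ⟶ N.X) (g : N.X ⟶ M.X) (hfg : f ≫ g = 𝟙 _) (hgf : g ≫ f = 𝟙 _)
    (h : act M ≫ f = A ◁ f ≫ act N) : M ≅ N where
  hom := mkHom f h
  inv := mkHom g (by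
    have : A ◁ g ≫ (A ◁ f ≫ act N) ≫ g = act N ≫ g := by
      rw [Category.assoc, ← whiskerLeft_comp_assoc, hgf]; simp
    rw [← this, ← h, Category.assoc, hfg, Category.comp_id])
  hom_inv_id := by ext; exact hfg
  inv_hom_id := by ext; exact hgf

lemma isIso_of_hom {M N : Mod D A} (f : M ⟶ N) (h : IsIso f.hom) : IsIso f :=
  (mkIso f.hom (inv f.hom) (by simp) (by simp) (act_hom f)).isIso_hom

/-- The associativity isomorphism of the tensor product of modules. -/
noncomputable def assocIso (M N P : Mod D A) :
    tensorMod (tensorMod M N) P ≅ tensorMod M (tensorMod N P) :=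
  mkIso (assocHom M N P) (assocInv M N P)
    (by
      rw [← cancel_epi (ten (tensorMod M N) P), ← cancel_epi (ten M N ▷ P.X),
        reassoc_of% @ten_assocHom, ten_assocInv]
      simp)
    (by
      rw [← cancel_epi (ten M (tensorMod N P)), ← cancel_epi (M.X ◁ ten N P),
        reassoc_of% @ten_assocInv, ten_assocHom]
      simp)
    (by
      rw [← cancel_epi (A ◁ ten (tensorMod M N) P), ← cancel_epi (A ◁ (ten M N ▷ P.X)),
        reassoc_of% @ten_act, associator_inv_naturality_middle_assoc, ← comp_whiskerRight_assoc,
        ten_act]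
      simp only [comp_whiskerRight, Category.assoc, ten_assocHom]
      simp only [← whiskerLeft_comp_assoc, ten_assocHom]
      simp only [whiskerLeft_comp, Category.assoc, ten_act]
      rw [associator_inv_naturality_right_assoc, whisker_exchange_assoc]
      monoidal)

lemma act_regular : act (Mod.regular A) = μ[A] := rfl

lemma ract_regular : ract (Mod.regular A) = μ[A] := IsCommMonObj.mul_comm A

/-- The universal balanced morphism `A ⊗ M ⟶ A ⊗_A M`. -/
noncomputable def lten (M : Mod D A) : A ⊗ M.X ⟶ (tensorMod (Mod.regular A) M).X :=
  ten (Mod.regular A) M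

instance (M : Mod D A) : Epi (lten M) := inferInstanceAs (Epi (ten (Mod.regular A) M))

lemma lten_condition (M : Mod D A) :
    μ[A] ▷ M.X ≫ lten M = (α_ A A M.X).hom ≫ A ◁ act M ≫ lten M := by
  have h := ten_condition (Mod.regular A) M
  rw [ract_regular] at h
  exact h

lemma lten_act (M : Mod D A) :
    A ◁ lten M ≫ act (tensorMod (Mod.regular A) M) = (α_ A A M.X).inv ≫ μ[A] ▷ M.X ≫ lten M :=
  ten_act (Mod.regular A) M

/-- The morphism `A ⊗_A M ⟶ M` induced by the action. -/
noncomputable def leftUnitHom (M : Mod D A) : (tensorMod (Mod.regular A) M).X ⟶ M.X :=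
  desc (M := Mod.regular A) (N := M) (act M) (by
    unfold Balanced
    rw [ract_regular]
    exact mul_act M)

@[simp]
lemma lten_leftUnitHom (M : Mod D A) : lten M ≫ leftUnitHom M = act M :=
  ten_desc (M := Mod.regular A) (N := M) _ _

/-- The unit isomorphism `A ⊗_A M ≅ M`. -/
noncomputable def leftUnitIso (M : Mod D A) : tensorMod (Mod.regular A) M ≅ M :=
  mkIso (leftUnitHom M) ((λ_ M.X).inv ≫ η[A] ▷ M.X ≫ lten M)
    (by
      have e : A ◁ act M ≫ lten M = (α_ A A M.X).inv ≫ μ[A] ▷ M.X ≫ lten M := by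
        rw [lten_condition, Iso.inv_hom_id_assoc]
      rw [← cancel_epi (lten M), reassoc_of% @lten_leftUnitHom, leftUnitor_inv_naturality_assoc,
        whisker_exchange_assoc, e, associator_inv_naturality_left_assoc,
        ← comp_whiskerRight_assoc, MonObj.one_mul]
      simp)
    (by simp [one_act])
    (by
      rw [← cancel_epi (A ◁ lten M), reassoc_of% @lten_act, lten_leftUnitHom,
        ← whiskerLeft_comp_assoc, lten_leftUnitHom, mul_act, Iso.inv_hom_id_assoc])

@[simp]
lemma lten_leftUnitIso (M : Mod D A) : lten M ≫ (leftUnitIso M).hom.hom = act M :=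
  lten_leftUnitHom M

/-- The symmetry `M ⊗_A N ⟶ N ⊗_A M`. -/
noncomputable def braidHom (M N : Mod D A) : tensorMod M N ⟶ tensorMod N M :=
  mkHom (desc ((β_ M.X N.X).hom ≫ ten N M) (by
    unfold Balanced
    have e : N.X ◁ ract M ≫ ten N M = N.X ◁ (β_ M.X A).hom ≫ (α_ N.X A M.X).inv ≫
        ract N ▷ M.X ≫ ten N M := by
      rw [ten_condition, Iso.inv_hom_id_assoc, ract, whiskerLeft_comp_assoc]
    rw [BraidedCategory.braiding_naturality_left_assoc, e,
      BraidedCategory.braiding_naturality_right_assoc, ract, comp_whiskerRight_assoc,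
      BraidedCategory.braiding_tensor_left_hom, BraidedCategory.braiding_tensor_right_hom]
    simp only [Category.assoc, Iso.hom_inv_id_assoc]
    have e2 : (α_ M.X N.X A).inv ≫ (β_ M.X N.X).hom ▷ A ≫ (α_ N.X M.X A).hom ≫
        N.X ◁ (β_ M.X A).hom ≫ (α_ N.X A M.X).inv = (β_ M.X (N.X ⊗ A)).hom := by
      rw [BraidedCategory.braiding_tensor_right_hom]
    have e3 : (β_ A N.X).hom ▷ M.X ≫ (β_ N.X A).hom ▷ M.X = 𝟙 _ := by
      rw [← comp_whiskerRight, SymmetricCategory.symmetry, id_whiskerRight]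
    rw [reassoc_of% e2, BraidedCategory.braiding_naturality_right_assoc, reassoc_of% e3,
      BraidedCategory.braiding_tensor_right_hom]
    simp only [Category.assoc, Iso.hom_inv_id_assoc])) (by
    rw [← cancel_epi (A ◁ ten M N), reassoc_of% @ten_act, ten_desc, ← whiskerLeft_comp_assoc, ten_desc,
      BraidedCategory.braiding_naturality_left_assoc, whiskerLeft_comp_assoc, ten_act]
    have e : N.X ◁ act M ≫ ten N M = N.X ◁ (β_ A M.X).hom ≫ (α_ N.X M.X A).inv ≫
        ten N M ▷ A ≫ ract (tensorMod N M) := by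
      rw [ten_ract, Iso.inv_hom_id_assoc, ract, ← whiskerLeft_comp_assoc,
        SymmetricCategory.symmetry_assoc]
    have e2 : ten N M ▷ A ≫ ract (tensorMod N M) = (β_ (N.X ⊗ M.X) A).hom ≫
        (α_ A N.X M.X).inv ≫ act N ▷ M.X ≫ ten N M := by
      rw [ract, BraidedCategory.braiding_naturality_left_assoc, ten_act]
    have e3 : A ◁ (β_ M.X N.X).hom = (β_ A (M.X ⊗ N.X)).hom ≫ (β_ M.X N.X).hom ▷ A ≫
        (β_ (N.X ⊗ M.X) A).hom := by
      rw [← BraidedCategory.braiding_naturality_right_assoc, SymmetricCategory.symmetry,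
        Category.comp_id]
    rw [e, e2, e3, BraidedCategory.braiding_tensor_left_hom,
      BraidedCategory.braiding_tensor_right_hom A M.X N.X]
    simp only [Category.assoc, Iso.inv_hom_id_assoc]
    rw [← reassoc_of% BraidedCategory.yang_baxter A M.X N.X, Iso.hom_inv_id_assoc])

@[simp]
lemma ten_braidHom (M N : Mod D A) :
    ten M N ≫ (braidHom M N).hom = (β_ M.X N.X).hom ≫ ten N M := by
  rw [braidHom, mkHom_hom, ten_desc]

/-- The symmetry `M ⊗_A N ≅ N ⊗_A M`. -/
noncomputable def braidIso (M N : Mod D A) : tensorMod M N ≅ tensorMod N M where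
  hom := braidHom M N
  inv := braidHom N M
  hom_inv_id := by
    ext
    rw [← cancel_epi (ten M N)]
    simp [reassoc_of% @ten_braidHom]
  inv_hom_id := by
    ext
    rw [← cancel_epi (ten N M)]
    simp [reassoc_of% @ten_braidHom]

/-- The right unit isomorphism `M ⊗_A A ≅ M`. -/
noncomputable def rightUnitIso (M : Mod D A) : tensorMod M (Mod.regular A) ≅ M :=
  braidIso M (Mod.regular A) ≪≫ leftUnitIso M

/-- The universal balanced morphism `M ⊗ A ⟶ M ⊗_A A`. -/
noncomputable def rten (M : Mod D A) : M.X ⊗ A ⟶ (tensorMod M (Mod.regular A)).X :=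
  ten M (Mod.regular A)

instance (M : Mod D A) : Epi (rten M) := inferInstanceAs (Epi (ten M (Mod.regular A)))

lemma rten_braidIso (M : Mod D A) :
    rten M ≫ (braidIso M (Mod.regular A)).hom.hom = (β_ M.X A).hom ≫ lten M :=
  ten_braidHom M (Mod.regular A)

@[simp]
lemma rten_rightUnitIso (M : Mod D A) : rten M ≫ (rightUnitIso M).hom.hom = ract M := by
  rw [rightUnitIso, Iso.trans_hom, Mod.comp_hom', reassoc_of% @rten_braidIso, lten_leftUnitIso, ract]

noncomputable instance : MonoidalCategoryStruct (Mod D A) where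
  tensorObj := tensorMod
  tensorUnit := Mod.regular A
  tensorHom f g := tmap f g
  whiskerLeft M _ _ g := tmap (𝟙 M) g
  whiskerRight f N := tmap f (𝟙 N)
  associator := assocIso
  leftUnitor := leftUnitIso
  rightUnitor := rightUnitIso

@[simp]
lemma ten_assocIso (M N P : Mod D A) :
    ten M N ▷ P.X ≫ ten (tensorMod M N) P ≫ (assocIso M N P).hom.hom =
      (α_ M.X N.X P.X).hom ≫ M.X ◁ ten N P ≫ ten M (tensorMod N P) :=
  ten_assocHom M N P

lemma tmap_id (M N : Mod D A) : tmap (𝟙 M) (𝟙 N) = 𝟙 (tensorMod M N) := by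
  ext
  rw [← cancel_epi (ten M N), ten_tmap]
  simp

lemma tmap_comp {M M' M'' N N' N'' : Mod D A} (f : M ⟶ M') (f' : M' ⟶ M'') (g : N ⟶ N')
    (g' : N' ⟶ N'') : tmap f g ≫ tmap f' g' = tmap (f ≫ f') (g ≫ g') := by
  ext
  rw [← cancel_epi (ten M N), ten_tmap, Mod.comp_hom', reassoc_of% @ten_tmap, ten_tmap]
  simp

lemma assocIso_naturality {M M' N N' P P' : Mod D A} (f : M ⟶ M') (g : N ⟶ N') (h : P ⟶ P') :
    tmap (tmap f g) h ≫ (assocIso M' N' P').hom =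
      (assocIso M N P).hom ≫ tmap f (tmap g h) := by
  ext
  have e1 : ten M N ▷ P.X ≫ ((tmap f g).hom ⊗ₘ h.hom) =
      ((f.hom ⊗ₘ g.hom) ⊗ₘ h.hom) ≫ ten M' N' ▷ P'.X := by
    rw [← tensorHom_id, ← tensorHom_id, tensorHom_comp_tensorHom, tensorHom_comp_tensorHom,
      ten_tmap]
    simp
  have e2 : M.X ◁ ten N P ≫ (f.hom ⊗ₘ (tmap g h).hom) =
      (f.hom ⊗ₘ (g.hom ⊗ₘ h.hom)) ≫ M'.X ◁ ten N' P' := by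
    rw [← id_tensorHom, ← id_tensorHom, tensorHom_comp_tensorHom, tensorHom_comp_tensorHom,
      ten_tmap]
    simp
  rw [← cancel_epi (ten (tensorMod M N) P), ← cancel_epi (ten M N ▷ P.X), Mod.comp_hom',
    Mod.comp_hom', reassoc_of% @ten_tmap, reassoc_of% e1, ten_assocIso,
    reassoc_of% @ten_assocIso, ten_tmap, reassoc_of% e2, associator_naturality_assoc]

lemma lten_tmap {M M' : Mod D A} (f : M ⟶ M') :
    lten M ≫ (tmap (𝟙 (Mod.regular A)) f).hom = A ◁ f.hom ≫ lten M' := by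
  have h := ten_tmap (𝟙 (Mod.regular A)) f
  rw [Mod.id_hom', id_tensorHom] at h
  exact h

lemma leftUnitIso_naturality {M M' : Mod D A} (f : M ⟶ M') :
    tmap (𝟙 (Mod.regular A)) f ≫ (leftUnitIso M').hom = (leftUnitIso M).hom ≫ f := by
  ext
  rw [← cancel_epi (lten M), Mod.comp_hom', Mod.comp_hom', reassoc_of% @lten_tmap,
    lten_leftUnitIso, reassoc_of% @lten_leftUnitIso, act_hom]

lemma rten_tmap {M M' : Mod D A} (f : M ⟶ M') :
    rten M ≫ (tmap f (𝟙 (Mod.regular A))).hom = f.hom ▷ A ≫ rten M' := by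
  have h := ten_tmap f (𝟙 (Mod.regular A))
  rw [Mod.id_hom', tensorHom_id] at h
  exact h

lemma rightUnitIso_naturality {M M' : Mod D A} (f : M ⟶ M') :
    tmap f (𝟙 (Mod.regular A)) ≫ (rightUnitIso M').hom = (rightUnitIso M).hom ≫ f := by
  ext
  rw [← cancel_epi (rten M), Mod.comp_hom', Mod.comp_hom', reassoc_of% @rten_tmap,
    rten_rightUnitIso, reassoc_of% @rten_rightUnitIso, ract_hom]

lemma ten_tmap_id_left (M : Mod D A) {N N' : Mod D A} (g : N ⟶ N') :
    ten M N ≫ (tmap (𝟙 M) g).hom = M.X ◁ g.hom ≫ ten M N' := by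
  rw [ten_tmap, Mod.id_hom', id_tensorHom]

lemma ten_tmap_id_right {M M' : Mod D A} (f : M ⟶ M') (N : Mod D A) :
    ten M N ≫ (tmap f (𝟙 N)).hom = f.hom ▷ N.X ≫ ten M' N := by
  rw [ten_tmap, Mod.id_hom', tensorHom_id]

lemma assocIso_pentagon (M N P Q : Mod D A) :
    tmap (assocIso M N P).hom (𝟙 Q) ≫ (assocIso M (tensorMod N P) Q).hom ≫
      tmap (𝟙 M) (assocIso N P Q).hom =
    (assocIso (tensorMod M N) P Q).hom ≫ (assocIso M N (tensorMod P Q)).hom := by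
  ext
  have e1 : (ten M N ▷ P.X) ▷ Q.X ≫ ten (tensorMod M N) P ▷ Q.X ≫
      (assocIso M N P).hom.hom ▷ Q.X = (α_ M.X N.X P.X).hom ▷ Q.X ≫ (M.X ◁ ten N P) ▷ Q.X ≫
      ten M (tensorMod N P) ▷ Q.X := by
    simp only [← comp_whiskerRight, ten_assocIso]
  have e2 : M.X ◁ (ten N P ▷ Q.X) ≫ M.X ◁ ten (tensorMod N P) Q ≫
      M.X ◁ (assocIso N P Q).hom.hom = M.X ◁ (α_ N.X P.X Q.X).hom ≫
      M.X ◁ (N.X ◁ ten P Q) ≫ M.X ◁ ten N (tensorMod P Q) := by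
    simp only [← whiskerLeft_comp, ten_assocIso]
  rw [← cancel_epi (ten (tensorMod (tensorMod M N) P) Q),
    ← cancel_epi (ten (tensorMod M N) P ▷ Q.X), ← cancel_epi ((ten M N ▷ P.X) ▷ Q.X)]
  simp only [Mod.comp_hom']
  rw [reassoc_of% @ten_tmap_id_right, reassoc_of% e1, reassoc_of% @ten_assocIso,
    ten_tmap_id_left, reassoc_of% @ten_assocIso, associator_naturality_middle_assoc,
    reassoc_of% e2, associator_naturality_left_assoc, ← whisker_exchange_assoc, ten_assocIso,
    associator_naturality_right_assoc, pentagon_assoc]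

lemma assocIso_triangle (M N : Mod D A) :
    (assocIso M (Mod.regular A) N).hom ≫ tmap (𝟙 M) (leftUnitIso N).hom =
      tmap (rightUnitIso M).hom (𝟙 N) := by
  ext
  have h := ten_assocIso M (Mod.regular A) N
  have e1 : rten M ▷ N.X ≫ ten (tensorMod M (Mod.regular A)) N ≫
      (assocIso M (Mod.regular A) N).hom.hom =
      (α_ M.X A N.X).hom ≫ M.X ◁ lten N ≫ ten M (tensorMod (Mod.regular A) N) := h
  rw [← cancel_epi (ten (tensorMod M (Mod.regular A)) N), ← cancel_epi (rten M ▷ N.X),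
    Mod.comp_hom', reassoc_of% e1, ten_tmap_id_left, ← whiskerLeft_comp_assoc,
    lten_leftUnitIso, ten_tmap_id_right, ← comp_whiskerRight_assoc, rten_rightUnitIso,
    ten_condition]

/-- Modules over a commutative monoid `A` form a monoidal category, with `M ⊗_A N` as tensor
product and `A` as unit. -/
noncomputable instance : MonoidalCategory (Mod D A) where
  tensorHom_def f g := by
    change tmap f g = tmap f (𝟙 _) ≫ tmap (𝟙 _) g
    rw [tmap_comp, Category.comp_id, Category.id_comp]
  id_tensorHom_id M N := tmap_id M N
  tensorHom_comp_tensorHom f g f' g' := tmap_comp f f' g g'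
  whiskerLeft_id M N := tmap_id M N
  id_whiskerRight M N := tmap_id M N
  associator_naturality f g h := assocIso_naturality f g h
  leftUnitor_naturality f := leftUnitIso_naturality f
  rightUnitor_naturality f := rightUnitIso_naturality f
  pentagon M N P Q := assocIso_pentagon M N P Q
  triangle M N := assocIso_triangle M N

lemma braidIso_naturality_left {M M' : Mod D A} (f : M ⟶ M') (N : Mod D A) :
    tmap f (𝟙 N) ≫ (braidIso M' N).hom = (braidIso M N).hom ≫ tmap (𝟙 N) f := by
  ext
  rw [← cancel_epi (ten M N), Mod.comp_hom', Mod.comp_hom', reassoc_of% @ten_tmap_id_right]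
  simp only [braidIso, ten_braidHom, reassoc_of% @ten_braidHom, ten_tmap_id_left,
    BraidedCategory.braiding_naturality_left_assoc]

lemma braidIso_naturality_right (M : Mod D A) {N N' : Mod D A} (f : N ⟶ N') :
    tmap (𝟙 M) f ≫ (braidIso M N').hom = (braidIso M N).hom ≫ tmap f (𝟙 M) := by
  ext
  rw [← cancel_epi (ten M N), Mod.comp_hom', Mod.comp_hom', reassoc_of% @ten_tmap_id_left]
  simp only [braidIso, ten_braidHom, reassoc_of% @ten_braidHom, ten_tmap_id_right,
    BraidedCategory.braiding_naturality_right_assoc]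

lemma braidIso_hexagon (M N P : Mod D A) :
    (assocIso M N P).hom ≫ (braidIso M (tensorMod N P)).hom ≫ (assocIso N P M).hom =
      tmap (braidIso M N).hom (𝟙 P) ≫ (assocIso N M P).hom ≫ tmap (𝟙 N) (braidIso M P).hom := by
  ext
  have b (X Y : Mod D A) : ten X Y ≫ (braidIso X Y).hom.hom = (β_ X.X Y.X).hom ≫ ten Y X :=
    ten_braidHom X Y
  rw [← cancel_epi (ten (tensorMod M N) P), ← cancel_epi (ten M N ▷ P.X)]
  simp only [Mod.comp_hom']
  rw [reassoc_of% @ten_assocIso, reassoc_of% @b, reassoc_of% @ten_tmap_id_right,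
    BraidedCategory.braiding_naturality_right_assoc, ten_assocIso, ← comp_whiskerRight_assoc,
    b, comp_whiskerRight_assoc, reassoc_of% @ten_assocIso, ten_tmap_id_left,
    ← whiskerLeft_comp_assoc, b, whiskerLeft_comp_assoc, BraidedCategory.hexagon_forward_assoc]

lemma braidIso_hexagon_reverse (M N P : Mod D A) :
    (assocIso M N P).inv ≫ (braidIso (tensorMod M N) P).hom ≫ (assocIso P M N).inv =
      tmap (𝟙 M) (braidIso N P).hom ≫ (assocIso M P N).inv ≫ tmap (braidIso M P).hom (𝟙 N) := by
  have h := braidIso_hexagon P M N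
  have e1 : tmap (braidIso M P).hom (𝟙 N) ≫ tmap (braidIso P M).hom (𝟙 N) = 𝟙 _ := by
    rw [tmap_comp, Category.comp_id, ← tmap_id]
    exact congrArg (fun f ↦ tmap f (𝟙 N)) (braidIso M P).hom_inv_id
  have e2 : tmap (𝟙 M) (braidIso N P).hom ≫ tmap (𝟙 M) (braidIso P N).hom = 𝟙 _ := by
    rw [tmap_comp, Category.comp_id, ← tmap_id]
    exact congrArg (fun f ↦ tmap (𝟙 M) f) (braidIso N P).hom_inv_id
  have e3 : (braidIso (tensorMod M N) P).hom ≫ (braidIso P (tensorMod M N)).hom = 𝟙 _ :=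
    (braidIso (tensorMod M N) P).hom_inv_id
  rw [← cancel_mono (assocIso P M N).hom, ← cancel_mono (braidIso P (tensorMod M N)).hom,
    ← cancel_mono (assocIso M N P).hom]
  simp only [Category.assoc, Iso.inv_hom_id_assoc, Category.id_comp, h, reassoc_of% e1,
    reassoc_of% e3, e2, Iso.inv_hom_id]

/-- The tensor product of modules over a commutative monoid is symmetric. -/
noncomputable instance : SymmetricCategory (Mod D A) where
  braiding M N := braidIso M N
  braiding_naturality_right M _ _ f := braidIso_naturality_right M f
  braiding_naturality_left f N := braidIso_naturality_left f N
  hexagon_forward M N P := braidIso_hexagon M N P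
  hexagon_reverse M N P := braidIso_hexagon_reverse M N P
  symmetry M N := (braidIso M N).hom_inv_id

variable {B : D} [MonObj B] [IsCommMonObj B] (f : A ⟶ B) [IsMonHom f]

/-- Restriction of scalars along a morphism `f : A ⟶ B` of commutative monoids: the action of `A`
on a `B`-module `N` is `A ⊗ N ⟶ B ⊗ N ⟶ N`. -/
abbrev restr (N : Mod D B) : Mod D A :=
  mkMod N.X (f ▷ N.X ≫ act N)
    (by rw [← comp_whiskerRight_assoc, IsMonHom.one_hom, one_act])
    (by
      rw [← comp_whiskerRight_assoc, IsMonHom.mul_hom, comp_whiskerRight_assoc, mul_act,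
        MonoidalCategory.tensorHom_def]
      simp only [comp_whiskerRight, Category.assoc, whiskerLeft_comp]
      rw [associator_naturality_middle_assoc, associator_naturality_left_assoc,
        whisker_exchange_assoc, whisker_exchange_assoc])

/-- A `B`-linear morphism is `A`-linear after restriction of scalars. -/
abbrev restrMap {N N' : Mod D B} (g : N ⟶ N') : restr f N ⟶ restr f N' :=
  mkHom g.hom (by
    change (f ▷ N.X ≫ act N) ≫ g.hom = A ◁ g.hom ≫ f ▷ N'.X ≫ act N'
    rw [Category.assoc, act_hom, whisker_exchange_assoc])

/-- The monoid `B`, as an `A`-module along `f : A ⟶ B`. -/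
abbrev algMod : Mod D A := mkMod B (f ▷ B ≫ μ[B])
    (one_act (restr f (Mod.regular B))) (mul_act (restr f (Mod.regular B)))

lemma act_restr (N : Mod D B) : act (restr f N) = f ▷ N.X ≫ act N := rfl

lemma ract_restr (N : Mod D B) : ract (restr f N) = N.X ◁ f ≫ ract N := by
  rw [ract, act_restr, ract, BraidedCategory.braiding_naturality_right_assoc]

lemma ract_algMod : ract (algMod f) = B ◁ f ≫ μ[B] := by
  exact (ract_restr f (Mod.regular B)).trans (congrArg (B ◁ f ≫ ·) ract_regular)

/-- Semilinearity of a morphism from an `A`-module to a `B`-module, along `A ⟶ B`. -/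
def Semilinear {M : Mod D A} {N : Mod D B} (φ : M.X ⟶ N.X) : Prop :=
  act M ≫ φ = A ◁ φ ≫ f ▷ N.X ≫ act N

/-- The universal balanced morphism `B ⊗ M ⟶ B ⊗_A M`. -/
noncomputable def bten (M : Mod D A) : B ⊗ M.X ⟶ (tensorMod (algMod f) M).X := ten (algMod f) M

instance (M : Mod D A) : Epi (bten f M) := inferInstanceAs (Epi (ten (algMod f) M))

lemma bten_act (M : Mod D A) : A ◁ bten f M ≫ act (tensorMod (algMod f) M) =
    (α_ A B M.X).inv ≫ (f ▷ B ≫ μ[B]) ▷ M.X ≫ bten f M :=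
  ten_act (algMod f) M

/-- The morphism `B ⊗_A M ⟶ N`, `b ⊗ m ↦ b φ(m)`, induced by a semilinear morphism
`φ : M ⟶ N`. -/
noncomputable def baseChangeHom {M : Mod D A} {N : Mod D B} (φ : M.X ⟶ N.X)
    (h : Semilinear f φ) : (tensorMod (algMod f) M).X ⟶ N.X :=
  desc (M := algMod f) (N := M) (B ◁ φ ≫ act N) (by
    have e : (B ◁ f ≫ μ[B]) ▷ M.X ≫ B ◁ φ ≫ act N =
        (α_ B A M.X).hom ≫ B ◁ act M ≫ B ◁ φ ≫ act N := by
      unfold Semilinear at h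
      rw [← whiskerLeft_comp_assoc, h, comp_whiskerRight_assoc, ← whisker_exchange_assoc, mul_act,
        associator_naturality_right_assoc, associator_naturality_middle_assoc,
        whisker_exchange_assoc]
      simp only [whiskerLeft_comp, Category.assoc]
    unfold Balanced
    rw [ract_algMod]
    exact e)

@[simp]
lemma bten_baseChangeHom {M : Mod D A} {N : Mod D B} (φ : M.X ⟶ N.X) (h : Semilinear f φ) :
    bten f M ≫ baseChangeHom f φ h = B ◁ φ ≫ act N :=
  ten_desc (M := algMod f) (N := M) _ _

/-- The morphism `baseChangeHom` is `A`-linear. -/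
noncomputable def baseChangeMap {M : Mod D A} {N : Mod D B} (φ : M.X ⟶ N.X)
    (h : Semilinear f φ) : tensorMod (algMod f) M ⟶ restr f N :=
  mkHom (baseChangeHom f φ h) (by
    change _ = A ◁ baseChangeHom f φ h ≫ f ▷ N.X ≫ act N
    rw [← cancel_epi (A ◁ bten f M), reassoc_of% @bten_act, ← whiskerLeft_comp_assoc,
      bten_baseChangeHom, comp_whiskerRight_assoc, ← whisker_exchange_assoc, mul_act,
      whiskerLeft_comp_assoc, associator_naturality_right_assoc, associator_naturality_left_assoc,
      Iso.inv_hom_id_assoc, whisker_exchange_assoc, whisker_exchange_assoc])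

/-- `N` is the base change of `M` along `φ`: the morphism `B ⊗_A M ⟶ N` is an isomorphism. -/
def IsBaseChange {M : Mod D A} {N : Mod D B} (φ : M.X ⟶ N.X) : Prop :=
  ∃ h : Semilinear f φ, IsIso (baseChangeMap f φ h)

lemma semilinear_regular : Semilinear f (M := Mod.regular A) (N := Mod.regular B) f := by
  change μ[A] ≫ f = A ◁ f ≫ f ▷ B ≫ μ[B]
  rw [IsMonHom.mul_hom, MonoidalCategory.tensorHom_def, Category.assoc, ← whisker_exchange_assoc]

lemma isBaseChange_regular : IsBaseChange f (M := Mod.regular A) (N := Mod.regular B) f := by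
  refine ⟨semilinear_regular f, ?_⟩
  have h : baseChangeMap f (M := Mod.regular A) (N := Mod.regular B) f (semilinear_regular f) =
      (rightUnitIso (algMod f)).hom := by
    ext
    have h1 := bten_baseChangeHom f (M := Mod.regular A) (N := Mod.regular B) f
      (semilinear_regular f)
    have h2 := rten_rightUnitIso (algMod f)
    rw [ract_algMod] at h2
    exact (cancel_epi (bten f (Mod.regular A))).1 (h1.trans h2.symm)
  rw [h]
  exact (rightUnitIso (algMod f)).isIso_hom

lemma bten_tmap {M M' : Mod D A} (g : M ⟶ M') :
    bten f M ≫ (tmap (𝟙 (algMod f)) g).hom = B ◁ g.hom ≫ bten f M' :=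
  ten_tmap_id_left (algMod f) g

/-- Restriction of scalars of an isomorphism. -/
abbrev restrIso {N N' : Mod D B} (e : N ≅ N') : restr f N ≅ restr f N' where
  hom := restrMap f e.hom
  inv := restrMap f e.inv
  hom_inv_id := by
    ext
    exact congrArg (fun g : N ⟶ N ↦ g.hom) e.hom_inv_id
  inv_hom_id := by
    ext
    exact congrArg (fun g : N' ⟶ N' ↦ g.hom) e.inv_hom_id

variable {f} in
lemma IsBaseChange.of_iso {M M' : Mod D A} {N N' : Mod D B} {φ : M.X ⟶ N.X}
    (hφ : IsBaseChange f φ) (e : M ≅ M') (e' : N ≅ N') {ψ : M'.X ⟶ N'.X}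
    (w : φ ≫ e'.hom.hom = e.hom.hom ≫ ψ) : IsBaseChange f ψ := by
  obtain ⟨h, hi⟩ := hφ
  have : IsIso e.hom.hom := inferInstanceAs (IsIso ((Mod.forget (D := D) A).map e.hom))
  have hψ : Semilinear f ψ := by
    unfold Semilinear at h ⊢
    rw [← cancel_epi (A ◁ e.hom.hom), ← reassoc_of% (act_hom e.hom), ← w, reassoc_of% h,
      ← whiskerLeft_comp_assoc, ← w, whiskerLeft_comp_assoc, act_hom,
      whisker_exchange_assoc f e'.hom.hom]
  refine ⟨hψ, ?_⟩
  have key : tmap (𝟙 (algMod f)) e.hom ≫ baseChangeMap f ψ hψ =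
      baseChangeMap f φ h ≫ (restrIso f e').hom := by
    ext
    refine (cancel_epi (bten f M)).1 ?_
    change bten f M ≫ (tmap (𝟙 (algMod f)) e.hom).hom ≫ baseChangeHom f ψ hψ =
      bten f M ≫ baseChangeHom f φ h ≫ e'.hom.hom
    rw [reassoc_of% @bten_tmap, reassoc_of% @bten_baseChangeHom, bten_baseChangeHom,
      ← whiskerLeft_comp_assoc, ← w, act_hom, whiskerLeft_comp_assoc]
  have h1 : IsIso (tmap (𝟙 (algMod f)) e.hom) :=
    inferInstanceAs (IsIso ((tensorLeft (algMod f)).map e.hom))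
  have h2 : IsIso (tmap (𝟙 (algMod f)) e.hom ≫ baseChangeMap f ψ hψ) := by
    rw [key]
    exact IsIso.comp_isIso' hi (restrIso f e').isIso_hom
  exact IsIso.of_isIso_comp_left (tmap (𝟙 (algMod f)) e.hom) _

section Tensor

variable {M N : Mod D A} {M' N' : Mod D B} (φ : M.X ⟶ M'.X) (ψ : N.X ⟶ N'.X)

/-- The morphism `M' ⊗_A N ⟶ M' ⊗_B N'` induced by a semilinear `ψ : N ⟶ N'`. -/
noncomputable def mixHom (hψ : Semilinear f ψ) (M' : Mod D B) :
    (tensorMod (restr f M') N).X ⟶ (tensorMod M' N').X :=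
  desc (M := restr f M') (M'.X ◁ ψ ≫ ten M' N') (by
    unfold Balanced
    rw [ract_restr]
    change _ = (α_ M'.X A N.X).hom ≫ M'.X ◁ act N ≫ M'.X ◁ ψ ≫ ten M' N'
    unfold Semilinear at hψ
    rw [← whiskerLeft_comp_assoc, hψ, comp_whiskerRight_assoc, ← whisker_exchange_assoc,
      ten_condition, associator_naturality_right_assoc, associator_naturality_middle_assoc,
      whisker_exchange_assoc]
    simp only [whiskerLeft_comp, Category.assoc])

/-- The universal balanced morphism `M' ⊗ N ⟶ M' ⊗_A N`. -/
noncomputable def mten (M' : Mod D B) (N : Mod D A) :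
    M'.X ⊗ N.X ⟶ (tensorMod (restr f M') N).X := ten (restr f M') N

instance (M' : Mod D B) (N : Mod D A) : Epi (mten f M' N) :=
  inferInstanceAs (Epi (ten (restr f M') N))

lemma mten_condition (M' : Mod D B) (N : Mod D A) :
    (M'.X ◁ f ≫ ract M') ▷ N.X ≫ mten f M' N =
      (α_ M'.X A N.X).hom ≫ M'.X ◁ act N ≫ mten f M' N := by
  have h := ten_condition (restr f M') N
  rw [ract_restr] at h
  exact h

lemma mten_mixHom (hψ : Semilinear f ψ) (M' : Mod D B) :
    mten f M' N ≫ mixHom f ψ hψ M' = M'.X ◁ ψ ≫ ten M' N' :=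
  ten_desc (M := restr f M') (N := N) _ _

variable {f} in
lemma isIso_mixHom (hψ : IsBaseChange f ψ) (M' : Mod D B) : IsIso (mixHom f ψ hψ.1 M') := by
  obtain ⟨h, hi⟩ := hψ
  have hb : IsIso (baseChangeHom f ψ h) :=
    inferInstanceAs (IsIso ((Mod.forget (D := D) A).map (baseChangeMap f ψ h)))
  have w : M'.X ◁ (ract (algMod f) ▷ N.X) ≫ (α_ M'.X B N.X).inv ≫ ract M' ▷ N.X ≫ mten f M' N =
      M'.X ◁ (α_ B A N.X).hom ≫ M'.X ◁ (B ◁ act N) ≫ (α_ M'.X B N.X).inv ≫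
        ract M' ▷ N.X ≫ mten f M' N := by
    have e1 : M'.X ◁ ract (algMod f) ≫ ract M' =
        (α_ M'.X B A).inv ≫ ract M' ▷ A ≫ M'.X ◁ f ≫ ract M' := by
      rw [ract_algMod, whiskerLeft_comp_assoc, ract_mul, associator_inv_naturality_right_assoc,
        whisker_exchange_assoc]
    have e2 : (M'.X ◁ ract (algMod f)) ▷ N.X ≫ ract M' ▷ N.X =
        (α_ M'.X B A).inv ▷ N.X ≫ ract M' ▷ A ▷ N.X ≫ (M'.X ◁ f ≫ ract M') ▷ N.X := by
      simp only [← comp_whiskerRight, e1]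
    have e3 : M'.X ◁ (ract (algMod f) ▷ N.X) ≫ (α_ M'.X B N.X).inv =
        (α_ M'.X (B ⊗ A) N.X).inv ≫ (M'.X ◁ ract (algMod f)) ▷ N.X :=
      associator_inv_naturality_middle _ _ _
    rw [reassoc_of% e3, reassoc_of% e2, mten_condition, associator_naturality_left_assoc,
      associator_inv_naturality_right_assoc, whisker_exchange_assoc]
    monoidal
  let y : M'.X ⊗ N'.X ⟶ (tensorMod (restr f M') N).X :=
    M'.X ◁ inv (baseChangeHom f ψ h) ≫ descL (M := algMod f) (N := N) _ w
  have hy : M'.X ◁ (B ◁ ψ ≫ act N') ≫ y = (α_ M'.X B N.X).inv ≫ ract M' ▷ N.X ≫ mten f M' N := by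
    rw [← bten_baseChangeHom f ψ h]
    simp only [y, ← whiskerLeft_comp_assoc, Category.assoc, IsIso.hom_inv_id, Category.comp_id]
    exact ten_descL (M := algMod f) (N := N) _ w
  have epi : Epi (B ◁ ψ ≫ act N') := by
    rw [← bten_baseChangeHom f ψ h]
    infer_instance
  have hψy : M'.X ◁ ψ ≫ y = mten f M' N := by
    have e : ψ = (λ_ N.X).inv ≫ η[B] ▷ N.X ≫ B ◁ ψ ≫ act N' := by
      rw [← whisker_exchange_assoc, one_act, leftUnitor_naturality, Iso.inv_hom_id_assoc]
    have e2 : M'.X ◁ ψ ≫ y = M'.X ◁ (λ_ N.X).inv ≫ M'.X ◁ (η[B] ▷ N.X) ≫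
        M'.X ◁ (B ◁ ψ ≫ act N') ≫ y := by
      simp only [← whiskerLeft_comp_assoc, ← e]
    rw [e2, hy, associator_inv_naturality_middle_assoc, ← comp_whiskerRight_assoc, ract_one]
    monoidal
  have hyb : Balanced M' N' y := by
    have e1 : B ◁ (B ◁ ψ ≫ act N') ≫ act N' =
        (α_ B B N.X).inv ≫ μ[B] ▷ N.X ≫ B ◁ ψ ≫ act N' := by
      rw [← whisker_exchange_assoc, mul_act, associator_naturality_right_assoc,
        Iso.inv_hom_id_assoc, whiskerLeft_comp_assoc]
    have e2 : M'.X ◁ (B ◁ (B ◁ ψ ≫ act N')) ≫ M'.X ◁ act N' ≫ y =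
        M'.X ◁ (α_ B B N.X).inv ≫ M'.X ◁ (μ[B] ▷ N.X) ≫ M'.X ◁ (B ◁ ψ ≫ act N') ≫ y := by
      simp only [← whiskerLeft_comp_assoc, e1]
    have e3 : (M'.X ◁ μ[B]) ▷ N.X ≫ ract M' ▷ N.X = (α_ M'.X B B).inv ▷ N.X ≫
        ract M' ▷ B ▷ N.X ≫ ract M' ▷ N.X := by
      simp only [← comp_whiskerRight, ract_mul]
    unfold Balanced
    rw [← cancel_epi ((M'.X ⊗ B) ◁ (B ◁ ψ ≫ act N')), whisker_exchange_assoc, hy,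
      associator_naturality_right_assoc, e2, hy, associator_inv_naturality_middle_assoc,
      reassoc_of% e3]
    monoidal
  refine ⟨desc y hyb, ?_, ?_⟩
  · rw [← cancel_epi (mten f M' N), reassoc_of% @mten_mixHom, ten_desc, hψy, Category.comp_id]
  · rw [← cancel_epi (ten M' N'), reassoc_of% @ten_desc, ← cancel_epi (M'.X ◁ (B ◁ ψ ≫ act N')),
      reassoc_of% hy, mten_mixHom, ← whisker_exchange_assoc, ten_condition,
      associator_naturality_right_assoc, Iso.inv_hom_id_assoc, ← whiskerLeft_comp_assoc,
      Category.comp_id]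

/-- Base changes are compatible with tensor products: if `M'` and `N'` are the base changes of `M`
and `N`, then `M' ⊗_B N'` is the base change of `M ⊗_A N`. -/
lemma isBaseChange_tensor (hφ : IsBaseChange f φ) (hψ : IsBaseChange f ψ)
    (θ : (tensorMod M N).X ⟶ (tensorMod M' N').X)
    (hθ : ten M N ≫ θ = (φ ⊗ₘ ψ) ≫ ten M' N') : IsBaseChange f θ := by
  obtain ⟨hφ, hi⟩ := hφ
  obtain ⟨hψ, hj⟩ := hψ
  have hx : IsIso (mixHom f ψ hψ M') := isIso_mixHom ψ ⟨hψ, hj⟩ M'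
  have hs : Semilinear f θ := by
    unfold Semilinear at hφ hψ ⊢
    rw [← cancel_epi (A ◁ ten M N), reassoc_of% @ten_act, hθ, ← whiskerLeft_comp_assoc, hθ,
      whiskerLeft_comp_assoc, whisker_exchange_assoc, ten_act,
      associator_inv_naturality_left_assoc, MonoidalCategory.tensorHom_def, Category.assoc,
      ← comp_whiskerRight_assoc, hφ, whiskerLeft_comp_assoc,
      associator_inv_naturality_right_assoc, whisker_exchange_assoc, whisker_exchange_assoc,
      associator_inv_naturality_middle_assoc, whisker_exchange_assoc (act M'),
      ← comp_whiskerRight_assoc (A ◁ φ), whisker_exchange]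
    simp only [comp_whiskerRight, Category.assoc]
  refine ⟨hs, ?_⟩
  have h1 : IsIso (tmap (baseChangeMap f φ hφ) (𝟙 N)).hom :=
    inferInstanceAs (IsIso ((Mod.forget (D := D) A).map
      ((tensorRight N).map (baseChangeMap f φ hφ))))
  have h0 : IsIso (assocIso (algMod f) M N).hom.hom :=
    inferInstanceAs (IsIso ((Mod.forget (D := D) A).map (assocIso (algMod f) M N).hom))
  have e1 : bten f M ▷ N.X ≫ ten (tensorMod (algMod f) M) N ≫
      (tmap (baseChangeMap f φ hφ) (𝟙 N)).hom = (B ◁ φ ≫ act M') ▷ N.X ≫ mten f M' N := by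
    have e := ten_tmap_id_right (baseChangeMap f φ hφ) N
    refine (congrArg (bten f M ▷ N.X ≫ ·) e).trans ?_
    change bten f M ▷ N.X ≫ baseChangeHom f φ hφ ▷ N.X ≫ mten f M' N = _
    rw [← comp_whiskerRight_assoc, bten_baseChangeHom]
  have e2 : bten f M ▷ N.X ≫ ten (tensorMod (algMod f) M) N ≫
      (assocIso (algMod f) M N).hom.hom =
      (α_ B M.X N.X).hom ≫ B ◁ ten M N ≫ bten f (tensorMod M N) :=
    ten_assocIso (algMod f) M N
  have key : (assocIso (algMod f) M N).hom.hom ≫ baseChangeHom f θ hs =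
      (tmap (baseChangeMap f φ hφ) (𝟙 N)).hom ≫ mixHom f ψ hψ M' := by
    rw [← cancel_epi (ten (tensorMod (algMod f) M) N), ← cancel_epi (bten f M ▷ N.X),
      reassoc_of% e1, reassoc_of% e2, bten_baseChangeHom, mten_mixHom, ← whiskerLeft_comp_assoc,
      hθ, whiskerLeft_comp_assoc, ten_act, MonoidalCategory.tensorHom_def, whiskerLeft_comp_assoc,
      associator_inv_naturality_right_assoc, associator_inv_naturality_middle_assoc,
      Iso.hom_inv_id_assoc, comp_whiskerRight_assoc, whisker_exchange_assoc]
  have h2 : IsIso ((assocIso (algMod f) M N).hom.hom ≫ baseChangeHom f θ hs) := by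
    rw [key]
    exact IsIso.comp_isIso' h1 hx
  have h3 : IsIso (baseChangeHom f θ hs) :=
    IsIso.of_isIso_comp_left (assocIso (algMod f) M N).hom.hom _
  exact isIso_of_hom (baseChangeMap f θ hs) h3

end Tensor

end ModuleTensor

section PresheafModules

set_option linter.unusedSectionVars false

attribute [local instance] epi_whiskerLeft epi_whiskerRight

variable {J : Type u₂} [Category.{v₂} J]
variable {C : Type u₁} [Category.{v₁} C] [MonoidalCategory C] [SymmetricCategory C]
variable [HasFiniteColimits C] [∀ X : C, PreservesFiniteColimits (tensorLeft X)]

instance (F : J ⥤ C) : PreservesFiniteColimits (tensorLeft F) :=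
  preservesFiniteColimits_of_evaluation _ fun j ↦ by
    have : PreservesFiniteColimits ((evaluation J C).obj j ⋙ tensorLeft (F.obj j)) := inferInstance
    exact this

/-- The commutative monoid in presheaves given by a presheaf of commutative monoids. -/
noncomputable abbrev ringObj (R : J ⥤ CommMon C) : CommMon (J ⥤ C) :=
  (Monoidal.commMonFunctorCategoryEquivalence J C).inverse.obj R

variable (R : J ⥤ CommMon C)

/-- Modules over a presheaf of commutative monoids. Their tensor product is
computed objectwise: `(M ⊗ N)(j) = M(j) ⊗_{R(j)} N(j)`. -/
abbrev PMod := Mod (J ⥤ C) (ringObj R).X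

/-- The module of sections over `j` of a presheaf of modules. -/
noncomputable def sectionsObj (j : J) (M : PMod R) : Mod C (R.obj j).X :=
  mkMod (M.X.obj j) ((act M).app j) (congr_app (one_act M) j) (congr_app (mul_act M) j)

/-- The functor of sections over `j`. -/
noncomputable def sections (j : J) : PMod R ⥤ Mod C (R.obj j).X where
  obj M := sectionsObj R j M
  map {M N} g := mkHom (M := sectionsObj R j M) (N := sectionsObj R j N) (g.hom.app j)
    (congr_app (act_hom g) j)

/-- The underlying morphism of a morphism of commutative monoids. -/
def homX {A B : CommMon C} (f : A ⟶ B) : A.X ⟶ B.X := f.hom.hom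

instance {A B : CommMon C} (f : A ⟶ B) : IsMonHom (homX f) := f.hom.isMonHom_hom

/-- The restriction morphisms of a presheaf of modules. -/
noncomputable def resMap (M : PMod R) {i j : J} (s : i ⟶ j) : (sectionsObj R i M).X ⟶ (sectionsObj R j M).X :=
  M.X.map s

lemma semilinear_resMap (M : PMod R) {i j : J} (s : i ⟶ j) :
    Semilinear (M := sectionsObj R i M) (N := sectionsObj R j M) (homX (R.map s))
      (resMap R M s) := by
  have h : ((homX (R.map s)) ⊗ₘ resMap R M s) ≫ act (sectionsObj R j M) =
      act (sectionsObj R i M) ≫ resMap R M s := (act M).naturality s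
  unfold Semilinear
  rw [← h, MonoidalCategory.tensorHom_def', Category.assoc]

/-- A presheaf of modules is quasi-coherent when all the morphisms
`R(j) ⊗_{R(i)} M(i) ⟶ M(j)` induced by the restrictions of `M` are isomorphisms. -/
def quasiCoherent : ObjectProperty (PMod R) := fun M ↦
  ∀ ⦃i j : J⦄ (s : i ⟶ j), IsIso (baseChangeMap (M := sectionsObj R i M)
    (N := sectionsObj R j M) (homX (R.map s)) (resMap R M s) (semilinear_resMap R M s))

lemma isBaseChange_resMap {M : PMod R} (hM : quasiCoherent R M) {i j : J} (s : i ⟶ j) :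
    IsBaseChange (M := sectionsObj R i M) (N := sectionsObj R j M) (homX (R.map s))
      (resMap R M s) := ⟨_, hM s⟩

lemma quasiCoherent_regular : quasiCoherent R (Mod.regular (ringObj R).X) := fun i j s ↦
  (isBaseChange_regular (homX (R.map s))).2

/-- Evaluation at `j` of the universal balanced morphism. -/
noncomputable def tenApp (M N : PMod R) (j : J) :
    (sectionsObj R j M).X ⊗ (sectionsObj R j N).X ⟶ (sectionsObj R j (tensorMod M N)).X :=
  (ten M N).app j

lemma tenApp_balanced (M N : PMod R) (j : J) :
    Balanced (sectionsObj R j M) (sectionsObj R j N) (tenApp R M N j) :=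
  congr_app (ten_condition M N) j

/-- The comparison `M(j) ⊗_{R(j)} N(j) ⟶ (M ⊗ N)(j)`. -/
noncomputable def compHom (M N : PMod R) (j : J) :
    tensorMod (sectionsObj R j M) (sectionsObj R j N) ⟶ sectionsObj R j (tensorMod M N) :=
  mkHom (desc (tenApp R M N j) (tenApp_balanced R M N j)) (by
    have h : (R.obj j).X ◁ tenApp R M N j ≫ act (sectionsObj R j (tensorMod M N)) =
        (α_ (R.obj j).X (sectionsObj R j M).X (sectionsObj R j N).X).inv ≫
          act (sectionsObj R j M) ▷ (sectionsObj R j N).X ≫ tenApp R M N j :=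
      congr_app (ten_act M N) j
    rw [← cancel_epi ((R.obj j).X ◁ ten (sectionsObj R j M) (sectionsObj R j N)),
      reassoc_of% @ten_act, ten_desc, ← whiskerLeft_comp_assoc, ten_desc, h])

lemma ten_compHom (M N : PMod R) (j : J) :
    ten (sectionsObj R j M) (sectionsObj R j N) ≫ (compHom R M N j).hom = tenApp R M N j :=
  ten_desc _ (tenApp_balanced R M N j)

lemma isIso_compHom (M N : PMod R) (j : J) : IsIso (compHom R M N j) := by
  apply isIso_of_hom
  let l := isColimitOfHasCoequalizerOfPreservesColimit ((evaluation J C).obj j)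
    (ract M ▷ N.X) ((α_ M.X (ringObj R).X N.X).hom ≫ M.X ◁ act N)
  let k : (sectionsObj R j (tensorMod M N)).X ⟶
      (tensorMod (sectionsObj R j M) (sectionsObj R j N)).X :=
    Cofork.IsColimit.desc l (ten (sectionsObj R j M) (sectionsObj R j N)) (by
      have := ten_condition (sectionsObj R j M) (sectionsObj R j N)
      rw [← Category.assoc] at this
      exact this)
  have hk : tenApp R M N j ≫ k = ten (sectionsObj R j M) (sectionsObj R j N) :=
    Cofork.IsColimit.π_desc' l _ _
  have : Epi (tenApp R M N j) := inferInstanceAs (Epi (((evaluation J C).obj j).map (ten M N)))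
  refine ⟨k, ?_, ?_⟩
  · rw [← cancel_epi (ten (sectionsObj R j M) (sectionsObj R j N)), reassoc_of% @ten_compHom, hk,
      Category.comp_id]
  · rw [← cancel_epi (tenApp R M N j), reassoc_of% hk, ten_compHom, Category.comp_id]

lemma quasiCoherent_tensor {M N : PMod R} (hM : quasiCoherent R M) (hN : quasiCoherent R N) :
    quasiCoherent R (tensorMod M N) := fun i j s ↦ by
  have ei := isIso_compHom R M N i
  have ej := isIso_compHom R M N j
  have nat : tenApp R M N i ≫ resMap R (tensorMod M N) s =
      (resMap R M s ⊗ₘ resMap R N s) ≫ tenApp R M N j := ((ten M N).naturality s).symm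
  have e1 : (compHom R M N j).hom ≫ (inv (compHom R M N j)).hom = 𝟙 _ := by
    rw [← Mod.comp_hom', IsIso.hom_inv_id, Mod.id_hom']
  have e2 : (inv (compHom R M N j)).hom ≫ (compHom R M N j).hom = 𝟙 _ := by
    rw [← Mod.comp_hom', IsIso.inv_hom_id, Mod.id_hom']
  have h := isBaseChange_tensor (homX (R.map s)) (resMap R M s) (resMap R N s)
    (isBaseChange_resMap R hM s) (isBaseChange_resMap R hN s)
    ((compHom R M N i).hom ≫ resMap R (tensorMod M N) s ≫ (inv (compHom R M N j)).hom) (by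
      rw [reassoc_of% @ten_compHom, reassoc_of% nat, ← ten_compHom, Category.assoc, e1,
        Category.comp_id])
  exact (h.of_iso (asIso (compHom R M N i)) (asIso (compHom R M N j)) (by
    simp only [asIso_hom, Category.assoc, e2, Category.comp_id])).2

instance : (quasiCoherent R).IsMonoidal where
  prop_unit := quasiCoherent_regular R
  prop_tensor {M N} hM hN := quasiCoherent_tensor R hM hN

/-- The symmetric monoidal category of quasi-coherent modules. -/
abbrev QMod := (quasiCoherent R).FullSubcategory

end PresheafModules

section Finiteness

/-- An object `M` is finitely generated if `Hom(M, -)` commutes with colimits of small filtered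
systems of monomorphisms. -/
def IsFinGen {D : Type u₁} [Category.{v₁} D] (M : D) : Prop :=
  ∀ (J : Type w) [SmallCategory J] [IsFiltered J] (S : J ⥤ D),
    (∀ ⦃i j : J⦄ (s : i ⟶ j), Mono (S.map s)) → PreservesColimit S (coyoneda.obj (op M))

/-- Every object is a small directed colimit of finitely generated subobjects. -/
def IsLocallyFinGen (D : Type u₁) [Category.{v₁} D] : Prop :=
  ∀ M : D, ∃ (J : Type w) (_ : Preorder J) (_ : IsDirectedOrder J) (_ : Nonempty J) (S : J ⥤ D)
    (c : Cocone S) (_ : IsColimit c) (_ : c.pt ≅ M), ∀ j, IsFinGen.{w} (S.obj j) ∧ Mono (c.ι.app j)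

end Finiteness

section Geometry

variable {C : Type u} [Category.{v} C] [MonoidalCategory C] [SymmetricCategory C]

section Finiteness

/-- `A` is Noetherian if every finitely generated `A`-module is the colimit of
`0 ← A^m → A^n` for some morphism `A^m ⟶ A^n` with `m, n ≥ 1`. -/
def IsNoetherian (A : CommMon C) : Prop :=
  ∀ M : Mod C A.X, IsFinGen.{v} M →
    ∃ (m n : ℕ) (_ : 1 ≤ m) (_ : 1 ≤ n)
      (P : Cofan fun _ : Fin m ↦ Mod.regular A.X) (_ : IsColimit P)
      (Q : Cofan fun _ : Fin n ↦ Mod.regular A.X) (_ : IsColimit Q)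
      (Z : Mod C A.X) (_ : IsZero Z) (q : P.pt ⟶ Q.pt) (p : Q.pt ⟶ M)
      (t : P.pt ⟶ Z) (z : Z ⟶ M), IsPushout q t p z

/-- A field object: a nonzero Noetherian commutative monoid `K` such that every monomorphism
`I ⟶ K` of `K`-modules is an isomorphism or zero. -/
structure IsFieldObject [HasZeroMorphisms C] (K : CommMon C) : Prop where
  nonzero : ¬ IsZero K.X
  noetherian : IsNoetherian K
  mono_iso_or_zero : ∀ (I : Mod C K.X) (i : I ⟶ Mod.regular K.X), Mono i → IsIso i ∨ i.hom = 0

end Finiteness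

variable [HasFiniteColimits C] [∀ X : C, PreservesFiniteColimits (tensorLeft X)]

/-- The functor `B ⊗_A - : A-Mod ⥤ A-Mod` for a morphism `A ⟶ B` of commutative monoids. -/
noncomputable def extendScalars {A B : CommMon C} (f : A ⟶ B) : Mod C A.X ⥤ Mod C A.X :=
  tensorLeft (algMod (homX f))

/-- A morphism of commutative monoids `A ⟶ B` is a Zariski open if it is a flat epimorphism of
finite presentation. -/
structure IsZariskiOpen {A B : CommMon C} (f : A ⟶ B) : Prop where
  epi : Epi f
  flat : PreservesFiniteLimits (extendScalars f)
  finitePresentation : MorphismProperty.isFinitelyPresentable.{v} (CommMon C) f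

/-- A family of morphisms `A ⟶ B k` is conservative if a morphism `g` of `A`-modules is an
isomorphism as soon as all the `B k ⊗_A g` are. -/
def IsConservative {A : CommMon C} {κ : Type w} {B : κ → CommMon C} (f : ∀ k, A ⟶ B k) : Prop :=
  ∀ ⦃M N : Mod C A.X⦄ (g : M ⟶ N), (∀ k, IsIso ((extendScalars (f k)).map g)) → IsIso g

variable (C) in
/-- Affine schemes over `C`. -/
abbrev Aff := (CommMon C)ᵒᵖ

variable (C) in
/-- The Zariski coverings of affine schemes: families of Zariski opens with a finite conservative
subfamily. -/
def zariskiPrecoverage : Precoverage (Aff C) where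
  coverings X := {R | (∀ ⦃Y : Aff C⦄ (f : Y ⟶ X), R f → IsZariskiOpen f.unop) ∧
    ∃ (n : ℕ) (Y : Fin n → Aff C) (f : ∀ k, Y k ⟶ X), (∀ k, R (f k)) ∧
      IsConservative fun k ↦ (f k).unop}

variable (C) in
/-- The Zariski topology on affine schemes. -/
def zariskiTopology : GrothendieckTopology (Aff C) := (zariskiPrecoverage C).toGrothendieck

/-- The functor represented by an affine scheme. -/
abbrev Spec : Aff C ⥤ (Aff C)ᵒᵖ ⥤ Type (max u v) := uliftYoneda.{u}

/-- The image of `∐ Y i ⟶ X` in the category of sheaves, as a subfunctor of `X`. -/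
def sheafImage {X : (Aff C)ᵒᵖ ⥤ Type (max u v)} {κ : Type w} {Y : κ → (Aff C)ᵒᵖ ⥤ Type (max u v)}
    (f : ∀ k, Y k ⟶ X) : Subfunctor X :=
  (⨆ k, Subfunctor.range (f k)).sheafify (zariskiTopology C)

/-- A subfunctor of an affine scheme is a Zariski open if it is the sheaf image of a family of
affine Zariski opens. -/
def IsOpenSubfunctor {A : Aff C} (V : Subfunctor (Spec.obj A)) : Prop :=
  ∃ (κ : Type (max u v)) (B : κ → Aff C) (f : ∀ k, B k ⟶ A),
    (∀ k, IsZariskiOpen (f k).unop) ∧ V = sheafImage fun k ↦ Spec.map (f k)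

/-- A morphism `f : Y ⟶ X` is a Zariski open immersion if, for every affine scheme `A` over `X`,
the base change `Y ×_X A ⟶ A` is a monomorphism whose image is a Zariski open of `A`. -/
def IsOpenImm {Y X : (Aff C)ᵒᵖ ⥤ Type (max u v)} (f : Y ⟶ X) : Prop :=
  ∀ (A : Aff C) (x : Spec.obj A ⟶ X),
    Mono (pullback.snd f x) ∧ IsOpenSubfunctor (Subfunctor.range (pullback.snd f x))

/-- Sheaves of sets on the Zariski site of affine schemes. -/
abbrev ZarSheaf (C : Type u) [Category.{v} C] [MonoidalCategory C] [SymmetricCategory C]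
    [HasFiniteColimits C] [∀ X : C, PreservesFiniteColimits (tensorLeft X)] :=
  Sheaf (zariskiTopology C) (Type (max u v))

variable (X : ZarSheaf C)

/-- An affine cover of `X`: Zariski open immersions `Spec (A k) ⟶ X` such that
`∐ Spec (A k) ⟶ X` is an epimorphism of sheaves. -/
structure IsAffineCover {κ : Type w} {A : κ → Aff C} (f : ∀ k, Spec.obj (A k) ⟶ X.obj) : Prop where
  openImm : ∀ k, IsOpenImm (f k)
  epi : sheafImage f = ⊤

/-- A scheme over `C` is a sheaf admitting an affine cover. -/
def IsScheme : Prop :=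
  ∃ (κ : Type (max u v)) (A : κ → Aff C) (f : ∀ k, Spec.obj (A k) ⟶ X.obj), IsAffineCover X f

/-- Every affine cover has a finite subcover. -/
def IsQuasiCompact : Prop :=
  ∀ (κ : Type (max u v)) (A : κ → Aff C) (f : ∀ k, Spec.obj (A k) ⟶ X.obj), IsAffineCover X f →
    ∃ s : Set κ, s.Finite ∧ IsAffineCover X fun k : s ↦ f k

/-- The category of Zariski open immersions `U ⟶ X` with `U` affine. -/
abbrev ZarAff := ObjectProperty.FullSubcategory
  (C := CostructuredArrow (Spec (C := C)) X.obj) fun U ↦ IsOpenImm U.hom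

variable {X} in
/-- The structure morphism `U ⟶ X`. -/
abbrev ZarAff.imm (U : ZarAff X) : Spec.obj U.obj.left ⟶ X.obj := U.obj.hom

variable {X} in
/-- The structure sheaf `ZarAff(X)ᵒᵖ ⥤ Comm(C)`, `(Spec A ⟶ X) ↦ A`. -/
abbrev structureSheaf : (ZarAff X)ᵒᵖ ⥤ CommMon C :=
  (ObjectProperty.ι _ ⋙ CostructuredArrow.proj (Spec (C := C)) X.obj).leftOp

/-- The fibre product of two objects of `ZarAff(X)` lies in `ZarAff(X)`. -/
def IsSemiSeparated : Prop :=
  ∀ U V : ZarAff X, ∃ (W : ZarAff X) (a : W ⟶ U) (b : W ⟶ V),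
    IsPullback (Spec.map a.hom.left) (Spec.map b.hom.left) U.imm V.imm

/-- For all affine opens `Spec A ⟶ X`, the commutative monoid `A` is Noetherian. -/
def IsNoetherianScheme : Prop :=
  ∀ U : ZarAff X, IsNoetherian ((structureSheaf (X := X)).obj (op U))

/-- Quasi-coherent modules on `X`, with `(M ⊗ N)(U) = M(U) ⊗_{O(U)} N(U)`. -/
abbrev QCoh := QMod (structureSheaf (X := X))

variable {X} in
/-- The ring `O(U)`. -/
abbrev ringOf (U : ZarAff X) : CommMon C := structureSheaf.obj (op U)

variable {X} in
/-- The pullback `i^* : QCoh(X) ⥤ QCoh(U) = O(U)-Mod`, `M ↦ M(U)`, for `i : U ⟶ X` in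
`ZarAff(X)`. -/
noncomputable def pullbackTo (U : ZarAff X) : QCoh X ⥤ Mod C (ringOf U).X :=
  (quasiCoherent _).ι ⋙ sections structureSheaf (op U)

end Geometry

/-- Let `L : E ⥤ D` have a fully faithful right adjoint `R`, i.e. the counit of `L ⊣ R` is an
isomorphism. A functor `F` on `E` is local with respect to `L ⊣ R` if `F` applied to the unit is
an isomorphism `F ⟶ F R L`. -/
def IsLocalFor {E : Type u₁} [Category.{v₁} E] {D : Type u₂} [Category.{v₂} D]
    {T : Type u₃} [Category.{v₃} T] (L : E ⥤ D) (F : E ⥤ T) : Prop :=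
  ∃ (R : D ⥤ E) (adj : L ⊣ R), IsIso adj.counit ∧ IsIso (Functor.whiskerRight adj.unit F)

end RelAG

open CategoryTheory MonoidalCategory Limits

/-!
The functor `F` sees an ideal of `O_X` only through whether `F` inverts it. Let `ε : I ⟶ O_X` be a
monomorphism. Multiplication `I ⊗ I ⟶ I` can be written as `ε ⊗ I` and as `I ⊗ ε`, and `F` carries
this symmetry to the morphism `F ε : F I ⟶ K`. If `F ε` is an epimorphism, the symmetry forces its
kernel to vanish (`mono_of_whiskerRight_comp_leftUnitor_hom`), so `F ε` is an isomorphism; otherwise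
the image of `F ε` is a proper ideal of the field object `K`, hence zero, and `F ε = 0`. If for every member
`U k` of a finite affine cover there were an ideal `I k` with `I k = O_X` on `U k` and killed by
`F`, then `∐ I k ⟶ O_X` would be an epimorphism killed by the right exact functor `F`, and `K` would
vanish. Hence some member `U` of the cover is such that `F` inverts every ideal which is trivial on
`U` (`IsFieldObject.exists_isIso_map`).

It remains to pass from ideals to modules. As `F` is right exact and restriction to `U` is exact, it
suffices to show that `F` inverts `M ⟶ P` for all exact sequences `0 ⟶ M ⟶ P ⟶ Q ⟶ 0` such that
`Q` vanishes on `U` (`isIso_map_of_isIso_map`). Suppose first that the sections of `Q` over the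
members `V` of the cover are finitely generated. As `X` is Noetherian, these sections are quotients
of finite free modules, and the finitely many generators correspond by adjunction to morphisms from
`O_X` to the direct images of the modules `Q(V)`. Let `I` be the common kernel of these morphisms.
It annihilates `Q`, and it is trivial on `U`, since base change shows that the direct images vanish
there (`IsAffineCover.exists_annihilator`). Hence multiplication `I ⊗ P ⟶ P` factors through `M`,
and inverting `F(I) ⟶ F(O_X)` one obtains that `F M ⟶ F P` is an isomorphism
(`isIso_map_of_annihilator`).

In general, `Q(V)` is a filtered union of finitely generated submodules `G` for each `V`, and `Q` is
the filtered union of the submodules `Q ×_{j_* Q(V)} j_* G`, with sections `G` over `V`. Treating the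
members `V` one at a time, and pulling back the extension `P` of `Q` to these submodules, one reduces
to the finitely generated case, since `F` commutes with filtered colimits
(`InvertsFinGen.of_univ`).

The geometric input is as follows. Inclusions of affine opens are flat and the members of an affine
cover are jointly conservative. Both are seen by comparing the Zariski topology with the topology in
which a sieve is covering when the flat morphisms in it are jointly conservative, which is a topology
because flat morphisms and their base changes satisfy the base change formula along pushouts of
commutative monoids (`zariskiTopology_le_flatTopology`, `flat_resRing`, `IsAffineCover.isIso`).
Quasi-coherent modules therefore form an abelian category with exact sections functors, and for
semi-separated `X` the direct image of an `O(U)`-module `N` along an affine open `U`, whose sections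
over `V` are `O(U ∩ V) ⊗_{O(U)} N`, is again quasi-coherent, and is a fully faithful right adjoint of
the restriction to `U` (`JoinsWith.dirAdj`). In particular `M ⟶ i_* i^* M` restricts to an
isomorphism on `U`, so that `F`, which inverts the morphisms inverted by `i^*`, is `i`-local.
-/

namespace RelAG

open CategoryTheory MonoidalCategory Limits MonObj Opposite

/-! ### Limits, colimits and exactness for modules over a commutative monoid -/

section ModLimits

set_option linter.unusedSectionVars false

variable {D : Type u₁} [Category.{v₁} D] [MonoidalCategory D] [SymmetricCategory D]
  [HasCoequalizers D] [∀ X : D, PreservesFiniteColimits (tensorLeft X)]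
variable {A : D} [MonObj A] [IsCommMonObj A]

instance : (Mod.forget (D := D) A).ReflectsIsomorphisms where
  reflects f h := isIso_of_hom f h

section Limit

variable {J : Type u₂} [Category.{v₂} J] {K : J ⥤ Mod D A}

/-- The projections of a cone over the underlying objects of a diagram of modules. -/
def coneπ (c : Cone (K ⋙ Mod.forget A)) (j : J) : c.pt ⟶ (K.obj j).X := c.π.app j

lemma coneπ_w (c : Cone (K ⋙ Mod.forget A)) {i j : J} (s : i ⟶ j) :
    coneπ c i ≫ (K.map s).hom = coneπ c j := c.w s

/-- Construct a morphism into the limit of the underlying objects of a diagram of modules. -/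
def limLift {c : Cone (K ⋙ Mod.forget A)} (hc : IsLimit c) {X : D} (f : ∀ j, X ⟶ (K.obj j).X)
    (hf : ∀ ⦃i j : J⦄ (s : i ⟶ j), f i ≫ (K.map s).hom = f j) : X ⟶ c.pt :=
  hc.lift ⟨X, { app := f, naturality := fun _ _ s ↦ (Category.id_comp _).trans (hf s).symm }⟩

lemma limLift_π {c : Cone (K ⋙ Mod.forget A)} (hc : IsLimit c) {X : D} (f : ∀ j, X ⟶ (K.obj j).X)
    (hf : ∀ ⦃i j : J⦄ (s : i ⟶ j), f i ≫ (K.map s).hom = f j) (j : J) :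
    limLift hc f hf ≫ coneπ c j = f j := hc.fac _ j

/-- The morphism from a cone of modules into the limit of the underlying objects. -/
def coneLift {c : Cone (K ⋙ Mod.forget A)} (hc : IsLimit c) (s : Cone K) :
    s.pt.X ⟶ c.pt := hc.lift ((Mod.forget A).mapCone s)

lemma coneLift_π {c : Cone (K ⋙ Mod.forget A)} (hc : IsLimit c) (s : Cone K) (j : J) :
    coneLift hc s ≫ coneπ c j = (s.π.app j).hom := hc.fac _ j

lemma lim_hom_ext {c : Cone (K ⋙ Mod.forget A)} (hc : IsLimit c) {X : D} {f g : X ⟶ c.pt}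
    (h : ∀ j, f ≫ coneπ c j = g ≫ coneπ c j) : f = g := hc.hom_ext h

/-- The action on the limit of the underlying objects of a diagram of modules. -/
noncomputable def limAct {c : Cone (K ⋙ Mod.forget A)} (hc : IsLimit c) : A ⊗ c.pt ⟶ c.pt :=
  limLift hc (fun j ↦ A ◁ coneπ c j ≫ act (K.obj j)) fun i j s ↦ by
    rw [Category.assoc, act_hom, ← whiskerLeft_comp_assoc, coneπ_w]

lemma limAct_π {c : Cone (K ⋙ Mod.forget A)} (hc : IsLimit c) (j : J) :
    limAct hc ≫ coneπ c j = A ◁ coneπ c j ≫ act (K.obj j) := limLift_π ..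

/-- The module structure on the limit of the underlying objects of a diagram of modules. -/
noncomputable abbrev limMod {c : Cone (K ⋙ Mod.forget A)} (hc : IsLimit c) : Mod D A :=
  mkMod c.pt (limAct hc)
    (lim_hom_ext hc fun j ↦ by
      rw [Category.assoc, limAct_π, ← whisker_exchange_assoc, one_act, leftUnitor_naturality])
    (lim_hom_ext hc fun j ↦ by
      simp only [Category.assoc, limAct_π]
      rw [← whiskerLeft_comp_assoc, limAct_π, ← whisker_exchange_assoc, mul_act]
      simp)

noncomputable instance createsLimitForget (K : J ⥤ Mod D A) :
    CreatesLimit K (Mod.forget (D := D) A) :=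
  createsLimitOfReflectsIso fun c hc ↦
    { liftedCone :=
        { pt := limMod hc
          π := { app := fun j ↦ mkHom (M := limMod hc) (coneπ c j) (limAct_π hc j)
                 naturality := fun i j s ↦ by
                   ext
                   exact c.π.naturality s } }
      validLift := Cone.ext (Iso.refl _) fun j ↦ (Category.id_comp _).symm
      makesLimit :=
        { lift := fun s ↦ mkHom (N := limMod hc) (coneLift hc s)
            (lim_hom_ext hc fun j ↦ by
              refine (Category.assoc _ _ _).trans ?_
              rw [coneLift_π, act_hom (M := s.pt) (N := K.obj j) (s.π.app j)]
              refine Eq.trans ?_ ((Category.assoc _ _ _).trans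
                (congrArg (A ◁ coneLift hc s ≫ ·) (limAct_π hc j))).symm
              rw [← whiskerLeft_comp_assoc, coneLift_π])
          fac := fun s j ↦ Mod.hom_ext _ _ (coneLift_π hc s j)
          uniq := fun s m w ↦ Mod.hom_ext _ _ (lim_hom_ext hc fun j ↦
            (congrArg Mod.Hom.hom (w j)).trans (coneLift_π hc s j).symm) } }

noncomputable instance : CreatesLimitsOfShape J (Mod.forget (D := D) A) where

instance [HasLimitsOfShape J D] : HasLimitsOfShape J (Mod D A) :=
  hasLimitsOfShape_of_hasLimitsOfShape_createsLimitsOfShape (Mod.forget A)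

end Limit

section Colimit

variable {J : Type u₂} [Category.{v₂} J] {K : J ⥤ Mod D A}

/-- The coprojections of a cocone over the underlying objects of a diagram of modules. -/
def coconeι (c : Cocone (K ⋙ Mod.forget A)) (j : J) : (K.obj j).X ⟶ c.pt := c.ι.app j

lemma coconeι_w (c : Cocone (K ⋙ Mod.forget A)) {i j : J} (s : i ⟶ j) :
    (K.map s).hom ≫ coconeι c j = coconeι c i := c.w s

/-- Descent of a cocone of modules along the colimit of the underlying objects. -/
def colimDesc {c : Cocone (K ⋙ Mod.forget A)} (hc : IsColimit c) (s : Cocone K) :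
    c.pt ⟶ s.pt.X := hc.desc ((Mod.forget A).mapCocone s)

lemma ι_colimDesc {c : Cocone (K ⋙ Mod.forget A)} (hc : IsColimit c) (s : Cocone K) (j : J) :
    coconeι c j ≫ colimDesc hc s = (s.ι.app j).hom := hc.fac _ j

variable [∀ X : D, PreservesColimitsOfShape J (tensorLeft X)]

lemma colim_hom_ext {c : Cocone (K ⋙ Mod.forget A)} (hc : IsColimit c) (X : D) {Z : D}
    {f g : X ⊗ c.pt ⟶ Z} (h : ∀ j, X ◁ coconeι c j ≫ f = X ◁ coconeι c j ≫ g) : f = g :=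
  (isColimitOfPreserves (tensorLeft X) hc).hom_ext h

/-- The action on the colimit of the underlying objects of a diagram of modules. -/
noncomputable def colimAct {c : Cocone (K ⋙ Mod.forget A)} (hc : IsColimit c) : A ⊗ c.pt ⟶ c.pt :=
  (isColimitOfPreserves (tensorLeft A) hc).desc
    ⟨c.pt, { app := fun j ↦ act (K.obj j) ≫ coconeι c j
             naturality := fun i j s ↦ by
               refine Eq.trans ?_ (Category.comp_id _).symm
               change A ◁ (K.map s).hom ≫ act (K.obj j) ≫ coconeι c j = _
               rw [← reassoc_of% (act_hom (K.map s)), coconeι_w]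
               rfl }⟩

lemma ι_colimAct {c : Cocone (K ⋙ Mod.forget A)} (hc : IsColimit c) (j : J) :
    A ◁ coconeι c j ≫ colimAct hc = act (K.obj j) ≫ coconeι c j :=
  (isColimitOfPreserves (tensorLeft A) hc).fac _ j

/-- The module structure on the colimit of the underlying objects of a diagram of modules. -/
noncomputable abbrev colimMod {c : Cocone (K ⋙ Mod.forget A)} (hc : IsColimit c) : Mod D A :=
  mkMod c.pt (colimAct hc)
    (colim_hom_ext hc _ fun j ↦ by
      rw [whisker_exchange_assoc, ι_colimAct, leftUnitor_naturality, ← one_act, Category.assoc])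
    (colim_hom_ext hc _ fun j ↦ by
      have e : A ◁ A ◁ coconeι c j ≫ A ◁ colimAct hc = A ◁ act (K.obj j) ≫ A ◁ coconeι c j := by
        rw [← whiskerLeft_comp, ι_colimAct, whiskerLeft_comp]
      rw [whisker_exchange_assoc, ι_colimAct, associator_naturality_right_assoc, reassoc_of% e,
        ι_colimAct, reassoc_of% (mul_act (K.obj j))])

noncomputable instance createsColimitForget (K : J ⥤ Mod D A) :
    CreatesColimit K (Mod.forget (D := D) A) :=
  createsColimitOfReflectsIso fun c hc ↦
    { liftedCocone :=
        ⟨colimMod hc,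
          { app := fun j ↦ mkHom (N := colimMod hc) (coconeι c j) (ι_colimAct hc j).symm
            naturality := fun i j s ↦ Mod.hom_ext _ _ (c.ι.naturality s) }⟩
      validLift := Cocone.ext (Iso.refl _) fun j ↦ Category.comp_id _
      makesColimit :=
        { desc := fun s ↦ mkHom (M := colimMod hc) (colimDesc hc s)
            (colim_hom_ext hc _ fun j ↦ by
              change A ◁ coconeι c j ≫ colimAct hc ≫ colimDesc hc s =
                A ◁ coconeι c j ≫ A ◁ colimDesc hc s ≫ act s.pt
              rw [reassoc_of% (ι_colimAct hc j), ← whiskerLeft_comp_assoc, ι_colimDesc]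
              exact act_hom (M := K.obj j) (N := s.pt) (s.ι.app j))
          fac := fun s j ↦ by
            ext
            exact hc.fac ((Mod.forget A).mapCocone s) j
          uniq := fun s m w ↦ by
            ext
            exact hc.uniq ((Mod.forget A).mapCocone s) m.hom fun j ↦ congrArg Mod.Hom.hom (w j) } }

noncomputable instance : CreatesColimitsOfShape J (Mod.forget (D := D) A) where

instance [HasColimitsOfShape J D] : HasColimitsOfShape J (Mod D A) :=
  hasColimitsOfShape_of_hasColimitsOfShape_createsColimitsOfShape (Mod.forget A)

end Colimit

end ModLimits

section ModAbelian

set_option linter.unusedSectionVars false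

variable {D : Type u₁} [Category.{v₁} D] [MonoidalCategory D] [SymmetricCategory D] [Abelian D]
  [∀ X : D, PreservesFiniteColimits (tensorLeft X)]

instance (X : D) : (tensorLeft X).Additive :=
  have := preservesBinaryBiproducts_of_preservesBinaryCoproducts (tensorLeft X)
  Functor.additive_of_preservesBinaryBiproducts _

lemma whiskerLeft_add' (X : D) {Y Z : D} (f g : Y ⟶ Z) : X ◁ (f + g) = X ◁ f + X ◁ g :=
  (tensorLeft X).map_add

lemma whiskerLeft_zero' (X : D) {Y Z : D} : X ◁ (0 : Y ⟶ Z) = 0 :=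
  (tensorLeft X).map_zero _ _

lemma whiskerLeft_neg' (X : D) {Y Z : D} (f : Y ⟶ Z) : X ◁ (-f) = -(X ◁ f) :=
  (tensorLeft X).map_neg

lemma whiskerLeft_sub' (X : D) {Y Z : D} (f g : Y ⟶ Z) : X ◁ (f - g) = X ◁ f - X ◁ g :=
  (tensorLeft X).map_sub

lemma zero_whiskerRight' {Y Z : D} (X : D) : (0 : Y ⟶ Z) ▷ X = 0 := by
  have h := BraidedCategory.braiding_naturality_left (0 : Y ⟶ Z) X
  rw [whiskerLeft_zero', comp_zero] at h
  rw [← cancel_mono (β_ Z X).hom, h, zero_comp]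

variable {A : D} [MonObj A] [IsCommMonObj A]

instance (M N : Mod D A) : Zero (M ⟶ N) :=
  ⟨mkHom 0 (by rw [whiskerLeft_zero', comp_zero, zero_comp])⟩

instance (M N : Mod D A) : Add (M ⟶ N) :=
  ⟨fun f g ↦ mkHom (f.hom + g.hom) (by
    rw [whiskerLeft_add', Preadditive.comp_add, Preadditive.add_comp, act_hom, act_hom])⟩

instance (M N : Mod D A) : Neg (M ⟶ N) :=
  ⟨fun f ↦ mkHom (-f.hom) (by
    rw [whiskerLeft_neg', Preadditive.comp_neg, Preadditive.neg_comp, act_hom])⟩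

instance (M N : Mod D A) : Sub (M ⟶ N) :=
  ⟨fun f g ↦ mkHom (f.hom - g.hom) (by
    rw [whiskerLeft_sub', Preadditive.comp_sub, Preadditive.sub_comp, act_hom, act_hom])⟩

instance (M N : Mod D A) : SMul ℕ (M ⟶ N) :=
  ⟨fun n f ↦ mkHom (n • f.hom) (by
    have : A ◁ (n • f.hom) = n • (A ◁ f.hom) := (tensorLeft A).map_nsmul
    rw [this, Preadditive.comp_nsmul, Preadditive.nsmul_comp, act_hom])⟩

instance (M N : Mod D A) : SMul ℤ (M ⟶ N) :=
  ⟨fun n f ↦ mkHom (n • f.hom) (by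
    have : A ◁ (n • f.hom) = n • (A ◁ f.hom) := (tensorLeft A).map_zsmul
    rw [this, Preadditive.comp_zsmul, Preadditive.zsmul_comp, act_hom])⟩

lemma Mod.hom_injective (M N : Mod D A) :
    Function.Injective (fun f : M ⟶ N ↦ f.hom) := fun _ _ h ↦ Mod.hom_ext _ _ h

instance (M N : Mod D A) : AddCommGroup (M ⟶ N) :=
  (Mod.hom_injective M N).addCommGroup _ rfl (fun _ _ ↦ rfl) (fun _ ↦ rfl) (fun _ _ ↦ rfl)
    (fun _ _ ↦ rfl) (fun _ _ ↦ rfl)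

instance : Preadditive (Mod D A) where
  add_comp _ _ _ _ _ _ := by
    ext
    exact Preadditive.add_comp _ _ _ _ _ _
  comp_add _ _ _ _ _ _ := by
    ext
    exact Preadditive.comp_add _ _ _ _ _ _

instance : (Mod.forget (D := D) A).Additive where

instance (J : Type) [SmallCategory J] [FinCategory J] (X : D) :
    PreservesColimitsOfShape J (tensorLeft X) := inferInstance

instance : HasFiniteLimits (Mod D A) where
  out _ _ _ := inferInstance

instance : HasFiniteColimits (Mod D A) where
  out _ _ _ := inferInstance

instance : PreservesFiniteLimits (Mod.forget (D := D) A) where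
  preservesFiniteLimits _ _ _ := inferInstance

instance : PreservesFiniteColimits (Mod.forget (D := D) A) where
  preservesFiniteColimits _ _ _ := inferInstance

noncomputable instance : IsNormalMonoCategory (Mod D A) where
  normalMonoOfMono f :=
    ⟨{Z := cokernel f
      g := cokernel.π f
      w := cokernel.condition f
      isLimit := isLimitOfReflects (Mod.forget A) ((KernelFork.isLimitMapConeEquiv _ _).symm
        (Abelian.monoIsKernelOfCokernel _
          (CokernelCofork.mapIsColimit _ (cokernelIsCokernel f) (Mod.forget A)))) }⟩

noncomputable instance : IsNormalEpiCategory (Mod D A) where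
  normalEpiOfEpi f :=
    ⟨{W := kernel f
      g := kernel.ι f
      w := kernel.condition f
      isColimit := isColimitOfReflects (Mod.forget A) ((CokernelCofork.isColimitMapCoconeEquiv _ _).symm
        (Abelian.epiIsCokernelOfKernel _
          (KernelFork.mapIsLimit _ (kernelIsKernel f) (Mod.forget A)))) }⟩

noncomputable instance : Abelian (Mod D A) where

end ModAbelian

/-! ### Extension and restriction of scalars -/

section ChangeOfRings

set_option linter.unusedSectionVars false

variable {D : Type u₁} [Category.{v₁} D] [MonoidalCategory D] [SymmetricCategory D]
  [HasCoequalizers D] [∀ X : D, PreservesFiniteColimits (tensorLeft X)]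

attribute [local instance] epi_whiskerLeft epi_whiskerRight

variable {A B E : D} [MonObj A] [IsCommMonObj A] [MonObj B] [IsCommMonObj B]
  [MonObj E] [IsCommMonObj E] (f : A ⟶ B) [IsMonHom f] (g : B ⟶ E) [IsMonHom g]

/-- Restriction of scalars along `f : A ⟶ B`, as a functor. -/
def restrFunctor : Mod D B ⥤ Mod D A where
  obj N := restr f N
  map h := restrMap f h

lemma bten_condition (M : Mod D A) :
    (B ◁ f ≫ μ[B]) ▷ M.X ≫ bten f M = (α_ B A M.X).hom ≫ B ◁ act M ≫ bten f M := by
  have h := ten_condition (algMod f) M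
  rw [ract_algMod] at h
  exact h

/-- Descent of balanced morphisms along `W ⊗ (B ⊗ M) ⟶ W ⊗ (B ⊗_A M)`. -/
noncomputable def bdescL {W : D} {M : Mod D A} {Z : D} (h : W ⊗ (B ⊗ M.X) ⟶ Z)
    (w : W ◁ ((B ◁ f ≫ μ[B]) ▷ M.X) ≫ h = W ◁ (α_ B A M.X).hom ≫ W ◁ (B ◁ act M) ≫ h) :
    W ⊗ (tensorMod (algMod f) M).X ⟶ Z :=
  descL (M := algMod f) h (by rw [ract_algMod]; exact w)

lemma bten_bdescL {W : D} {M : Mod D A} {Z : D} (h : W ⊗ (B ⊗ M.X) ⟶ Z)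
    (w : W ◁ ((B ◁ f ≫ μ[B]) ▷ M.X) ≫ h = W ◁ (α_ B A M.X).hom ≫ W ◁ (B ◁ act M) ≫ h) :
    W ◁ bten f M ≫ bdescL f h w = h := ten_descL (M := algMod f) _ _

/-- The action of `B` on `B ⊗_A M`. -/
noncomputable def extAct (M : Mod D A) :
    B ⊗ (tensorMod (algMod f) M).X ⟶ (tensorMod (algMod f) M).X :=
  bdescL f ((α_ B B M.X).inv ≫ μ[B] ▷ M.X ≫ bten f M) (by
    have e2 : B ◁ (B ◁ f ≫ μ[B]) ≫ μ[B] = (α_ B B A).inv ≫ μ[B] ▷ A ≫ B ◁ f ≫ μ[B] := by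
      rw [← whisker_exchange_assoc, MonObj.mul_assoc, associator_naturality_right_assoc,
        Iso.inv_hom_id_assoc, whiskerLeft_comp_assoc]
    rw [associator_inv_naturality_middle_assoc, ← comp_whiskerRight_assoc, e2]
    simp only [comp_whiskerRight, Category.assoc]
    have h := bten_condition f M
    simp only [comp_whiskerRight, Category.assoc] at h
    rw [h, associator_naturality_left_assoc, ← whisker_exchange_assoc]
    monoidal)

lemma bten_extAct (M : Mod D A) :
    B ◁ bten f M ≫ extAct f M = (α_ B B M.X).inv ≫ μ[B] ▷ M.X ≫ bten f M :=
  bten_bdescL f _ _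

/-- The `B`-module `B ⊗_A M` obtained from an `A`-module `M` by extension of scalars. -/
noncomputable abbrev extMod (M : Mod D A) : Mod D B :=
  mkMod (tensorMod (algMod f) M).X (extAct f M)
    (by
      rw [← cancel_epi (𝟙_ D ◁ bten f M), whisker_exchange_assoc, bten_extAct,
        associator_inv_naturality_left_assoc, ← comp_whiskerRight_assoc, MonObj.one_mul]
      simp)
    (by
      rw [← cancel_epi ((B ⊗ B) ◁ bten f M), whisker_exchange_assoc, bten_extAct,
        associator_inv_naturality_left_assoc, ← comp_whiskerRight_assoc, MonObj.mul_assoc,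
        associator_naturality_right_assoc, ← whiskerLeft_comp_assoc, bten_extAct]
      simp only [comp_whiskerRight, whiskerLeft_comp, Category.assoc, bten_extAct]
      monoidal)

/-- The universal semilinear morphism `M ⟶ B ⊗_A M`. -/
noncomputable def extUnit (M : Mod D A) : M.X ⟶ (extMod f M).X :=
  (λ_ M.X).inv ≫ η[B] ▷ M.X ≫ bten f M

lemma whiskerLeft_extUnit_act (M : Mod D A) :
    B ◁ extUnit f M ≫ act (extMod f M) = bten f M := by
  have h : B ◁ bten f M ≫ act (extMod f M) = _ := bten_extAct f M
  rw [extUnit, whiskerLeft_comp_assoc, whiskerLeft_comp_assoc, h,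
    associator_inv_naturality_middle_assoc, ← comp_whiskerRight_assoc, MonObj.mul_one]
  simp

lemma semilinear_extUnit (M : Mod D A) : Semilinear f (N := extMod f M) (extUnit f M) := by
  unfold Semilinear
  rw [whisker_exchange_assoc f, whiskerLeft_extUnit_act, extUnit]
  have h := bten_condition f M
  rw [leftUnitor_inv_naturality_assoc, whisker_exchange_assoc]
  have e : B ◁ act M ≫ bten f M = (α_ B A M.X).inv ≫ (B ◁ f ≫ μ[B]) ▷ M.X ≫ bten f M := by
    rw [h, Iso.inv_hom_id_assoc]
  rw [e, associator_inv_naturality_left_assoc, ← comp_whiskerRight_assoc,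
    ← whisker_exchange_assoc, MonObj.one_mul]
  simp

lemma bten_eq_iff {M : Mod D A} {N : Mod D B} {a b : extMod f M ⟶ N} :
    a = b ↔ extUnit f M ≫ a.hom = extUnit f M ≫ b.hom := by
  refine ⟨fun h ↦ by rw [h], fun h ↦ ?_⟩
  ext
  refine (cancel_epi (bten f M)).1 ?_
  rw [← whiskerLeft_extUnit_act, Category.assoc, Category.assoc, act_hom, act_hom,
    ← whiskerLeft_comp_assoc, ← whiskerLeft_comp_assoc, h]

/-- The `B`-linear morphism `B ⊗_A M ⟶ N` induced by a semilinear morphism `M ⟶ N`. -/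
noncomputable def extDesc {M : Mod D A} {N : Mod D B} (φ : M.X ⟶ N.X) (h : Semilinear f φ) :
    extMod f M ⟶ N :=
  mkHom (M := extMod f M) (baseChangeHom f φ h) (by
    rw [← cancel_epi (B ◁ bten f M)]
    have e : B ◁ bten f M ≫ act (extMod f M) = _ := bten_extAct f M
    rw [reassoc_of% e]
    have e2 := bten_baseChangeHom f φ h
    rw [e2, ← whiskerLeft_comp_assoc, e2, ← whisker_exchange_assoc, mul_act,
      associator_naturality_right_assoc, Iso.inv_hom_id_assoc, whiskerLeft_comp_assoc])

lemma extUnit_extDesc {M : Mod D A} {N : Mod D B} (φ : M.X ⟶ N.X) (h : Semilinear f φ) :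
    extUnit f M ≫ (extDesc f φ h).hom = φ := by
  have e2 := bten_baseChangeHom f φ h
  change extUnit f M ≫ baseChangeHom f φ h = φ
  rw [extUnit, Category.assoc, Category.assoc, e2, ← whisker_exchange_assoc, one_act]
  simp

/-- The functoriality of extension of scalars. -/
noncomputable def extMap {M N : Mod D A} (h : M ⟶ N) : extMod f M ⟶ extMod f N :=
  mkHom (M := extMod f M) (N := extMod f N) (tmap (𝟙 (algMod f)) h).hom (by
    have e1 : ∀ P : Mod D A, B ◁ bten f P ≫ act (extMod f P) = _ := fun P ↦ bten_extAct f P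
    have e2 := bten_tmap f h
    rw [← cancel_epi (B ◁ bten f M), reassoc_of% (e1 M), ← whiskerLeft_comp_assoc, e2,
      whiskerLeft_comp_assoc, e1, associator_inv_naturality_right_assoc,
      whisker_exchange_assoc])

lemma extUnit_extMap {M N : Mod D A} (h : M ⟶ N) :
    extUnit f M ≫ (extMap f h).hom = h.hom ≫ extUnit f N := by
  have e2 : bten f M ≫ (extMap f h).hom = B ◁ h.hom ≫ bten f N := bten_tmap f h
  rw [extUnit, Category.assoc, Category.assoc, e2, extUnit, leftUnitor_inv_naturality_assoc,
    whisker_exchange_assoc]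

/-- Extension of scalars along `f : A ⟶ B`, as a functor. -/
noncomputable def extFunctor : Mod D A ⥤ Mod D B where
  obj M := extMod f M
  map h := extMap f h
  map_id M := (bten_eq_iff f).2 (by
    rw [extUnit_extMap, Mod.id_hom', Mod.id_hom', Category.id_comp]
    exact (Category.comp_id _).symm)
  map_comp h k := (bten_eq_iff f).2 (by
    rw [extUnit_extMap, Mod.comp_hom', Mod.comp_hom', reassoc_of% (extUnit_extMap f h),
      extUnit_extMap, Category.assoc])

lemma semilinear_of_restr {M : Mod D A} {N : Mod D B} (h : M ⟶ restr f N) :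
    Semilinear f (N := N) h.hom := act_hom h

variable {f} in
lemma Semilinear.comp_hom {M : Mod D A} {N N' : Mod D B} {φ : M.X ⟶ N.X}
    (hφ : Semilinear f φ) (a : N ⟶ N') : Semilinear f (φ ≫ a.hom) := by
  unfold Semilinear at *
  rw [reassoc_of% hφ, act_hom, whiskerLeft_comp_assoc, whisker_exchange_assoc f a.hom]

variable {f} in
lemma Semilinear.hom_comp {M M' : Mod D A} {N : Mod D B} {φ : M.X ⟶ N.X}
    (hφ : Semilinear f φ) (a : M' ⟶ M) : Semilinear f (a.hom ≫ φ) := by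
  unfold Semilinear at *
  rw [reassoc_of% (act_hom a), hφ, whiskerLeft_comp_assoc]

/-- The adjunction bijection between extension and restriction of scalars. -/
noncomputable def extEquiv (M : Mod D A) (N : Mod D B) : (extMod f M ⟶ N) ≃ (M ⟶ restr f N) where
  toFun h := mkHom (N := restr f N) (extUnit f M ≫ h.hom) ((semilinear_extUnit f M).comp_hom h)
  invFun h := extDesc f h.hom (semilinear_of_restr f h)
  left_inv _ := (bten_eq_iff f).2 (extUnit_extDesc f _ _)
  right_inv _ := Mod.hom_ext _ _ (extUnit_extDesc f _ _)

/-- Extension of scalars is left adjoint to restriction of scalars. -/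
noncomputable def extAdj : extFunctor f ⊣ restrFunctor f :=
  Adjunction.mkOfHomEquiv
    { homEquiv := extEquiv f
      homEquiv_naturality_left_symm := fun {M M' N} h k ↦ (bten_eq_iff f).2 (by
        refine (extUnit_extDesc f (h.hom ≫ k.hom) _).trans ?_
        change h.hom ≫ k.hom = extUnit f M ≫ (extMap f h).hom ≫
          (extDesc f (N := N) k.hom (semilinear_of_restr f k)).hom
        rw [reassoc_of% (extUnit_extMap f h)]
        exact congrArg (h.hom ≫ ·) (extUnit_extDesc f (N := N) k.hom _).symm)
      homEquiv_naturality_right := fun _ _ ↦ Mod.hom_ext _ _ (Category.assoc _ _ _).symm }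

/-- The underlying object of an extension of scalars is the tensor product `B ⊗_A M`. -/
noncomputable def extFunctorForgetIso :
    extFunctor f ⋙ Mod.forget B ≅ tensorLeft (algMod f) ⋙ Mod.forget A :=
  NatIso.ofComponents (fun M ↦ Iso.refl (tensorMod (algMod f) M).X) fun _ ↦
    (Category.comp_id _).trans (Category.id_comp _).symm

/-- Restriction of scalars along a composition. -/
def restrFunctorComp : restrFunctor g ⋙ restrFunctor f ≅ restrFunctor (f ≫ g) :=
  NatIso.ofComponents (fun N ↦ mkIso (M := restr f (restr g N)) (N := restr (f ≫ g) N)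
      (𝟙 N.X) (𝟙 N.X) (Category.comp_id _) (Category.comp_id _) (by
        change (f ▷ N.X ≫ g ▷ N.X ≫ act N) ≫ 𝟙 N.X = A ◁ 𝟙 N.X ≫ (f ≫ g) ▷ N.X ≫ act N
        simp))
    fun _ ↦ Mod.hom_ext _ _ ((Category.comp_id _).trans (Category.id_comp _).symm)

/-- Extension of scalars along a composition. -/
noncomputable def extFunctorComp : extFunctor (f ≫ g) ≅ extFunctor f ⋙ extFunctor g :=
  (conjugateIsoEquiv ((extAdj f).comp (extAdj g)) (extAdj (f ≫ g))).symm
    (restrFunctorComp f g)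

/-- Restriction of scalars along the identity. -/
def restrFunctorId : restrFunctor (𝟙 A) ≅ 𝟭 (Mod D A) :=
  NatIso.ofComponents (fun N ↦ mkIso (M := restr (𝟙 A) N) (N := N)
      (𝟙 N.X) (𝟙 N.X) (Category.comp_id _) (Category.comp_id _) (by
        change (𝟙 A ▷ N.X ≫ act N) ≫ 𝟙 N.X = A ◁ 𝟙 N.X ≫ act N
        simp))
    fun _ ↦ Mod.hom_ext _ _ ((Category.comp_id _).trans (Category.id_comp _).symm)

/-- Extension of scalars along the identity. -/
noncomputable def extFunctorId : extFunctor (𝟙 A) ≅ 𝟭 (Mod D A) :=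
  ((conjugateIsoEquiv (extAdj (𝟙 A)) Adjunction.id).symm restrFunctorId).symm

section IsBaseChange

variable {f g} {M : Mod D A} {N : Mod D B} {P : Mod D E} {φ : M.X ⟶ N.X} {ψ : N.X ⟶ P.X}

lemma isBaseChange_iff : IsBaseChange f φ ↔ ∃ h : Semilinear f φ, IsIso (extDesc f φ h) := by
  refine exists_congr fun h ↦ ⟨fun hi ↦ ?_, fun hi ↦ ?_⟩
  · have : IsIso (baseChangeHom f φ h) :=
      inferInstanceAs (IsIso ((Mod.forget A).map (baseChangeMap f φ h)))
    exact isIso_of_hom (extDesc f φ h) this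
  · have : IsIso (baseChangeHom f φ h) :=
      inferInstanceAs (IsIso ((Mod.forget B).map (extDesc f φ h)))
    exact isIso_of_hom (baseChangeMap f φ h) this

lemma IsBaseChange.hom_ext (hφ : IsBaseChange f φ) {N' : Mod D B} {a b : N ⟶ N'}
    (h : φ ≫ a.hom = φ ≫ b.hom) : a = b := by
  obtain ⟨hs, hi⟩ := isBaseChange_iff.1 hφ
  rw [← cancel_epi (extDesc f φ hs), bten_eq_iff]
  change extUnit f M ≫ (extDesc f φ hs).hom ≫ a.hom = extUnit f M ≫ (extDesc f φ hs).hom ≫ b.hom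
  rw [reassoc_of% (extUnit_extDesc f φ hs), reassoc_of% (extUnit_extDesc f φ hs), h]

lemma IsBaseChange.exists_desc (hφ : IsBaseChange f φ) {N' : Mod D B} (θ : M.X ⟶ N'.X)
    (hθ : Semilinear f θ) : ∃ a : N ⟶ N', φ ≫ a.hom = θ := by
  obtain ⟨hs, hi⟩ := isBaseChange_iff.1 hφ
  refine ⟨inv (extDesc f φ hs) ≫ extDesc f θ hθ, ?_⟩
  have e : φ = extUnit f M ≫ (extDesc f φ hs).hom := (extUnit_extDesc f φ hs).symm
  have e2 : (extDesc f φ hs).hom ≫ (inv (extDesc f φ hs)).hom = 𝟙 _ := by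
    rw [← Mod.comp_hom', IsIso.hom_inv_id]; rfl
  rw [Mod.comp_hom']
  nth_rw 1 [e]
  rw [Category.assoc, reassoc_of% e2, extUnit_extDesc]

/-- A semilinear morphism is a base change as soon as it is a universal semilinear morphism. -/
lemma isBaseChange_of_universal (hs : Semilinear f φ)
    (h : ∀ (N' : Mod D B) (θ : M.X ⟶ N'.X), Semilinear f θ → ∃ a : N ⟶ N', φ ≫ a.hom = θ)
    (h' : ∀ (N' : Mod D B) (a b : N ⟶ N'), φ ≫ a.hom = φ ≫ b.hom → a = b) :
    IsBaseChange f φ := by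
  refine isBaseChange_iff.2 ⟨hs, ?_⟩
  obtain ⟨a, ha⟩ := h (extMod f M) (extUnit f M) (semilinear_extUnit f M)
  refine ⟨a, ?_, ?_⟩
  · rw [bten_eq_iff]
    change extUnit f M ≫ (extDesc f φ hs).hom ≫ a.hom = extUnit f M ≫ 𝟙 _
    rw [reassoc_of% (extUnit_extDesc f φ hs), ha, Category.comp_id]
  · apply h'
    rw [Mod.comp_hom', reassoc_of% ha, extUnit_extDesc]
    exact (Category.comp_id _).symm

lemma isBaseChange_extUnit (M : Mod D A) : IsBaseChange f (N := extMod f M) (extUnit f M) :=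
  isBaseChange_of_universal (semilinear_extUnit f M)
    (fun _ θ hθ ↦ ⟨extDesc f θ hθ, extUnit_extDesc f θ hθ⟩) fun _ _ _ h ↦ (bten_eq_iff f).2 h

lemma Semilinear.comp (hφ : Semilinear f φ) (hψ : Semilinear g ψ) :
    Semilinear (f ≫ g) (φ ≫ ψ) := by
  unfold Semilinear at *
  rw [reassoc_of% hφ, hψ, whiskerLeft_comp_assoc, comp_whiskerRight_assoc,
    whisker_exchange_assoc f ψ]

lemma Semilinear.restr_right {θ : M.X ⟶ P.X} (hθ : Semilinear (f ≫ g) θ) :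
    Semilinear f (N := restr g P) θ := by
  unfold Semilinear at *
  rw [hθ, comp_whiskerRight_assoc]
  rfl

lemma IsBaseChange.of_comp (hφ : IsBaseChange f φ) (hψ : Semilinear g ψ)
    (h : IsBaseChange (f ≫ g) (φ ≫ ψ)) : IsBaseChange g ψ := by
  refine isBaseChange_of_universal hψ (fun P' θ hθ ↦ ?_) fun P' a b hab ↦ ?_
  · obtain ⟨a, ha⟩ := h.exists_desc (φ ≫ θ) (hφ.1.comp hθ)
    refine ⟨a, ?_⟩
    have := hφ.hom_ext (N' := restr g P')
      (a := mkHom (ψ ≫ a.hom) (hψ.comp_hom a)) (b := mkHom θ hθ) (by rw [Category.assoc] at ha; exact ha)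
    exact congrArg Mod.Hom.hom this
  · exact h.hom_ext (by rw [Category.assoc, Category.assoc, hab])

lemma semilinear_id_iff {M N : Mod D A} {φ : M.X ⟶ N.X} :
    Semilinear (𝟙 A) φ ↔ act M ≫ φ = A ◁ φ ≫ act N := by
  unfold Semilinear
  rw [id_whiskerRight_assoc]

end IsBaseChange

end ChangeOfRings

/-! ### Pushouts of commutative monoids -/

section Pushouts

set_option linter.unusedSectionVars false

variable {D : Type u₁} [Category.{v₁} D] [MonoidalCategory D] [SymmetricCategory D]

lemma isMonHom_one (M : D) [MonObj M] : IsMonHom η[M] where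
  one_hom := by
    change 𝟙 _ ≫ η = η
    rw [Category.id_comp]
  mul_hom := by
    change (λ_ (𝟙_ D)).hom ≫ η = _
    rw [MonoidalCategory.tensorHom_def, Category.assoc, MonObj.mul_one, unitors_equal,
      rightUnitor_naturality]

lemma isMonHom_mul (M : D) [MonObj M] [IsCommMonObj M] : IsMonHom μ[M] where
  one_hom := by
    change ((λ_ (𝟙_ D)).inv ≫ (η[M] ⊗ₘ η[M])) ≫ μ = η
    rw [MonoidalCategory.tensorHom_def, Category.assoc, Category.assoc, MonObj.mul_one,
      rightUnitor_naturality, ← unitors_equal, Iso.inv_hom_id_assoc]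
  mul_hom := by
    change (tensorμ M M M M ≫ (μ[M] ⊗ₘ μ[M])) ≫ μ = _
    rw [Category.assoc, MonObj.mul_mul_mul_comm]

attribute [local instance] isMonHom_one isMonHom_mul

/-- Bundle a morphism of commutative monoids. -/
def commMonHomMk {A B : CommMon D} (f : A.X ⟶ B.X) (hf : IsMonHom f) : A ⟶ B :=
  letI : IsMonHom (M := A.toMon.X) (N := B.toMon.X) f := hf
  CommMon.homMk (A := A) (B := B) (Mon.Hom.mk f)

@[simp] lemma homX_comp {A B E : CommMon D} (f : A ⟶ B) (g : B ⟶ E) :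
    homX (f ≫ g) = homX f ≫ homX g := rfl

@[simp] lemma homX_id (A : CommMon D) : homX (𝟙 A) = 𝟙 A.X := rfl

lemma commMon_hom_ext {A B : CommMon D} {f g : A ⟶ B} (h : homX f = homX g) : f = g :=
  CommMon.hom_ext _ _ h

variable [HasCoequalizers D] [∀ X : D, PreservesFiniteColimits (tensorLeft X)]

attribute [local instance] epi_whiskerLeft epi_whiskerRight

section Quotient

variable {P S T : D} [MonObj P] [MonObj S] {d₀ d₁ : P ⟶ S} [IsMonHom d₀] [IsMonHom d₁]
  {s : S ⟶ P} {π : S ⟶ T} {w : d₀ ≫ π = d₁ ≫ π}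
  (hT : IsColimit (Cofork.ofπ π w))

include hT in
lemma exists_descL (W : D) {Z : D} (h : W ⊗ S ⟶ Z) (hh : W ◁ d₀ ≫ h = W ◁ d₁ ≫ h) :
    ∃ k : W ⊗ T ⟶ Z, W ◁ π ≫ k = h :=
  ⟨_, Cofork.IsColimit.π_desc' (isColimitCoforkMapOfIsColimit (tensorLeft W) w hT) h hh⟩

include hT in
lemma exists_descR (W : D) {Z : D} (h : S ⊗ W ⟶ Z) (hh : d₀ ▷ W ≫ h = d₁ ▷ W ≫ h) :
    ∃ k : T ⊗ W ⟶ Z, π ▷ W ≫ k = h := by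
  obtain ⟨k, hk⟩ := exists_descL hT W ((β_ W S).hom ≫ h) (by
    rw [BraidedCategory.braiding_naturality_right_assoc, hh,
      BraidedCategory.braiding_naturality_right_assoc])
  refine ⟨(β_ T W).hom ≫ k, ?_⟩
  rw [BraidedCategory.braiding_naturality_left_assoc, hk, SymmetricCategory.symmetry_assoc]

include hT in
/-- The multiplication of `S` descends to the reflexive coequalizer `T` of two morphisms of
monoids `P ⇉ S`. -/
lemma exists_quotMul (hs₀ : s ≫ d₀ = 𝟙 S) (hs₁ : s ≫ d₁ = 𝟙 S) :
    ∃ m : T ⊗ T ⟶ T, (π ⊗ₘ π) ≫ m = μ[S] ≫ π := by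
  have e (d : P ⟶ S) [IsMonHom d] (hs : s ≫ d = 𝟙 S) : S ◁ d ≫ μ[S] = s ▷ P ≫ μ[P] ≫ d := by
    rw [IsMonHom.mul_hom, MonoidalCategory.tensorHom_def, Category.assoc,
      ← comp_whiskerRight_assoc, hs, id_whiskerRight, Category.id_comp]
  have e' (d : P ⟶ S) [IsMonHom d] (hs : s ≫ d = 𝟙 S) : d ▷ S ≫ μ[S] = P ◁ s ≫ μ[P] ≫ d := by
    rw [IsMonHom.mul_hom, MonoidalCategory.tensorHom_def', Category.assoc,
      ← whiskerLeft_comp_assoc, hs, whiskerLeft_id, Category.id_comp]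
  obtain ⟨k, hk⟩ := exists_descL hT S (μ[S] ≫ π) (by
    rw [reassoc_of% (e d₀ hs₀), reassoc_of% (e d₁ hs₁), w])
  have : Epi π := Cofork.IsColimit.epi hT
  obtain ⟨m, hm⟩ := exists_descR hT T k (by
    rw [← cancel_epi (P ◁ π), whisker_exchange_assoc, whisker_exchange_assoc, hk,
      reassoc_of% (e' d₀ hs₀), reassoc_of% (e' d₁ hs₁), w])
  refine ⟨m, ?_⟩
  rw [MonoidalCategory.tensorHom_def', Category.assoc, hm, hk]

/-- The monoid structure on a quotient `T` of a monoid `S` through which the multiplication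
of `S` descends. -/
@[reducible] def quotMonObj [Epi π] (m : T ⊗ T ⟶ T) (hm : (π ⊗ₘ π) ≫ m = μ[S] ≫ π) : MonObj T where
  one := η[S] ≫ π
  mul := m
  one_mul := by
    rw [← cancel_epi (𝟙_ D ◁ π), comp_whiskerRight_assoc, whisker_exchange_assoc,
      ← tensorHom_def'_assoc, hm, MonObj.one_mul_assoc,
      leftUnitor_naturality]
  mul_one := by
    rw [← cancel_epi (π ▷ 𝟙_ D), whiskerLeft_comp_assoc, ← whisker_exchange_assoc,
      ← tensorHom_def_assoc, hm, MonObj.mul_one_assoc,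
      rightUnitor_naturality]
  mul_assoc := by
    have : Epi ((π ⊗ₘ π) ⊗ₘ π) := by
      simp only [MonoidalCategory.tensorHom_def]
      infer_instance
    rw [← cancel_epi ((π ⊗ₘ π) ⊗ₘ π)]
    have e1 : ((π ⊗ₘ π) ⊗ₘ π) ≫ m ▷ T = (μ[S] ▷ S) ≫ (π ⊗ₘ π) := by
      rw [← tensorHom_id, tensorHom_comp_tensorHom, hm, Category.comp_id, ← tensorHom_id,
        tensorHom_comp_tensorHom, Category.id_comp]
    have e2 : (π ⊗ₘ (π ⊗ₘ π)) ≫ T ◁ m = (S ◁ μ[S]) ≫ (π ⊗ₘ π) := by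
      rw [← id_tensorHom, tensorHom_comp_tensorHom, hm, Category.comp_id, ← id_tensorHom,
        tensorHom_comp_tensorHom, Category.id_comp]
    rw [reassoc_of% e1, hm, associator_naturality_assoc, reassoc_of% e2, hm,
      MonObj.mul_assoc_assoc]

end Quotient

section Tensor

variable {A B E : CommMon D} (f : A ⟶ B) (g : A ⟶ E)

/-- The projection `B ⊗ E ⟶ B ⊗_A E`. -/
noncomputable def pushπ : B.X ⊗ E.X ⟶ (tensorMod (algMod (homX f)) (algMod (homX g))).X :=
  ten (algMod (homX f)) (algMod (homX g))

instance : Epi (pushπ f g) := inferInstanceAs (Epi (ten _ _))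

/-- The first of the two morphisms `(B ⊗ A) ⊗ E ⟶ B ⊗ E` whose coequalizer is `B ⊗_A E`. -/
def pushd₀ : (B.X ⊗ A.X) ⊗ E.X ⟶ B.X ⊗ E.X := (B.X ◁ homX f ≫ μ[B.X]) ▷ E.X

/-- The second of the two morphisms `(B ⊗ A) ⊗ E ⟶ B ⊗ E` whose coequalizer is `B ⊗_A E`. -/
def pushd₁ : (B.X ⊗ A.X) ⊗ E.X ⟶ B.X ⊗ E.X :=
  (α_ B.X A.X E.X).hom ≫ B.X ◁ (homX g ▷ E.X ≫ μ[E.X])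

/-- The common section of the two morphisms whose coequalizer is `B ⊗_A E`. -/
def pushs (A B E : CommMon D) : B.X ⊗ E.X ⟶ (B.X ⊗ A.X) ⊗ E.X :=
  ((ρ_ B.X).inv ≫ B.X ◁ η[A.X]) ▷ E.X

instance : IsMonHom (pushd₀ (E := E) f) := by unfold pushd₀; infer_instance

instance : IsMonHom (pushd₁ (B := B) g) := by unfold pushd₁; infer_instance

lemma pushs_d₀ : pushs A B E ≫ pushd₀ f = 𝟙 _ := by
  rw [pushs, pushd₀, ← comp_whiskerRight, Category.assoc, ← whiskerLeft_comp_assoc,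
    IsMonHom.one_hom, MonObj.mul_one]
  simp

lemma pushs_d₁ : pushs A B E ≫ pushd₁ g = 𝟙 _ := by
  rw [pushs, pushd₁, comp_whiskerRight_assoc, associator_naturality_middle_assoc,
    ← whiskerLeft_comp, ← comp_whiskerRight_assoc, IsMonHom.one_hom, MonObj.one_mul]
  simp

lemma push_condition : pushd₀ f ≫ pushπ f g = pushd₁ g ≫ pushπ f g := by
  have h := ten_condition (algMod (homX f)) (algMod (homX g))
  rw [ract_algMod] at h
  refine h.trans ?_
  rw [pushd₁, Category.assoc]
  rfl

/-- `B ⊗_A E` is the coequalizer of `(B ⊗ A) ⊗ E ⇉ B ⊗ E`. -/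
noncomputable def pushIsColimit : IsColimit (Cofork.ofπ (pushπ f g) (push_condition f g)) :=
  Cofork.IsColimit.mk _
    (fun s ↦ desc (M := algMod (homX f)) (N := algMod (homX g)) s.π (by
      unfold Balanced
      rw [ract_algMod]
      have h := s.condition
      exact h.trans (Category.assoc _ _ _)))
    (fun s ↦ ten_desc (M := algMod (homX f)) (N := algMod (homX g)) _ _)
    (fun s m hm ↦ (cancel_epi (pushπ f g)).1
      (hm.trans (ten_desc (M := algMod (homX f)) (N := algMod (homX g)) s.π _).symm))

/-- The multiplication of `B ⊗_A E`. -/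
noncomputable def pushMul :
    (tensorMod (algMod (homX f)) (algMod (homX g))).X ⊗
      (tensorMod (algMod (homX f)) (algMod (homX g))).X ⟶ (tensorMod (algMod (homX f)) (algMod (homX g))).X :=
  (exists_quotMul (pushIsColimit f g) (pushs_d₀ f) (pushs_d₁ g)).choose

lemma pushMul_spec : (pushπ f g ⊗ₘ pushπ f g) ≫ pushMul f g = μ[B.X ⊗ E.X] ≫ pushπ f g :=
  (exists_quotMul (pushIsColimit f g) (pushs_d₀ f) (pushs_d₁ g)).choose_spec

/-- The commutative monoid `B ⊗_A E`. -/
noncomputable def pushMon : CommMon D :=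
  letI : MonObj (tensorMod (algMod (homX f)) (algMod (homX g))).X :=
    quotMonObj _ (pushMul_spec f g)
  { X := (tensorMod (algMod (homX f)) (algMod (homX g))).X
    comm := ⟨by
      have : Epi (pushπ f g ⊗ₘ pushπ f g) := by
        rw [MonoidalCategory.tensorHom_def]
        infer_instance
      rw [← cancel_epi (pushπ f g ⊗ₘ pushπ f g)]
      change _ ≫ _ ≫ pushMul f g = _ ≫ pushMul f g
      rw [BraidedCategory.braiding_naturality_assoc, pushMul_spec,
        reassoc_of% (IsCommMonObj.mul_comm (B.X ⊗ E.X))]⟩ }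

/-- The projection `B ⊗ E ⟶ B ⊗_A E`, with values in the commutative monoid `B ⊗_A E`. -/
noncomputable def pushProj : B.X ⊗ E.X ⟶ (pushMon f g).X := pushπ f g

instance : Epi (pushProj f g) := inferInstanceAs (Epi (pushπ f g))

instance : IsMonHom (pushProj f g) where
  one_hom := rfl
  mul_hom := (pushMul_spec f g).symm

/-- The coprojection `B ⟶ B ⊗ E`. -/
def tensorInl (B E : CommMon D) : B.X ⟶ B.X ⊗ E.X := (ρ_ B.X).inv ≫ B.X ◁ η[E.X]

/-- The coprojection `E ⟶ B ⊗ E`. -/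
def tensorInr (B E : CommMon D) : E.X ⟶ B.X ⊗ E.X := (λ_ E.X).inv ≫ η[B.X] ▷ E.X

instance (B E : CommMon D) : IsMonHom (tensorInl B E) := by unfold tensorInl; infer_instance

instance (B E : CommMon D) : IsMonHom (tensorInr B E) := by unfold tensorInr; infer_instance

/-- The coprojection `B ⟶ B ⊗_A E`. -/
noncomputable def pushInl : B ⟶ pushMon f g :=
  commMonHomMk (tensorInl B E ≫ pushProj f g) inferInstance

/-- The coprojection `E ⟶ B ⊗_A E`. -/
noncomputable def pushInr : E ⟶ pushMon f g :=
  commMonHomMk (tensorInr B E ≫ pushProj f g) inferInstance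

lemma push_w : f ≫ pushInl f g = g ≫ pushInr f g := by
  apply commMon_hom_ext
  change homX f ≫ tensorInl B E ≫ pushπ f g = homX g ≫ tensorInr B E ≫ pushπ f g
  have h := push_condition f g
  have e := congrArg (fun t ↦ ((λ_ A.X).inv ≫ (ρ_ _).inv ≫ (η[B.X] ▷ A.X) ▷ _ ≫ _ ◁ η[E.X]) ≫ t) h
  simp only [pushd₀, pushd₁, Category.assoc] at e
  convert e using 1
  · rw [whisker_exchange_assoc, ← comp_whiskerRight_assoc, ← whisker_exchange_assoc (η[B.X]),
      MonObj.one_mul, tensorInl, Category.assoc]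
    simp
  · rw [associator_naturality_right_assoc, ← whiskerLeft_comp_assoc, whisker_exchange_assoc,
      MonObj.mul_one, tensorInr, associator_naturality_left_assoc, ← whisker_exchange_assoc]
    simp

lemma tensorInl_mul_tensorInr (B E : CommMon D) :
    (tensorInl B E ⊗ₘ tensorInr B E) ≫ μ[B.X ⊗ E.X] = 𝟙 _ := by
  have h := tensorμ_natural (𝟙 B.X) η[E.X] η[B.X] (𝟙 E.X)
  rw [tensorObj.mul_def, tensorInl, tensorInr, ← id_tensorHom, ← tensorHom_id,
    ← tensorHom_comp_tensorHom, Category.assoc, reassoc_of% h, tensorHom_comp_tensorHom]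
  simp only [id_tensorHom, tensorHom_id, MonObj.mul_one, MonObj.one_mul]
  have hb : (β_ (𝟙_ D) (𝟙_ D)).hom = 𝟙 _ := by
    rw [braiding_tensorUnit_left, unitors_equal, Iso.hom_inv_id]
  simp only [tensorμ, hb]
  monoidal

lemma tensor_hom_eq {Z : CommMon D} (h : B.X ⊗ E.X ⟶ Z.X) [IsMonHom h] :
    h = (tensorInl B E ≫ h ⊗ₘ tensorInr B E ≫ h) ≫ μ[Z.X] := by
  rw [← tensorHom_comp_tensorHom, Category.assoc, ← IsMonHom.mul_hom,
    reassoc_of% tensorInl_mul_tensorInr]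

variable {f g}

lemma pushMon_hom_ext {Z : CommMon D} {h k : pushMon f g ⟶ Z}
    (h₁ : pushInl f g ≫ h = pushInl f g ≫ k) (h₂ : pushInr f g ≫ h = pushInr f g ≫ k) :
    h = k := by
  apply commMon_hom_ext
  rw [← cancel_epi (pushProj f g), tensor_hom_eq (pushProj f g ≫ homX h),
    tensor_hom_eq (pushProj f g ≫ homX k)]
  have e₁ : tensorInl B E ≫ pushProj f g ≫ homX h = tensorInl B E ≫ pushProj f g ≫ homX k := by
    have := congrArg homX h₁
    change (tensorInl B E ≫ pushProj f g) ≫ homX h = (tensorInl B E ≫ pushProj f g) ≫ homX k at this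
    simpa only [Category.assoc] using this
  have e₂ : tensorInr B E ≫ pushProj f g ≫ homX h = tensorInr B E ≫ pushProj f g ≫ homX k := by
    have := congrArg homX h₂
    change (tensorInr B E ≫ pushProj f g) ≫ homX h = (tensorInr B E ≫ pushProj f g) ≫ homX k at this
    simpa only [Category.assoc] using this
  rw [e₁, e₂]

lemma exists_pushDesc {Z : CommMon D} (b : B ⟶ Z) (e : E ⟶ Z) (w : f ≫ b = g ≫ e) :
    ∃ k : (pushMon f g).X ⟶ Z.X, pushProj f g ≫ k = (homX b ⊗ₘ homX e) ≫ μ[Z.X] := by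
  have w' : homX f ≫ homX b = homX g ≫ homX e := congrArg homX w
  refine ⟨_, Cofork.IsColimit.π_desc' (pushIsColimit f g) ((homX b ⊗ₘ homX e) ≫ μ[Z.X]) ?_⟩
  have e₁ : pushd₀ f ≫ (homX b ⊗ₘ homX e) ≫ μ[Z.X] =
      ((homX b ⊗ₘ homX f ≫ homX b) ⊗ₘ homX e) ≫ μ[Z.X] ▷ Z.X ≫ μ[Z.X] := by
    rw [pushd₀, ← tensorHom_id, tensorHom_comp_tensorHom_assoc, Category.assoc, IsMonHom.mul_hom,
      ← id_tensorHom, tensorHom_comp_tensorHom_assoc, ← tensorHom_id,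
      tensorHom_comp_tensorHom_assoc]
    simp only [Category.id_comp, Category.comp_id]
  have e₂ : pushd₁ g ≫ (homX b ⊗ₘ homX e) ≫ μ[Z.X] =
      ((homX b ⊗ₘ homX g ≫ homX e) ⊗ₘ homX e) ≫ μ[Z.X] ▷ Z.X ≫ μ[Z.X] := by
    rw [MonObj.mul_assoc, pushd₁, Category.assoc, ← id_tensorHom, tensorHom_comp_tensorHom_assoc,
      Category.assoc, IsMonHom.mul_hom, ← tensorHom_id, tensorHom_comp_tensorHom_assoc,
      associator_naturality_assoc, ← id_tensorHom, tensorHom_comp_tensorHom_assoc]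
    simp only [Category.id_comp, Category.comp_id]
  rw [e₁, e₂, w']

lemma isMonHom_of_pushProj {Z : CommMon D} (k : (pushMon f g).X ⟶ Z.X)
    (hk : IsMonHom (pushProj f g ≫ k)) : IsMonHom k where
  one_hom := by
    have h := hk.one_hom
    rwa [← Category.assoc, IsMonHom.one_hom (pushProj f g)] at h
  mul_hom := by
    have : Epi (pushProj f g ⊗ₘ pushProj f g) := by
      rw [MonoidalCategory.tensorHom_def]
      infer_instance
    rw [← cancel_epi (pushProj f g ⊗ₘ pushProj f g), ← IsMonHom.mul_hom_assoc, hk.mul_hom,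
      tensorHom_comp_tensorHom_assoc]

lemma tensorInl_desc {Z : CommMon D} (b : B ⟶ Z) (e : E ⟶ Z) :
    tensorInl B E ≫ (homX b ⊗ₘ homX e) ≫ μ[Z.X] = homX b := by
  rw [tensorInl, Category.assoc, MonoidalCategory.tensorHom_def', Category.assoc,
    ← whiskerLeft_comp_assoc, IsMonHom.one_hom, whisker_exchange_assoc, MonObj.mul_one]
  simp

lemma tensorInr_desc {Z : CommMon D} (b : B ⟶ Z) (e : E ⟶ Z) :
    tensorInr B E ≫ (homX b ⊗ₘ homX e) ≫ μ[Z.X] = homX e := by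
  rw [tensorInr, Category.assoc, MonoidalCategory.tensorHom_def, Category.assoc,
    ← comp_whiskerRight_assoc, IsMonHom.one_hom, ← whisker_exchange_assoc, MonObj.one_mul]
  simp

variable (f g) in
/-- The commutative monoid `B ⊗_A E` is the pushout of `B` and `E` over `A`. -/
lemma isPushout_pushMon : IsPushout f g (pushInl f g) (pushInr f g) := by
  have key (s : PushoutCocone f g) : ∃ k : pushMon f g ⟶ s.pt,
      pushInl f g ≫ k = s.inl ∧ pushInr f g ≫ k = s.inr := by
    obtain ⟨k, hk⟩ := exists_pushDesc s.inl s.inr s.condition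
    have hk' : IsMonHom k := isMonHom_of_pushProj k (by rw [hk]; infer_instance)
    refine ⟨commMonHomMk k hk', commMon_hom_ext ?_, commMon_hom_ext ?_⟩
    · change (tensorInl B E ≫ pushProj f g) ≫ k = _
      rw [Category.assoc, hk, tensorInl_desc]
    · change (tensorInr B E ≫ pushProj f g) ≫ k = _
      rw [Category.assoc, hk, tensorInr_desc]
  exact ⟨⟨push_w f g⟩, ⟨PushoutCocone.IsColimit.mk _ (fun s ↦ (key s).choose)
    (fun s ↦ (key s).choose_spec.1) (fun s ↦ (key s).choose_spec.2)
    (fun s m h₁ h₂ ↦ pushMon_hom_ext (h₁.trans (key s).choose_spec.1.symm)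
      (h₂.trans (key s).choose_spec.2.symm))⟩⟩

/-- In a pushout square of commutative monoids, `E ⟶ Z` exhibits `Z` as the base change of the
`A`-module `E` along `A ⟶ B`. -/
lemma isBaseChange_of_isPushout {Z : CommMon D} {b : B ⟶ Z} {e : E ⟶ Z} (h : IsPushout f g b e) :
    IsBaseChange (homX f) (M := algMod (homX g)) (N := algMod (homX b)) (homX e) := by
  have w' : homX f ≫ homX b = homX g ≫ homX e := congrArg homX h.w
  have hs : Semilinear (homX f) (M := algMod (homX g)) (N := algMod (homX b)) (homX e) := by
    change (homX g ▷ E.X ≫ μ[E.X]) ≫ homX e =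
      A.X ◁ homX e ≫ homX f ▷ Z.X ≫ homX b ▷ Z.X ≫ μ[Z.X]
    rw [← comp_whiskerRight_assoc, w', Category.assoc, IsMonHom.mul_hom,
      MonoidalCategory.tensorHom_def, comp_whiskerRight_assoc, Category.assoc,
      ← whisker_exchange_assoc, whisker_exchange_assoc (homX g), whisker_exchange_assoc (homX e)]
  refine ⟨hs, ?_⟩
  let i := (isPushout_pushMon f g).isoIsPushout _ _ h
  have hi : pushProj f g ≫ homX i.hom = (homX b ⊗ₘ homX e) ≫ μ[Z.X] := by
    have e₁ : tensorInl B E ≫ pushProj f g ≫ homX i.hom = homX b := by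
      have := congrArg homX ((isPushout_pushMon f g).inl_isoIsPushout_hom _ _ h)
      rw [← this]
      exact (Category.assoc _ _ _).symm
    have e₂ : tensorInr B E ≫ pushProj f g ≫ homX i.hom = homX e := by
      have := congrArg homX ((isPushout_pushMon f g).inr_isoIsPushout_hom _ _ h)
      rw [← this]
      exact (Category.assoc _ _ _).symm
    rw [tensor_hom_eq (pushProj f g ≫ homX i.hom), e₁, e₂]
  have hb : baseChangeHom (homX f) (M := algMod (homX g)) (N := algMod (homX b)) (homX e) hs =
      homX i.hom := by
    refine (cancel_epi (pushπ f g)).1 ?_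
    refine Eq.trans (bten_baseChangeHom (homX f) (M := algMod (homX g)) (N := algMod (homX b))
      (homX e) hs) (Eq.trans ?_ hi.symm)
    change B.X ◁ homX e ≫ homX b ▷ Z.X ≫ μ[Z.X] = _
    rw [MonoidalCategory.tensorHom_def', Category.assoc]
  apply isIso_of_hom
  change IsIso (baseChangeHom (homX f) (M := algMod (homX g)) (N := algMod (homX b)) (homX e) hs)
  rw [hb]
  exact inferInstanceAs (IsIso ((CommMon.forget D).map i.hom))

/-- Base change along pushout squares: if `θ : M ⟶ M'` is the base change along `B ⟶ Z` of a
`B`-module `M`, then it is also the base change along `A ⟶ E` of `M` considered as an `A`-module,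
when `Z` is the pushout of `B` and `E` over `A`. -/
lemma IsBaseChange.restr_of_isPushout {Z : CommMon D} {b : B ⟶ Z} {e : E ⟶ Z}
    (h : IsPushout f g b e) {M : Mod D B.X} {M' : Mod D Z.X} {θ : M.X ⟶ M'.X}
    (hθ : IsBaseChange (homX b) θ) :
    IsBaseChange (homX g) (M := restr (homX f) M) (N := restr (homX e) M') θ := by
  have w' : homX f ≫ homX b = homX g ≫ homX e := congrArg homX h.w
  obtain ⟨hθ₁, hθ₂⟩ := hθ
  have hs : Semilinear (homX g) (M := restr (homX f) M) (N := restr (homX e) M') θ := by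
    change (homX f ▷ M.X ≫ act M) ≫ θ = A.X ◁ θ ≫ homX g ▷ M'.X ≫ homX e ▷ M'.X ≫ act M'
    unfold Semilinear at hθ₁
    rw [← comp_whiskerRight_assoc, ← w', Category.assoc, hθ₁, comp_whiskerRight_assoc,
      whisker_exchange_assoc (homX f)]
  refine ⟨hs, ?_⟩
  have hψ := isBaseChange_of_isPushout h
  have i₁ := isIso_mixHom (N := algMod (homX g)) (N' := algMod (homX b)) (homX e) hψ M
  have i₂ : IsIso (baseChangeHom (homX b) θ hθ₁) :=
    inferInstanceAs (IsIso ((Mod.forget B.X).map (baseChangeMap (homX b) θ hθ₁)))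
  have i₃ : IsIso (braidHom M (algMod (homX b))).hom :=
    inferInstanceAs (IsIso ((Mod.forget B.X).map (braidIso M (algMod (homX b))).hom))
  have i₄ : IsIso (braidHom (restr (homX f) M) (algMod (homX g))).hom :=
    inferInstanceAs (IsIso ((Mod.forget A.X).map (braidIso (restr (homX f) M) (algMod (homX g))).hom))
  have key : (braidHom (restr (homX f) M) (algMod (homX g))).hom ≫
      baseChangeHom (homX g) (M := restr (homX f) M) (N := restr (homX e) M') θ hs =
      mixHom (homX f) (N := algMod (homX g)) (N' := algMod (homX b)) (homX e) hψ.1 M ≫ (braidHom M (algMod (homX b))).hom ≫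
        baseChangeHom (homX b) θ hθ₁ := by
    refine (cancel_epi (mten (homX f) M (algMod (homX g)))).1 ?_
    have e₁ : mten (homX f) M (algMod (homX g)) ≫
        (braidHom (restr (homX f) M) (algMod (homX g))).hom =
        (β_ M.X E.X).hom ≫ bten (homX g) (restr (homX f) M) := ten_braidHom _ _
    have e₂ := bten_baseChangeHom (homX g) (M := restr (homX f) M) (N := restr (homX e) M') θ hs
    have e₃ := mten_mixHom (homX f) (N := algMod (homX g)) (N' := algMod (homX b)) (homX e) hψ.1 M
    have e₄ : ten M (algMod (homX b)) ≫ (braidHom M (algMod (homX b))).hom =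
        (β_ M.X Z.X).hom ≫ bten (homX b) M := ten_braidHom _ _
    have e₅ := bten_baseChangeHom (homX b) θ hθ₁
    rw [reassoc_of% e₁, reassoc_of% e₃, reassoc_of% e₄, e₅]
    refine (congrArg ((β_ M.X E.X).hom ≫ ·) e₂).trans ?_
    change (β_ M.X E.X).hom ≫ E.X ◁ θ ≫ homX e ▷ M'.X ≫ act M' =
      M.X ◁ homX e ≫ (β_ M.X Z.X).hom ≫ Z.X ◁ θ ≫ act M'
    rw [BraidedCategory.braiding_naturality_right_assoc, whisker_exchange_assoc (homX e)]
  have i₅ : IsIso ((braidHom (restr (homX f) M) (algMod (homX g))).hom ≫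
      baseChangeHom (homX g) (M := restr (homX f) M) (N := restr (homX e) M') θ hs) := by
    rw [key]
    infer_instance
  have i₆ := IsIso.of_isIso_comp_left (braidHom (restr (homX f) M) (algMod (homX g))).hom
    (baseChangeHom (homX g) (N := restr (homX e) M') θ hs)
  exact isIso_of_hom (baseChangeMap (homX g) (M := restr (homX f) M) (N := restr (homX e) M') θ hs) i₆

end Tensor

end Pushouts

/-! ### Flat morphisms and the flat topology -/

section Flat

set_option linter.unusedSectionVars false

variable {D : Type u₁} [Category.{v₁} D] [MonoidalCategory D] [SymmetricCategory D] [Abelian D]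
  [∀ X : D, PreservesFiniteColimits (tensorLeft X)]

lemma preservesFiniteLimits_iff_forget {T : Type u₂} [Category.{v₂} T] {A : D} [MonObj A]
    [IsCommMonObj A] (G : T ⥤ Mod D A) :
    PreservesFiniteLimits G ↔ PreservesFiniteLimits (G ⋙ Mod.forget A) := by
  refine ⟨fun h ↦ inferInstance, fun h ↦ ⟨fun J _ _ ↦ ?_⟩⟩
  have : ReflectsLimitsOfShape J (Mod.forget (D := D) A) :=
    reflectsLimitsOfShape_of_reflectsIsomorphisms
  exact preservesLimitsOfShape_of_reflects_of_preserves G (Mod.forget A)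

lemma isIso_map_iff_forget {T : Type u₂} [Category.{v₂} T] {A : D} [MonObj A]
    [IsCommMonObj A] (G : T ⥤ Mod D A) {M N : T} (g : M ⟶ N) :
    IsIso (G.map g) ↔ IsIso ((G ⋙ Mod.forget A).map g) :=
  ⟨fun _ ↦ inferInstanceAs (IsIso ((Mod.forget A).map (G.map g))),
    fun h ↦ isIso_of_hom (G.map g) h⟩

variable {A B E Z : CommMon D}

/-- Extension of scalars along a morphism of commutative monoids, with values in `B`-modules. -/
noncomputable abbrev ext (f : A ⟶ B) : Mod D A.X ⥤ Mod D B.X := extFunctor (homX f)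

/-- Restriction of scalars along a morphism of commutative monoids. -/
abbrev res (f : A ⟶ B) : Mod D B.X ⥤ Mod D A.X := restrFunctor (homX f)

instance (f : A ⟶ B) : (ext f).IsLeftAdjoint := (extAdj (homX f)).isLeftAdjoint

instance (f : A ⟶ B) : (res f).IsRightAdjoint := (extAdj (homX f)).isRightAdjoint

/-- A morphism of commutative monoids is flat if extension of scalars is left exact. -/
def Flat (f : A ⟶ B) : Prop := PreservesFiniteLimits (ext f)

lemma flat_iff_extendScalars (f : A ⟶ B) : Flat f ↔ PreservesFiniteLimits (extendScalars f) := by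
  rw [Flat, preservesFiniteLimits_iff_forget, preservesFiniteLimits_iff_forget (extendScalars f)]
  exact ⟨fun (_ : PreservesFiniteLimits (extFunctor (homX f) ⋙ Mod.forget B.X)) ↦
      preservesFiniteLimits_of_natIso (extFunctorForgetIso (homX f)),
    fun (_ : PreservesFiniteLimits (tensorLeft (algMod (homX f)) ⋙ Mod.forget A.X)) ↦
      preservesFiniteLimits_of_natIso (extFunctorForgetIso (homX f)).symm⟩

lemma isIso_extendScalars_map_iff (f : A ⟶ B) {M N : Mod D A.X} (g : M ⟶ N) :
    IsIso ((extendScalars f).map g) ↔ IsIso ((ext f).map g) := by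
  rw [isIso_map_iff_forget, isIso_map_iff_forget (ext f)]
  exact (NatIso.isIso_map_iff (extFunctorForgetIso (homX f)) g).symm

lemma Flat.comp {f : A ⟶ B} {g : B ⟶ E} (hf : Flat f) (hg : Flat g) : Flat (f ≫ g) := by
  unfold Flat at *
  exact preservesFiniteLimits_of_natIso (extFunctorComp (homX f) (homX g)).symm

lemma flat_id (A : CommMon D) : Flat (𝟙 A) :=
  preservesFiniteLimits_of_natIso (F := 𝟭 _) (extFunctorId (A := A.X)).symm

lemma isIso_ext_comp_map_iff (f : A ⟶ B) (g : B ⟶ E) {M N : Mod D A.X} (h : M ⟶ N) :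
    IsIso ((ext (f ≫ g)).map h) ↔ IsIso ((ext g).map ((ext f).map h)) :=
  NatIso.isIso_map_iff (extFunctorComp (homX f) (homX g)) h

lemma isIso_ext_id_map_iff {M N : Mod D A.X} (h : M ⟶ N) :
    IsIso ((ext (𝟙 A)).map h) ↔ IsIso h :=
  NatIso.isIso_map_iff (extFunctorId (A := A.X)) h

section Pushout

variable {f : A ⟶ B} {g : A ⟶ E} {b : B ⟶ Z} {e : E ⟶ Z}

/-- Extension of scalars commutes with restriction of scalars, for pushout squares. -/
lemma nonempty_ext_res_iso (h : IsPushout f g b e) : Nonempty (res f ⋙ ext g ≅ ext b ⋙ res e) := by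
  have hb (M : Mod D B.X) : IsBaseChange (homX g) (M := restr (homX f) M)
      (N := restr (homX e) (extMod (homX b) M)) (extUnit (homX b) M) :=
    (isBaseChange_extUnit (f := homX b) M).restr_of_isPushout h
  have hi (M : Mod D B.X) := (isBaseChange_iff.1 (hb M)).2
  refine ⟨NatIso.ofComponents (fun M ↦ @asIso _ _ _ _ (extDesc (homX g) (M := restr (homX f) M)
      (N := restr (homX e) (extMod (homX b) M)) (extUnit (homX b) M) (hb M).1) (hi M)) ?_⟩
  intro M N k
  refine (bten_eq_iff (homX g)).2 ?_
  have e₁ := extUnit_extMap (homX g) (restrMap (homX f) k)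
  have e₂ := extUnit_extMap (homX b) k
  have e₃ (M : Mod D B.X) := extUnit_extDesc (homX g) (M := restr (homX f) M)
      (N := restr (homX e) (extMod (homX b) M)) (extUnit (homX b) M) (hb M).1
  refine ((Category.assoc _ _ _).symm.trans (congrArg (· ≫ _) e₁)).trans ?_
  refine ((Category.assoc _ _ _).trans (congrArg (k.hom ≫ ·) (e₃ N))).trans ?_
  refine e₂.symm.trans ?_
  exact (congrArg (· ≫ (extMap (homX b) k).hom) (e₃ M)).symm.trans (Category.assoc _ _ _)

lemma Flat.of_isPushout (h : IsPushout f g b e) (hg : Flat g) : Flat b := by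
  obtain ⟨i⟩ := nonempty_ext_res_iso h
  unfold Flat at *
  have : PreservesFiniteLimits (res f ⋙ ext g) := inferInstance
  rw [preservesFiniteLimits_iff_forget]
  have h2 : PreservesFiniteLimits (ext b ⋙ res e) := preservesFiniteLimits_of_natIso i
  exact (preservesFiniteLimits_iff_forget (ext b ⋙ res e)).1 h2

lemma isIso_ext_res_map_iff (h : IsPushout f g b e) {M N : Mod D B.X} (k : M ⟶ N) :
    IsIso ((ext b).map k) ↔ IsIso ((ext g).map ((res f).map k)) := by
  obtain ⟨i⟩ := nonempty_ext_res_iso h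
  rw [isIso_map_iff_forget]
  exact (isIso_map_iff_forget (ext b ⋙ res e) k).symm.trans (NatIso.isIso_map_iff i k).symm

/-- Extension of scalars along an epimorphism `A ⟶ B` is left inverse to restriction of scalars,
since `B` is the pushout of `B` and `B` over `A`. -/
lemma nonempty_res_ext_iso_id (f : A ⟶ B) [Epi f] : Nonempty (res f ⋙ ext f ≅ 𝟭 _) := by
  have h : IsPushout f f (𝟙 B) (𝟙 B) := by
    refine ⟨⟨by simp⟩, ⟨PushoutCocone.isColimitMkIdId f⟩⟩
  obtain ⟨i⟩ := nonempty_ext_res_iso h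
  exact ⟨i ≪≫ Functor.isoWhiskerRight (extFunctorId (A := B.X)) _ ≪≫ Functor.leftUnitor _ ≪≫
    restrFunctorId⟩

end Pushout

/-- Left exactness can be checked after extension of scalars along a jointly conservative family
of flat morphisms. -/
lemma flat_of_conservative (f : A ⟶ B) {κ : Type w} {Z : κ → CommMon D} (g : ∀ k, B ⟶ Z k)
    (hg : ∀ k, Flat (g k)) (hfg : ∀ k, PreservesFiniteLimits (ext f ⋙ ext (g k)))
    (hc : ∀ ⦃M N : Mod D B.X⦄ (a : M ⟶ N), (∀ k, IsIso ((ext (g k)).map a)) → IsIso a) :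
    Flat f := by
  refine ⟨fun J _ _ ↦ ⟨fun {K} ↦ ⟨fun {c} hc' ↦ ?_⟩⟩⟩
  let l := limit.lift (K ⋙ ext f) ((ext f).mapCone c)
  have : IsIso l := by
    refine hc l fun k ↦ ?_
    have : PreservesFiniteLimits (ext (g k)) := hg k
    have := hfg k
    let i := isLimitOfPreserves (ext (g k)) (limit.isLimit (K ⋙ ext f))
    let j : IsLimit ((ext (g k)).mapCone ((ext f).mapCone c)) :=
      isLimitOfPreserves (ext f ⋙ ext (g k)) hc'
    have e : (ext (g k)).map l = (j.conePointUniqueUpToIso i).hom := by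
      refine i.hom_ext fun x ↦ ?_
      rw [IsLimit.conePointUniqueUpToIso_hom_comp]
      change (ext (g k)).map l ≫ (ext (g k)).map (limit.π _ x) = (ext (g k)).map ((ext f).map (c.π.app x))
      rw [← Functor.map_comp, limit.lift_π]
      rfl
    rw [e]
    infer_instance
  exact ⟨IsLimit.ofIsoLimit (limit.isLimit (K ⋙ ext f))
    (Cone.ext (asIso l) fun x ↦ (limit.lift_π _ x).symm).symm⟩

variable (D) in
/-- The topology on affine schemes whose covering sieves are those such that extension of scalars
along the flat morphisms of the sieve is jointly conservative. -/
def flatTopology : GrothendieckTopology (Aff D) where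
  sieves X := {S | ∀ ⦃M N : Mod D X.unop.X⦄ (g : M ⟶ N),
    (∀ ⦃Y : Aff D⦄ (f : Y ⟶ X), S f → Flat f.unop → IsIso ((ext f.unop).map g)) → IsIso g}
  top_mem' X M N g hg := (isIso_ext_id_map_iff g).1 (hg (𝟙 X) trivial (flat_id _))
  pullback_stable' X Y S h hS M N g hg := by
    have h₁ : IsIso ((res h.unop).map g) := hS _ fun T f hf hf' ↦ by
      have sq := isPushout_pushMon h.unop f.unop
      refine (isIso_ext_res_map_iff sq g).1 (hg (pushInl h.unop f.unop).op ?_ (hf'.of_isPushout sq))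
      have e : (pushInl h.unop f.unop).op ≫ h = (pushInr h.unop f.unop).op ≫ f :=
        congrArg Quiver.Hom.op sq.w
      change S _
      rw [e]
      exact S.downward_closed hf _
    exact isIso_of_hom g ((isIso_map_iff_forget (res h.unop) g).1 h₁)
  transitive' X S hS R hR M N g hg := hS g fun Y f hf hf' ↦ hR hf _ fun T r hr hr' ↦
    (isIso_ext_comp_map_iff f.unop r.unop g).1 (hg (r ≫ f) hr (hf'.comp hr'))

lemma zariskiTopology_le_flatTopology : zariskiTopology D ≤ flatTopology D := by
  refine Precoverage.toGrothendieck_le_iff_le_toPrecoverage.2 ?_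
  rintro X R ⟨hR, n, Y, f, hf, hc⟩
  rw [GrothendieckTopology.mem_toPrecoverage_iff]
  intro M N g hg
  exact hc g fun k ↦ (isIso_extendScalars_map_iff _ _).2 (hg (f k)
    (Sieve.le_generate R _ _ (hf k)) ((flat_iff_extendScalars _).2 (hR (f k) (hf k)).flat))

end Flat

/-! ### The category of affine opens of a sheaf -/

section AffineOpens

set_option linter.unusedSectionVars false

variable {C : Type u} [Category.{v} C] [MonoidalCategory C] [SymmetricCategory C] [Abelian C]
  [∀ X : C, PreservesFiniteColimits (tensorLeft X)]

lemma IsOpenImm.hom_ext {Y X : (Aff C)ᵒᵖ ⥤ Type (max u v)} {f : Y ⟶ X} (hf : IsOpenImm f)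
    {T : Aff C} {a b : Spec.obj T ⟶ Y} (h : a ≫ f = b ≫ f) : a = b := by
  have := (hf T (a ≫ f)).1
  have e : pullback.lift (f := f) (g := a ≫ f) a (𝟙 _) (by simp) =
      pullback.lift (f := f) (g := a ≫ f) b (𝟙 _) (by simp [h]) := by
    rw [← cancel_mono (pullback.snd f (a ≫ f)), pullback.lift_snd, pullback.lift_snd]
  have e' := congrArg (· ≫ pullback.fst f (a ≫ f)) e
  rwa [pullback.lift_fst, pullback.lift_fst] at e'

/-- The element of a presheaf corresponding to a morphism from an affine scheme. -/
abbrev toElem {Y : (Aff C)ᵒᵖ ⥤ Type (max u v)} {T : Aff C} (a : Spec.obj T ⟶ Y) : Y.obj (op T) :=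
  uliftYonedaEquiv a

lemma exists_toElem {Y : (Aff C)ᵒᵖ ⥤ Type (max u v)} {T : Aff C} (y : Y.obj (op T)) :
    ∃ a : Spec.obj T ⟶ Y, toElem a = y := ⟨uliftYonedaEquiv.symm y, Equiv.apply_symm_apply _ _⟩

lemma toElem_injective {Y : (Aff C)ᵒᵖ ⥤ Type (max u v)} {T : Aff C} :
    Function.Injective (toElem : (Spec.obj T ⟶ Y) → _) := uliftYonedaEquiv.injective

lemma toElem_comp {Y Z : (Aff C)ᵒᵖ ⥤ Type (max u v)} {T : Aff C} (a : Spec.obj T ⟶ Y) (b : Y ⟶ Z) :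
    b.app _ (toElem a) = toElem (a ≫ b) := (uliftYonedaEquiv_comp a b).symm

lemma map_toElem {Y : (Aff C)ᵒᵖ ⥤ Type (max u v)} {T S : Aff C} (a : Spec.obj T ⟶ Y) (h : S ⟶ T) :
    Y.map h.op (toElem a) = toElem (Spec.map h ≫ a) :=
  uliftYonedaEquiv_naturality (X := op T) (Y := op S) (F := Y) a h.op

lemma toElem_mem_range_iff {Y Z : (Aff C)ᵒᵖ ⥤ Type (max u v)} {T : Aff C} (a : Spec.obj T ⟶ Z)
    (b : Y ⟶ Z) : toElem a ∈ (Subfunctor.range b).obj (op T) ↔ ∃ t, t ≫ b = a := by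
  constructor
  · rintro ⟨y, hy⟩
    obtain ⟨t, rfl⟩ := exists_toElem y
    exact ⟨t, toElem_injective ((toElem_comp t b).symm.trans hy)⟩
  · rintro ⟨t, rfl⟩
    exact ⟨toElem t, toElem_comp t b⟩

lemma toElem_mem_iSup_iff {κ : Type w} {Y : κ → (Aff C)ᵒᵖ ⥤ Type (max u v)}
    {Z : (Aff C)ᵒᵖ ⥤ Type (max u v)} {T : Aff C} (a : Spec.obj T ⟶ Z) (b : ∀ k, Y k ⟶ Z) :
    toElem a ∈ (⨆ k, Subfunctor.range (b k)).obj (op T) ↔ ∃ k t, t ≫ b k = a := by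
  simp only [Subfunctor.iSup_obj, Set.mem_iUnion, toElem_mem_range_iff]

/-- Local membership in a sheaf image. -/
lemma mem_zariskiTopology_of_mem_sheafImage {κ : Type w} {Y : κ → (Aff C)ᵒᵖ ⥤ Type (max u v)}
    {Z : (Aff C)ᵒᵖ ⥤ Type (max u v)} {T : Aff C} (a : Spec.obj T ⟶ Z) (b : ∀ k, Y k ⟶ Z)
    (h : toElem a ∈ (sheafImage b).obj (op T)) :
    ∃ S ∈ zariskiTopology C T, ∀ ⦃T' : Aff C⦄ (h : T' ⟶ T), S h →
      ∃ k t, t ≫ b k = Spec.map h ≫ a := by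
  refine ⟨_, h, fun T' r hr ↦ ?_⟩
  have : Z.map r.op (toElem a) ∈ (⨆ k, Subfunctor.range (b k)).obj (op T') := hr
  rwa [map_toElem, toElem_mem_iSup_iff] at this

variable {X : ZarSheaf C}

lemma ZarAff.w {V U : ZarAff X} (a : V ⟶ U) : Spec.map a.hom.left ≫ U.imm = V.imm :=
  CostructuredArrow.w a.hom

/-- The category of affine opens is thin. -/
instance (V U : ZarAff X) : Subsingleton (V ⟶ U) where
  allEq a b := by
    have h : Spec.map a.hom.left = Spec.map b.hom.left :=
      U.property.hom_ext ((ZarAff.w a).trans (ZarAff.w b).symm)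
    exact ObjectProperty.hom_ext _ (CostructuredArrow.hom_ext _ _ (Spec.map_injective h))

/-- A factorisation of `V ⟶ X` through `U ⟶ X` is a morphism of affine opens. -/
lemma ZarAff.exists_hom {V U : ZarAff X} (t : Spec.obj V.obj.left ⟶ Spec.obj U.obj.left)
    (h : t ≫ U.imm = V.imm) : ∃ a : V ⟶ U, Spec.map a.hom.left = t :=
  ⟨ObjectProperty.homMk (CostructuredArrow.homMk (Spec.preimage t)
    (by rw [Functor.map_preimage]; exact h)), Functor.map_preimage _ _⟩

/-- The restriction morphism `O(U) ⟶ O(V)` for affine opens `V ⊆ U`. -/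
abbrev resRing {V U : ZarAff X} (a : V ⟶ U) : ringOf U ⟶ ringOf V := structureSheaf.map a.op

lemma toElem_mem_range_snd_iff {V U : ZarAff X} (a : V ⟶ U) {T : Aff C} (y : T ⟶ U.obj.left) :
    toElem (Spec.map y) ∈ (Subfunctor.range (pullback.snd V.imm U.imm)).obj (op T) ↔
      ∃ z : T ⟶ V.obj.left, z ≫ a.hom.left = y := by
  rw [toElem_mem_range_iff]
  constructor
  · rintro ⟨p, hp⟩
    refine ⟨Spec.preimage (p ≫ pullback.fst _ _), Spec.map_injective ?_⟩
    apply U.property.hom_ext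
    rw [Functor.map_comp, Functor.map_preimage, Category.assoc, ZarAff.w, ← hp, Category.assoc,
      Category.assoc, pullback.condition]
  · rintro ⟨z, rfl⟩
    refine ⟨pullback.lift (Spec.map z) (Spec.map (z ≫ a.hom.left)) ?_, pullback.lift_snd _ _ _⟩
    rw [Functor.map_comp, Category.assoc, ZarAff.w]

/-- The restriction morphisms of the structure sheaf are flat: locally on the source, `V ⟶ U` is the
composition of a flat morphism and a Zariski open of `U`. -/
lemma flat_resRing {V U : ZarAff X} (a : V ⟶ U) : Flat (resRing a) := by
  let f := a.hom.left
  -- the image of `V` in `U` is the union of affine Zariski opens `b k : B k ⟶ U`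
  obtain ⟨κ, B, b, hb, hVU⟩ := (V.property U.obj.left U.imm).2
  have hmono {T : Aff C} {z z' : T ⟶ V.obj.left} (h : z ≫ f = z' ≫ f) : z = z' := by
    apply Spec.map_injective
    apply V.property.hom_ext
    change _ ≫ V.imm = _ ≫ V.imm
    rw [← ZarAff.w a, ← Functor.map_comp_assoc, ← Functor.map_comp_assoc, h]
  have hz (k : κ) : ∃ z, z ≫ f = b k := by
    rw [← toElem_mem_range_snd_iff a]
    have h := Subfunctor.le_sheafify (zariskiTopology C)
      (⨆ k, Subfunctor.range (Spec.map (b k))) (op (B k))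
      ((toElem_mem_iSup_iff (Spec.map (b k)) fun k ↦ Spec.map (b k)).2 ⟨k, 𝟙 _, Category.id_comp _⟩)
    rw [hVU]
    exact h
  have hf : toElem (Spec.map f) ∈ (sheafImage fun k ↦ Spec.map (b k)).obj (op _) := by
    rw [← hVU, toElem_mem_range_snd_iff a]
    exact ⟨𝟙 _, Category.id_comp _⟩
  -- locally on `V`, the inclusion of `V` in `U` factors through some `b k`
  obtain ⟨S, hS, hS'⟩ := mem_zariskiTopology_of_mem_sheafImage _ _ hf
  refine flat_of_conservative (κ := Σ T : Aff C, {h : T ⟶ V.obj.left // S h ∧ Flat h.unop})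
    f.unop (fun k ↦ k.2.1.unop) (fun k ↦ k.2.2.2) ?_ ?_
  · rintro ⟨T, h, hSh, hh⟩
    obtain ⟨k, t, ht⟩ := hS' h hSh
    obtain ⟨t, rfl⟩ := Spec.map_surjective t
    obtain ⟨z, hz⟩ := hz k
    have ht : t ≫ b k = h ≫ f := Spec.map_injective (by
      rw [Functor.map_comp, Functor.map_comp]; exact ht)
    have htz : t ≫ z = h := hmono (by rw [Category.assoc, hz, ht])
    have hzu : b k = z ≫ f := hz.symm
    -- `O(V) ⟶ O(B k)` is an epimorphism, so flatness of `O(V) ⟶ O(T)` gives that of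
    -- `O(B k) ⟶ O(T)`
    have : Epi (f.unop ≫ z.unop) := by
      have := (hb k).epi
      rw [hzu] at this
      exact this
    have : Epi z.unop := epi_of_epi f.unop z.unop
    obtain ⟨i⟩ := nonempty_res_ext_iso_id z.unop
    have hbk : Flat (b k).unop := (flat_iff_extendScalars _).2 (hb k).flat
    have hb' : PreservesFiniteLimits (ext (b k).unop) := hbk
    have hh' : PreservesFiniteLimits (ext h.unop) := hh
    have htf : PreservesFiniteLimits (ext t.unop) := by
      let j : res z.unop ⋙ ext (z.unop ≫ t.unop) ≅ ext t.unop :=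
        Functor.isoWhiskerLeft _ (extFunctorComp (homX z.unop) (homX t.unop)) ≪≫
          (Functor.associator _ _ _).symm ≪≫ Functor.isoWhiskerRight i _ ≪≫ Functor.leftUnitor _
      have e : z.unop ≫ t.unop = h.unop := congrArg Quiver.Hom.unop htz
      rw [e] at j
      exact preservesFiniteLimits_of_natIso j
    have e : (b k).unop ≫ t.unop = f.unop ≫ h.unop := congrArg Quiver.Hom.unop ht
    have h₁ : PreservesFiniteLimits (ext ((b k).unop ≫ t.unop)) := hbk.comp htf
    rw [e] at h₁
    exact @preservesFiniteLimits_of_natIso _ _ _ _ _ _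
      (extFunctorComp (homX f.unop) (homX h.unop)) h₁
  · intro M N g hg
    exact zariskiTopology_le_flatTopology _ hS g fun T h hSh hh ↦ hg ⟨T, h, hSh, hh⟩

/-- The members of an affine cover, as affine opens. -/
abbrev IsAffineCover.member {κ : Type w} {A : κ → Aff C} {f : ∀ k, Spec.obj (A k) ⟶ X.obj}
    (hf : IsAffineCover X f) (k : κ) : ZarAff X := ⟨CostructuredArrow.mk (f k), hf.openImm k⟩

/-- A morphism of `O(V)`-modules is an isomorphism if its restriction to every affine open of `V`
contained in a member of a given affine cover is so. -/
lemma IsAffineCover.isIso (hss : IsSemiSeparated X) {κ : Type w} {A : κ → Aff C}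
    {f : ∀ k, Spec.obj (A k) ⟶ X.obj} (hf : IsAffineCover X f) (V : ZarAff X)
    {M N : Mod C (ringOf V).X} (g : M ⟶ N)
    (hg : ∀ k (W : ZarAff X) (p : W ⟶ V) (_ : W ⟶ hf.member k),
      IsIso ((ext (resRing p)).map g)) : IsIso g := by
  have hV : toElem V.imm ∈ (sheafImage f).obj (op _) := by
    rw [hf.epi]; trivial
  obtain ⟨S, hS, hS'⟩ := mem_zariskiTopology_of_mem_sheafImage _ _ hV
  refine zariskiTopology_le_flatTopology _ hS g fun T h hSh _ ↦ ?_
  obtain ⟨k, t, ht⟩ := hS' h hSh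
  obtain ⟨W, p, q, hpq⟩ := hss V (hf.member k)
  have hw : Spec.preimage (hpq.lift (Spec.map h) t ht.symm) ≫ p.hom.left = h :=
    Spec.map_injective (by rw [Functor.map_comp, Functor.map_preimage, hpq.lift_fst])
  have h₁ := hg k W p q
  have h₂ := (isIso_ext_comp_map_iff (resRing p) (Spec.preimage (hpq.lift (Spec.map h) t
    ht.symm)).unop g).2 inferInstance
  have e : resRing p ≫ (Spec.preimage (hpq.lift (Spec.map h) t ht.symm)).unop = h.unop :=
    congrArg Quiver.Hom.unop hw
  rwa [e] at h₂

lemma ZarAff.comp_left {U V W : ZarAff X} (a : W ⟶ V) (b : V ⟶ U) :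
    a.hom.left ≫ b.hom.left = (a ≫ b).hom.left := rfl

/-- If `W = U ∩ V` and `W' = U ∩ V'` with `V' ⊆ V`, then `O(W')` is the pushout of `O(W)` and
`O(V')` over `O(V)`. -/
lemma isPushout_resRing {U V V' W W' : ZarAff X} (a : V' ⟶ V) (p : W ⟶ U) (q : W ⟶ V)
    (p' : W' ⟶ U) (q' : W' ⟶ V') (c : W' ⟶ W)
    (h : IsPullback (Spec.map p.hom.left) (Spec.map q.hom.left) U.imm V.imm)
    (h' : IsPullback (Spec.map p'.hom.left) (Spec.map q'.hom.left) U.imm V'.imm) :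
    IsPushout (resRing q) (resRing a) (resRing c) (resRing q') := by
  have w : c.hom.left ≫ q.hom.left = q'.hom.left ≫ a.hom.left := by
    rw [ZarAff.comp_left, ZarAff.comp_left, Subsingleton.elim (c ≫ q)]
  have sq : IsPullback (Spec.map c.hom.left) (Spec.map q'.hom.left) (Spec.map q.hom.left)
      (Spec.map a.hom.left) := by
    refine IsPullback.of_right (h₁₂ := Spec.map p.hom.left) (h₂₂ := V.imm) (v₁₃ := U.imm) ?_ ?_ h
    · rw [← Functor.map_comp, ZarAff.w a, ZarAff.comp_left, Subsingleton.elim (c ≫ p) p']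
      exact h'
    · rw [← Functor.map_comp, ← Functor.map_comp, w]
  exact (IsPullback.of_map Spec w sq).unop.flip

section Inter

variable (hss : IsSemiSeparated X)

/-- The intersection of two affine opens of a semi-separated sheaf. -/
noncomputable def inter (U V : ZarAff X) : ZarAff X := (hss U V).choose

/-- The inclusion of `U ∩ V` in `U`. -/
noncomputable def interLeft (U V : ZarAff X) : inter hss U V ⟶ U := (hss U V).choose_spec.choose

/-- The inclusion of `U ∩ V` in `V`. -/
noncomputable def interRight (U V : ZarAff X) : inter hss U V ⟶ V :=
  (hss U V).choose_spec.choose_spec.choose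

lemma inter_isPullback (U V : ZarAff X) : IsPullback (Spec.map (interLeft hss U V).hom.left)
    (Spec.map (interRight hss U V).hom.left) U.imm V.imm :=
  (hss U V).choose_spec.choose_spec.choose_spec

lemma exists_hom_inter {U V W : ZarAff X} (a : W ⟶ U) (b : W ⟶ V) :
    Nonempty (W ⟶ inter hss U V) := by
  have w := (ZarAff.w a).trans (ZarAff.w b).symm
  obtain ⟨c, -⟩ := ZarAff.exists_hom (V := W) (U := inter hss U V)
    ((inter_isPullback hss U V).lift _ _ w) (by
      rw [← ZarAff.w (interLeft hss U V), IsPullback.lift_fst_assoc, ZarAff.w])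
  exact ⟨c⟩

end Inter

end AffineOpens

/-! ### The abelian category of quasi-coherent modules -/

/-- If the components of a natural transformation between limit-preserving functors are
isomorphisms on a diagram, then so is the component at the limit. -/
lemma isIso_app_of_isLimit {K : Type w} [Category.{w} K] {E : Type u₁} [Category.{v₁} E]
    {T : Type u₂} [Category.{v₂} T] {G H : E ⥤ T} (τ : G ⟶ H) {S : K ⥤ E} {c : Cone S}
    (hc : IsLimit c) [PreservesLimit S G] [PreservesLimit S H]
    (h : ∀ k, IsIso (τ.app (S.obj k))) : IsIso (τ.app c.pt) := by
  have : IsIso (Functor.whiskerLeft S τ) := @NatIso.isIso_of_isIso_app _ _ _ _ _ _ _ h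
  have e : τ.app c.pt = (IsLimit.conePointsIsoOfNatIso (isLimitOfPreserves G hc)
      (isLimitOfPreserves H hc) (asIso (Functor.whiskerLeft S τ))).hom :=
    (isLimitOfPreserves H hc).hom_ext fun k ↦ by
      rw [IsLimit.conePointsIsoOfNatIso_hom_comp]
      exact (τ.naturality (c.π.app k)).symm
  rw [e]
  infer_instance

/-- If the components of a natural transformation between colimit-preserving functors are
isomorphisms on a diagram, then so is the component at the colimit. -/
lemma isIso_app_of_isColimit {K : Type u₃} [Category.{v₃} K] {E : Type u₁} [Category.{v₁} E]
    {T : Type u₂} [Category.{v₂} T] {G H : E ⥤ T} (τ : G ⟶ H) {S : K ⥤ E} {c : Cocone S}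
    (hc : IsColimit c) [PreservesColimit S G] [PreservesColimit S H]
    (h : ∀ k, IsIso (τ.app (S.obj k))) : IsIso (τ.app c.pt) := by
  have : IsIso (Functor.whiskerLeft S τ) := @NatIso.isIso_of_isIso_app _ _ _ _ _ _ _ h
  have e : τ.app c.pt = (IsColimit.coconePointsIsoOfNatIso (isColimitOfPreserves G hc)
      (isColimitOfPreserves H hc) (asIso (Functor.whiskerLeft S τ))).hom :=
    (isColimitOfPreserves G hc).hom_ext fun k ↦ by
      rw [IsColimit.comp_coconePointsIsoOfNatIso_hom]
      exact τ.naturality (c.ι.app k)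
  rw [e]
  infer_instance

section QuasiCoherent

set_option linter.unusedSectionVars false

variable {J : Type u₂} [Category.{v₂} J]
variable {C : Type u₁} [Category.{v₁} C] [MonoidalCategory C] [SymmetricCategory C] [Abelian C]
variable [∀ X : C, PreservesFiniteColimits (tensorLeft X)]

instance {K : Type u₃} [Category.{v₃} K] [HasColimitsOfShape K C]
    [∀ X : C, PreservesColimitsOfShape K (tensorLeft X)] (F : J ⥤ C) :
    PreservesColimitsOfShape K (tensorLeft F) :=
  preservesColimitsOfShape_of_evaluation _ _ fun j ↦ by
    have : PreservesColimitsOfShape K ((evaluation J C).obj j ⋙ tensorLeft (F.obj j)) :=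
      inferInstance
    exact this

variable (R : J ⥤ CommMon C)

/-- The functor forgetting the module structure, from presheaves of modules to presheaves. -/
noncomputable abbrev PMod.forget : PMod R ⥤ (J ⥤ C) := Mod.forget (ringObj R).X

lemma preservesLimitsOfShape_sections {K : Type u₃} [Category.{v₃} K] [HasLimitsOfShape K C]
    (j : J) : PreservesLimitsOfShape K (sections R j) := by
  have : ReflectsLimitsOfShape K (Mod.forget (D := C) (R.obj j).X) :=
    reflectsLimitsOfShape_of_reflectsIsomorphisms
  have : PreservesLimitsOfShape K (sections R j ⋙ Mod.forget (R.obj j).X) :=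
    inferInstanceAs (PreservesLimitsOfShape K (PMod.forget R ⋙ (evaluation J C).obj j))
  exact preservesLimitsOfShape_of_reflects_of_preserves _ (Mod.forget (R.obj j).X)

lemma preservesColimitsOfShape_sections {K : Type u₃} [Category.{v₃} K] [HasColimitsOfShape K C]
    [∀ X : C, PreservesColimitsOfShape K (tensorLeft X)] (j : J) :
    PreservesColimitsOfShape K (sections R j) := by
  have : ReflectsColimitsOfShape K (Mod.forget (D := C) (R.obj j).X) :=
    reflectsColimitsOfShape_of_reflectsIsomorphisms
  have : PreservesColimitsOfShape K (sections R j ⋙ Mod.forget (R.obj j).X) :=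
    inferInstanceAs (PreservesColimitsOfShape K (PMod.forget R ⋙ (evaluation J C).obj j))
  exact preservesColimitsOfShape_of_reflects_of_preserves _ (Mod.forget (R.obj j).X)

variable {R} in
lemma isIso_of_sections {M N : PMod R} (g : M ⟶ N) (h : ∀ j, IsIso ((sections R j).map g)) :
    IsIso g := by
  have h' (j : J) : IsIso (g.hom.app j) :=
    @Functor.map_isIso _ _ _ _ _ _ (Mod.forget (R.obj j).X) _ (h j)
  exact isIso_of_hom g (NatIso.isIso_of_isIso_app g.hom)

/-- The comparison `R(j) ⊗_{R(i)} M(i) ⟶ M(j)`, natural in the presheaf of modules `M`. -/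
noncomputable def compare {i j : J} (s : i ⟶ j) : sections R i ⋙ ext (R.map s) ⟶ sections R j where
  app M := extDesc (homX (R.map s)) (M := sectionsObj R i M) (N := sectionsObj R j M)
    (resMap R M s) (semilinear_resMap R M s)
  naturality M N g := by
    refine (bten_eq_iff (homX (R.map s))).2 ?_
    have e₁ := extUnit_extMap (homX (R.map s)) ((sections R i).map g)
    have e₂ (M : PMod R) := extUnit_extDesc (homX (R.map s)) (M := sectionsObj R i M)
      (N := sectionsObj R j M) (resMap R M s) (semilinear_resMap R M s)
    refine ((Category.assoc _ _ _).symm.trans (congrArg (· ≫ _) e₁)).trans ?_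
    refine ((Category.assoc _ _ _).trans (congrArg (_ ≫ ·) (e₂ N))).trans ?_
    refine Eq.trans ?_ (Category.assoc _ _ _)
    refine Eq.trans ?_ (congrArg (· ≫ _) (e₂ M)).symm
    exact (g.hom.naturality s).symm

lemma quasiCoherent_iff (M : PMod R) :
    quasiCoherent R M ↔ ∀ ⦃i j : J⦄ (s : i ⟶ j), IsIso ((compare R s).app M) := by
  refine forall₃_congr fun i j s ↦ ⟨fun h ↦ ?_, fun h ↦ ?_⟩
  · exact (isBaseChange_iff.1 ⟨_, h⟩).2
  · exact (isBaseChange_iff.2 ⟨semilinear_resMap R M s, h⟩).2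

/-- A diagram of commutative monoids all of whose transition morphisms are flat. -/
class FlatDiagram : Prop where
  flat {i j : J} (s : i ⟶ j) : Flat (R.map s)

instance {K : Type u₃} [Category.{v₃} K] [HasColimitsOfShape K C]
    [∀ X : C, PreservesColimitsOfShape K (tensorLeft X)] :
    (quasiCoherent R).IsClosedUnderColimitsOfShape K where
  colimitsOfShape_le := by
    rintro M ⟨h⟩
    refine (quasiCoherent_iff R M).2 fun i j s ↦ ?_
    have := preservesColimitsOfShape_sections (K := K) R
    have : PreservesColimitsOfShape K (ext (R.map s)) := inferInstance
    exact isIso_app_of_isColimit (compare R s) h.isColimit fun k ↦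
      (quasiCoherent_iff R _).1 (h.prop_diag_obj k) s

instance [FlatDiagram R] {K : Type} [SmallCategory K] [FinCategory K] :
    (quasiCoherent R).IsClosedUnderLimitsOfShape K where
  limitsOfShape_le := by
    rintro M ⟨h⟩
    refine (quasiCoherent_iff R M).2 fun i j s ↦ ?_
    have := preservesLimitsOfShape_sections (K := K) R
    have : PreservesFiniteLimits (ext (R.map s)) := FlatDiagram.flat s
    exact isIso_app_of_isLimit (compare R s) h.isLimit fun k ↦
      (quasiCoherent_iff R _).1 (h.prop_diag_obj k) s

instance [FlatDiagram R] : (quasiCoherent R).IsClosedUnderKernels where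
  kernels_le := by
    rintro _ ⟨f, k, hk, hf⟩
    exact (quasiCoherent R).prop_of_isLimit hk (by rintro (_ | _); exacts [hf.1, hf.2])

instance : (quasiCoherent R).IsClosedUnderCokernels where
  cokernels_le := by
    rintro _ ⟨f, k, hk, hf⟩
    exact (quasiCoherent R).prop_of_isColimit hk (by rintro (_ | _); exacts [hf.1, hf.2])

instance [FlatDiagram R] : (quasiCoherent R).IsClosedUnderFiniteProducts where
  isClosedUnderLimitsOfShape K _ := by
    have := Fintype.ofFinite K
    infer_instance

instance [FlatDiagram R] : (quasiCoherent R).ContainsZero where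
  exists_zero := ⟨_, (isZero_zero (PMod R)).of_iso (HasZeroObject.zeroIsoIsTerminal
    terminalIsTerminal).symm, (quasiCoherent R).prop_terminal⟩

noncomputable instance [FlatDiagram R] : Abelian (QMod R) :=
  inferInstanceAs (Abelian (quasiCoherent R).FullSubcategory)

instance [FlatDiagram R] : PreservesFiniteLimits (quasiCoherent R).ι where
  preservesFiniteLimits _ _ _ := inferInstance

/-- The functor of sections over `j` on quasi-coherent modules. -/
noncomputable abbrev qsections (j : J) : QMod R ⥤ Mod C (R.obj j).X :=
  (quasiCoherent R).ι ⋙ sections R j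

instance [FlatDiagram R] (j : J) : PreservesFiniteLimits (qsections R j) where
  preservesFiniteLimits K _ _ := by
    have := preservesLimitsOfShape_sections (K := K) R j
    infer_instance

lemma preservesColimitsOfShape_qsections {K : Type u₃} [Category.{v₃} K] [HasColimitsOfShape K C]
    [∀ X : C, PreservesColimitsOfShape K (tensorLeft X)] (j : J) :
    PreservesColimitsOfShape K (qsections R j) := by
  have := preservesColimitsOfShape_sections (K := K) R j
  infer_instance

instance (j : J) : PreservesFiniteColimits (qsections R j) where
  preservesFiniteColimits _ _ _ := preservesColimitsOfShape_qsections R j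

instance (j : J) [FlatDiagram R] : (qsections R j).Additive :=
  Functor.additive_of_preserves_binary_products _

variable {R} in
lemma isIso_of_qsections {M N : QMod R} (g : M ⟶ N) (h : ∀ j, IsIso ((qsections R j).map g)) :
    IsIso g := by
  have : IsIso ((quasiCoherent R).ι.map g) := isIso_of_sections _ h
  exact isIso_of_fully_faithful (quasiCoherent R).ι g

/-- Naturality of the comparison, for quasi-coherent modules: extending scalars along
`R(i) ⟶ R(j)` turns sections over `i` into sections over `j`. -/
lemma isIso_ext_map_qsections_iff {i j : J} (s : i ⟶ j) {M N : QMod R} (g : M ⟶ N) :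
    IsIso ((ext (R.map s)).map ((qsections R i).map g)) ↔ IsIso ((qsections R j).map g) := by
  have h : IsIso (Functor.whiskerLeft (quasiCoherent R).ι (compare R s)) :=
    @NatIso.isIso_of_isIso_app _ _ _ _ _ _ _ fun M ↦ (quasiCoherent_iff R M.obj).1 M.property s
  exact NatIso.isIso_map_iff (asIso (Functor.whiskerLeft (quasiCoherent R).ι (compare R s))) g

instance [FlatDiagram R] {K : Type u₃} [Category.{v₃} K] [HasColimitsOfShape K C]
    [∀ X : C, PreservesColimitsOfShape K (tensorLeft X)] [HasExactColimitsOfShape K C] :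
    HasExactColimitsOfShape K (QMod R) := by
  have : ReflectsFiniteLimits ((quasiCoherent R).ι ⋙ PMod.forget R) := ⟨fun K _ _ ↦
    reflectsLimitsOfShape_of_reflectsIsomorphisms⟩
  exact HasExactColimitsOfShape.domain_of_functor K ((quasiCoherent R).ι ⋙ PMod.forget R)

end QuasiCoherent

section

variable {D : Type u₁} [Category.{v₁} D] [MonoidalCategory D] [SymmetricCategory D] [Abelian D]
  [∀ X : D, PreservesFiniteColimits (tensorLeft X)] {A : D} [MonObj A] [IsCommMonObj A]

instance {K : Type u₃} [Category.{v₃} K] [HasColimitsOfShape K D]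
    [∀ X : D, PreservesColimitsOfShape K (tensorLeft X)] [HasExactColimitsOfShape K D] :
    HasExactColimitsOfShape K (Mod D A) := by
  have : ReflectsFiniteLimits (Mod.forget (D := D) A) := ⟨fun K _ _ ↦
    reflectsLimitsOfShape_of_reflectsIsomorphisms⟩
  exact HasExactColimitsOfShape.domain_of_functor K (Mod.forget (D := D) A)

end

section

variable {C : Type u} [Category.{v} C] [MonoidalCategory C] [SymmetricCategory C] [Abelian C]
  [∀ X : C, PreservesFiniteColimits (tensorLeft X)] {X : ZarSheaf C}

instance : FlatDiagram (structureSheaf (X := X)) where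
  flat s := flat_resRing s.unop

/-- A morphism of quasi-coherent modules is an isomorphism if it is so on the members of an affine
cover. -/
lemma IsAffineCover.isIso_of_pullbackTo (hss : IsSemiSeparated X) {κ : Type w} {A : κ → Aff C}
    {f : ∀ k, Spec.obj (A k) ⟶ X.obj} (hf : IsAffineCover X f) {M N : QCoh X} (g : M ⟶ N)
    (hg : ∀ k, IsIso ((pullbackTo (hf.member k)).map g)) : IsIso g := by
  refine isIso_of_qsections g fun V ↦ hf.isIso hss V.unop _ fun k W p q ↦ ?_
  rw [isIso_ext_map_qsections_iff structureSheaf p.op g,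
    ← isIso_ext_map_qsections_iff structureSheaf q.op g]
  have := hg k
  exact inferInstanceAs (IsIso ((ext (resRing q)).map ((pullbackTo (hf.member k)).map g)))

end

/-! ### Direct images of modules on an affine open -/

section MkPMod

set_option linter.unusedSectionVars false

variable {J : Type u₂} [Category.{v₂} J]
variable {C : Type u₁} [Category.{v₁} C] [MonoidalCategory C] [SymmetricCategory C]
variable {R : J ⥤ CommMon C}

/-- A presheaf of modules from modules `N j` and semilinear restriction morphisms. -/
noncomputable def mkPMod (N : ∀ j, Mod C (R.obj j).X) (r : ∀ ⦃i j⦄, (i ⟶ j) → ((N i).X ⟶ (N j).X))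
    (hr : ∀ ⦃i j⦄ (s : i ⟶ j), Semilinear (M := N i) (N := N j) (homX (R.map s)) (r s))
    (hid : ∀ i, r (𝟙 i) = 𝟙 _) (hcomp : ∀ ⦃i j k⦄ (s : i ⟶ j) (t : j ⟶ k), r (s ≫ t) = r s ≫ r t) :
    PMod R :=
  mkMod (D := J ⥤ C) (A := (ringObj R).X)
    { obj := fun j ↦ (N j).X, map := fun s ↦ r s, map_id := hid, map_comp := fun s t ↦ hcomp s t }
    ⟨fun j ↦ act (N j), fun i j s ↦ by
      have h : act (N i) ≫ r s = (homX (R.map s) ⊗ₘ r s) ≫ act (N j) := by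
        rw [MonoidalCategory.tensorHom_def', Category.assoc]
        exact hr s
      exact h.symm⟩
    (NatTrans.ext (funext fun j ↦ one_act (N j)))
    (NatTrans.ext (funext fun j ↦ mul_act (N j)))

/-- A morphism of presheaves of modules from compatible morphisms on sections. -/
noncomputable def mkPHom {M N : PMod R} (φ : ∀ j, sectionsObj R j M ⟶ sectionsObj R j N)
    (h : ∀ ⦃i j⦄ (s : i ⟶ j), resMap R M s ≫ (φ j).hom = (φ i).hom ≫ resMap R N s) : M ⟶ N :=
  mkHom (D := J ⥤ C) (A := (ringObj R).X) ⟨fun j ↦ (φ j).hom, fun _ _ s ↦ h s⟩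
    (NatTrans.ext (funext fun j ↦ act_hom (φ j)))

lemma resMap_naturality {M N : PMod R} (g : M ⟶ N) ⦃i j : J⦄ (s : i ⟶ j) :
    resMap R M s ≫ ((sections R j).map g).hom = ((sections R i).map g).hom ≫ resMap R N s :=
  g.hom.naturality s

lemma pmod_hom_ext {M N : PMod R} {g h : M ⟶ N}
    (w : ∀ j, (sections R j).map g = (sections R j).map h) : g = h :=
  Mod.hom_ext _ _ (NatTrans.ext (funext fun j ↦ congrArg Mod.Hom.hom (w j)))

lemma resMap_comp (M : PMod R) {i j k : J} (s : i ⟶ j) (t : j ⟶ k) :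
    resMap R M (s ≫ t) = resMap R M s ≫ resMap R M t := M.X.map_comp s t

end MkPMod

section

variable {D : Type u₁} [Category.{v₁} D] [MonoidalCategory D] [SymmetricCategory D]
  [HasCoequalizers D] [∀ X : D, PreservesFiniteColimits (tensorLeft X)]
  {A B E : D} [MonObj A] [IsCommMonObj A] [MonObj B] [IsCommMonObj B] [MonObj E] [IsCommMonObj E]
  {f : A ⟶ B} [IsMonHom f] {g : B ⟶ E} [IsMonHom g]

/-- Semilinear morphisms out of a base change of `M` agree if they agree on `M`. -/
lemma IsBaseChange.semilinear_ext {M : Mod D A} {N : Mod D B} {P : Mod D E} {φ : M.X ⟶ N.X}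
    (hφ : IsBaseChange f φ) {x y : N.X ⟶ P.X} (hx : Semilinear g x) (hy : Semilinear g y)
    (h : φ ≫ x = φ ≫ y) : x = y :=
  congrArg Mod.Hom.hom (hφ.hom_ext (N' := restr g P) (a := mkHom (N := restr g P) x hx)
    (b := mkHom (N := restr g P) y hy) h)

end

section DirectImage

set_option linter.unusedSectionVars false

variable {J : Type u₂} [Category.{v₂} J] [Quiver.IsThin J]
variable {C : Type u₁} [Category.{v₁} C] [MonoidalCategory C] [SymmetricCategory C] [Abelian C]
variable [∀ X : C, PreservesFiniteColimits (tensorLeft X)]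

section Shift

variable (R : J ⥤ CommMon C) {U : J} (N : Mod C (R.obj U).X)

/-- The `R(k)`-module `R(k) ⊗_{R(U)} N`. -/
noncomputable abbrev extTo {k : J} (a : U ⟶ k) : Mod C (R.obj k).X := extMod (homX (R.map a)) N

/-- The universal semilinear morphism `N ⟶ R(k) ⊗_{R(U)} N`. -/
noncomputable abbrev toExtTo {k : J} (a : U ⟶ k) : N.X ⟶ (extTo R N a).X :=
  extUnit (homX (R.map a)) N

variable {k k' k'' : J} (a : U ⟶ k) (c : k ⟶ k') (b : U ⟶ k')

include b in
lemma homX_map_comp_eq : homX (R.map a) ≫ homX (R.map c) = homX (R.map b) := by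
  rw [← homX_comp, ← R.map_comp, Subsingleton.elim (a ≫ c) b]

lemma semilinear_toExtTo : Semilinear (M := N) (N := restr (homX (R.map c)) (extTo R N b))
    (homX (R.map a)) (toExtTo R N b) := by
  have h := semilinear_extUnit (homX (R.map b)) N
  have e := homX_map_comp_eq R a c b
  refine Semilinear.restr_right (P := extTo R N b) ?_
  unfold Semilinear at h ⊢
  rw [e]
  exact h

/-- The restriction morphism `R(k) ⊗_{R(U)} N ⟶ R(k') ⊗_{R(U)} N`. -/
noncomputable def shift : (extTo R N a).X ⟶ (extTo R N b).X :=
  (extDesc (homX (R.map a)) (M := N) (N := restr (homX (R.map c)) (extTo R N b)) (toExtTo R N b)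
    (semilinear_toExtTo R N a c b)).hom

lemma toExtTo_shift : toExtTo R N a ≫ shift R N a c b = toExtTo R N b :=
  extUnit_extDesc (homX (R.map a)) (M := N) (N := restr (homX (R.map c)) (extTo R N b))
    (toExtTo R N b) (semilinear_toExtTo R N a c b)

lemma semilinear_shift : Semilinear (M := extTo R N a) (N := extTo R N b) (homX (R.map c))
    (shift R N a c b) :=
  semilinear_of_restr _ _

lemma isBaseChange_shift : IsBaseChange (M := extTo R N a) (N := extTo R N b) (homX (R.map c))
    (shift R N a c b) := by
  refine (isBaseChange_extUnit (f := homX (R.map a)) N).of_comp (semilinear_shift R N a c b) ?_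
  have h := isBaseChange_extUnit (f := homX (R.map b)) N
  have e := homX_map_comp_eq R a c b
  have e' : extUnit (homX (R.map a)) N ≫ shift R N a c b = extUnit (homX (R.map b)) N :=
    toExtTo_shift R N a c b
  rw [e']
  simpa only [e] using h

variable {R N} in
/-- Semilinear morphisms out of `R(k) ⊗_{R(U)} N` agree if they agree on `N`. -/
lemma semilinear_ext {P : Mod C (R.obj k').X} {x y : (extTo R N a).X ⟶ P.X}
    (hx : Semilinear (M := extTo R N a) (homX (R.map c)) x)
    (hy : Semilinear (M := extTo R N a) (homX (R.map c)) y)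
    (h : toExtTo R N a ≫ x = toExtTo R N a ≫ y) : x = y :=
  (isBaseChange_extUnit (f := homX (R.map a)) N).semilinear_ext hx hy h

lemma shift_id (c : k ⟶ k) : shift R N a c a = 𝟙 _ := by
  refine semilinear_ext (P := extTo R N a) a c (semilinear_shift R N a c a) ?_
    ((toExtTo_shift R N a c a).trans (Category.comp_id _).symm)
  rw [Subsingleton.elim c (𝟙 k), R.map_id]
  exact semilinear_id_iff.2 (by rw [Category.comp_id]; simp)

lemma shift_comp (c' : k' ⟶ k'') (b' : U ⟶ k'') (e : k ⟶ k'') :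
    shift R N a e b' = shift R N a c b ≫ shift R N b c' b' := by
  refine semilinear_ext (P := extTo R N b') a e (semilinear_shift R N a e b') ?_ ?_
  · have h := (semilinear_shift R N a c b).comp (semilinear_shift R N b c' b')
    have e' : homX (R.map c) ≫ homX (R.map c') = homX (R.map e) := by
      rw [← homX_comp, ← R.map_comp, Subsingleton.elim (c ≫ c') e]
    unfold Semilinear at h ⊢
    rw [e'] at h
    exact h
  · rw [toExtTo_shift, reassoc_of% (toExtTo_shift R N a c b), toExtTo_shift]

lemma isIso_shift (d : k' ⟶ k) : IsIso (shift R N a c b) :=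
  ⟨shift R N b d a, by rw [← shift_comp R N a c b d a (𝟙 k), shift_id],
    by rw [← shift_comp R N b d a c b (𝟙 k'), shift_id]⟩

variable {N} in
lemma extMap_shift {N' : Mod C (R.obj U).X} (g : N ⟶ N') :
    shift R N a c b ≫ (extMap (homX (R.map b)) g).hom =
      (extMap (homX (R.map a)) g).hom ≫ shift R N' a c b := by
  refine semilinear_ext (P := extTo R N' b) a c
    ((semilinear_shift R N a c b).comp_hom (extMap (homX (R.map b)) g))
    ((semilinear_shift R N' a c b).hom_comp (extMap (homX (R.map a)) g)) ?_
  rw [reassoc_of% (toExtTo_shift R N a c b), reassoc_of% (extUnit_extMap (homX (R.map a)) g),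
    toExtTo_shift]
  exact extUnit_extMap _ _

end Shift

/-- Binary joins with a fixed object `U` in the (thin) index category of a diagram of commutative
monoids, compatible with pushouts of commutative monoids. -/
structure JoinsWith (R : J ⥤ CommMon C) (U : J) where
  /-- The join of `U` and `i`. -/
  obj : J → J
  /-- The morphism from `U` to the join. -/
  left (i : J) : U ⟶ obj i
  /-- The morphism from `i` to the join. -/
  right (i : J) : i ⟶ obj i
  /-- The universal property of the join. -/
  desc {i k : J} : (U ⟶ k) → (i ⟶ k) → (obj i ⟶ k)
  isPushout {i j : J} (s : i ⟶ j) (c : obj i ⟶ obj j) :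
    IsPushout (R.map (right i)) (R.map s) (R.map c) (R.map (right j))

variable {R : J ⥤ CommMon C} {U : J} (W : JoinsWith R U)

namespace JoinsWith

/-- Functoriality of the join. -/
def map {i j : J} (s : i ⟶ j) : W.obj i ⟶ W.obj j := W.desc (W.left j) (s ≫ W.right j)

/-- The direct image of an `R(U)`-module `N`, as a presheaf of modules: its sections over `i` are
`R(U ∨ i) ⊗_{R(U)} N`. -/
noncomputable def dirObj (N : Mod C (R.obj U).X) : PMod R :=
  mkPMod (fun i ↦ restr (homX (R.map (W.right i))) (extTo R N (W.left i)))
    (fun i j s ↦ shift R N (W.left i) (W.map s) (W.left j))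
    (fun _ _ s ↦ ((isBaseChange_shift R N _ _ _).restr_of_isPushout (W.isPushout s (W.map s))).1)
    (fun _ ↦ shift_id R N _ _)
    (fun _ _ _ _ _ ↦ shift_comp R N _ _ _ _ _ _)

lemma quasiCoherent_dirObj (N : Mod C (R.obj U).X) : quasiCoherent R (W.dirObj N) := fun i j s ↦
  ((isBaseChange_shift R N (W.left i) (W.map s) (W.left j)).restr_of_isPushout
    (W.isPushout s (W.map s))).2

/-- The direct image functor, from `R(U)`-modules to quasi-coherent modules. -/
noncomputable def dir : Mod C (R.obj U).X ⥤ QMod R where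
  obj N := ⟨W.dirObj N, W.quasiCoherent_dirObj N⟩
  map {N N'} g := ObjectProperty.homMk (mkPHom (M := W.dirObj N) (N := W.dirObj N')
    (fun i ↦ (res (R.map (W.right i))).map ((ext (R.map (W.left i))).map g))
    fun i j s ↦ extMap_shift R (W.left i) (W.map s) (W.left j) g)
  map_id N := ObjectProperty.hom_ext _ (pmod_hom_ext fun i ↦
    ((ext (R.map (W.left i)) ⋙ res (R.map (W.right i))).map_id N))
  map_comp g h := ObjectProperty.hom_ext _ (pmod_hom_ext fun i ↦
    ((ext (R.map (W.left i)) ⋙ res (R.map (W.right i))).map_comp g h))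

section Counit

variable (N : Mod C (R.obj U).X)

lemma semilinear_id_restr {k : J} (a : U ⟶ k) (d : k ⟶ U) :
    Semilinear (M := N) (N := restr (homX (R.map d)) N) (homX (R.map a)) (𝟙 N.X) := by
  have e : homX (R.map a) ≫ homX (R.map d) = 𝟙 _ := by
    rw [← homX_comp, ← R.map_comp, Subsingleton.elim (a ≫ d) (𝟙 U), R.map_id, homX_id]
  refine Semilinear.restr_right (P := N) ?_
  unfold Semilinear
  rw [e]
  simp

/-- The retraction of `N ⟶ R(U ∨ U) ⊗_{R(U)} N`. -/
noncomputable def retr : extTo R N (W.left U) ⟶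
    restr (homX (R.map (W.desc (𝟙 U) (𝟙 U)))) N :=
  extDesc (homX (R.map (W.left U))) (M := N) (N := restr (homX (R.map (W.desc (𝟙 U) (𝟙 U)))) N)
    (𝟙 N.X) (semilinear_id_restr N _ _)

lemma toExtTo_retr : toExtTo R N (W.left U) ≫ (W.retr N).hom = 𝟙 _ :=
  extUnit_extDesc (homX (R.map (W.left U))) (M := N)
    (N := restr (homX (R.map (W.desc (𝟙 U) (𝟙 U)))) N) (𝟙 N.X) (semilinear_id_restr N _ _)

lemma semilinear_retr : Semilinear (M := extTo R N (W.left U)) (N := N)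
    (homX (R.map (W.desc (𝟙 U) (𝟙 U)))) (W.retr N).hom :=
  semilinear_of_restr _ _

lemma retr_toExtTo : (W.retr N).hom ≫ toExtTo R N (W.left U) = 𝟙 _ := by
  have h := (W.semilinear_retr N).comp (semilinear_extUnit (homX (R.map (W.left U))) N)
  have e : homX (R.map (W.desc (𝟙 U) (𝟙 U))) ≫ homX (R.map (W.left U)) = homX (R.map (𝟙 _)) := by
    rw [← homX_comp, ← R.map_comp, Subsingleton.elim (W.desc (𝟙 U) (𝟙 U) ≫ W.left U) (𝟙 _)]
  refine semilinear_ext (P := extTo R N (W.left U)) (W.left U) (𝟙 _) ?_ ?_ ?_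
  · unfold Semilinear at h ⊢
    rw [e] at h
    exact h
  · rw [R.map_id]
    exact semilinear_id_iff.2 (by rw [Category.comp_id]; simp)
  · rw [reassoc_of% (W.toExtTo_retr N)]
    exact (Category.comp_id _).symm

/-- The counit of the adjunction between sections over `U` and direct image. -/
noncomputable def dirCounit : (qsections R U).obj (W.dir.obj N) ⟶ N :=
  mkHom (M := restr (homX (R.map (W.right U))) (extTo R N (W.left U))) (W.retr N).hom (by
    have h := W.semilinear_retr N
    have e : homX (R.map (W.right U)) ≫ homX (R.map (W.desc (𝟙 U) (𝟙 U))) = 𝟙 _ := by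
      rw [← homX_comp, ← R.map_comp, Subsingleton.elim (W.right U ≫ W.desc (𝟙 U) (𝟙 U)) (𝟙 U),
        R.map_id, homX_id]
    unfold Semilinear at h
    rw [act_restr, Category.assoc, h, ← whisker_exchange_assoc, ← comp_whiskerRight_assoc, e,
      id_whiskerRight_assoc])

instance : IsIso (W.dirCounit N) := by
  refine isIso_of_hom _ ⟨toExtTo R N (W.left U), W.retr_toExtTo N, W.toExtTo_retr N⟩

end Counit

section HomEquiv

variable {W} {M : QMod R} {N : Mod C (R.obj U).X}

lemma exists_lift_sections (φ : sectionsObj R U M.obj ⟶ N) {k : J} (a : U ⟶ k) :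
    ∃ θ : sectionsObj R k M.obj ⟶ extTo R N a,
      resMap R M.obj a ≫ θ.hom = φ.hom ≫ toExtTo R N a :=
  (isBaseChange_resMap R M.property a).exists_desc (φ.hom ≫ toExtTo R N a)
    ((semilinear_extUnit (homX (R.map a)) N).hom_comp φ)

lemma exists_dir_lift (φ : sectionsObj R U M.obj ⟶ N) :
    ∃ ψ : M ⟶ W.dir.obj N, (qsections R U).map ψ ≫ W.dirCounit N = φ := by
  -- the sections of `ψ` over `i` are `M(i) ⟶ M(U ∨ i) ⟶ R(U ∨ i) ⊗_{R(U)} N`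
  choose θ hθ using fun k (a : U ⟶ k) ↦ exists_lift_sections φ a
  have hθ' {k k'} (a : U ⟶ k) (c : k ⟶ k') (b : U ⟶ k') :
      resMap R M.obj c ≫ (θ k' b).hom = (θ k a).hom ≫ shift R N a c b := by
    refine (isBaseChange_resMap R M.property a).semilinear_ext (P := extTo R N b)
      ((semilinear_resMap R M.obj c).comp_hom (θ k' b))
      ((semilinear_shift R N a c b).hom_comp (θ k a)) ?_
    rw [← reassoc_of% (resMap_comp M.obj a c), Subsingleton.elim (a ≫ c) b, hθ,
      reassoc_of% (hθ k a), toExtTo_shift]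
  refine ⟨ObjectProperty.homMk (mkPHom (M := M.obj) (N := W.dirObj N)
    (fun i ↦ mkHom (M := sectionsObj R i M.obj)
      (N := restr (homX (R.map (W.right i))) (extTo R N (W.left i)))
      (resMap R M.obj (W.right i) ≫ (θ _ (W.left i)).hom)
      ((semilinear_resMap R M.obj (W.right i)).comp_hom (θ _ (W.left i)))) fun i j s ↦ ?_), ?_⟩
  · change resMap R M.obj s ≫ resMap R M.obj (W.right j) ≫ (θ _ (W.left j)).hom =
      (resMap R M.obj (W.right i) ≫ (θ _ (W.left i)).hom) ≫ shift R N (W.left i) (W.map s) (W.left j)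
    rw [← reassoc_of% (resMap_comp M.obj s (W.right j)), Category.assoc, ← hθ',
      ← reassoc_of% (resMap_comp M.obj (W.right i) (W.map s)),
      Subsingleton.elim (s ≫ W.right j) (W.right i ≫ W.map s)]
  · refine Mod.hom_ext _ _ ?_
    change (resMap R M.obj (W.right U) ≫ (θ _ (W.left U)).hom) ≫ (W.retr N).hom = φ.hom
    rw [Subsingleton.elim (W.right U) (W.left U), hθ, Category.assoc, W.toExtTo_retr]
    exact Category.comp_id _

/-- A morphism to a direct image is determined by its sections over `U`, because sections of the
direct image over `i` and over `U ∨ i` agree. -/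
lemma dir_hom_ext {ψ ψ' : M ⟶ W.dir.obj N} (h : (qsections R U).map ψ = (qsections R U).map ψ') :
    ψ = ψ' := by
  refine ObjectProperty.hom_ext _ (pmod_hom_ext fun i ↦ ?_)
  have h₁ : (sections R (W.obj i)).map ψ.hom = (sections R (W.obj i)).map ψ'.hom := by
    refine (isBaseChange_resMap R M.property (W.left i)).hom_ext ?_
    rw [resMap_naturality, resMap_naturality]
    exact congrArg (fun x ↦ Mod.Hom.hom x ≫ _) h
  have h₂ : IsIso (resMap R (W.dirObj N) (W.right i)) :=
    isIso_shift R N _ _ _ (W.desc (W.left i) (𝟙 _))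
  refine Mod.hom_ext _ _ ?_
  have e (x : M ⟶ W.dir.obj N) := resMap_naturality x.hom (W.right i)
  refine (cancel_mono (resMap R (W.dirObj N) (W.right i))).1 ?_
  exact (e ψ).symm.trans ((congrArg (fun x ↦ _ ≫ Mod.Hom.hom x) h₁).trans (e ψ'))

variable (W M N) in
/-- The adjunction bijection between sections over `U` and direct image. -/
noncomputable def dirEquiv : (M ⟶ W.dir.obj N) ≃ ((qsections R U).obj M ⟶ N) :=
  Equiv.ofBijective (fun ψ ↦ (qsections R U).map ψ ≫ W.dirCounit N)
    ⟨fun _ _ h ↦ dir_hom_ext ((cancel_mono _).1 h), exists_dir_lift⟩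

end HomEquiv

lemma dirCounit_naturality {N N' : Mod C (R.obj U).X} (g : N ⟶ N') :
    (qsections R U).map (W.dir.map g) ≫ W.dirCounit N' = W.dirCounit N ≫ g := by
  have : IsIso (toExtTo R N (W.left U)) :=
    ⟨(W.retr N).hom, W.toExtTo_retr N, W.retr_toExtTo N⟩
  refine Mod.hom_ext _ _ ((cancel_epi (toExtTo R N (W.left U))).1 ?_)
  change toExtTo R N (W.left U) ≫ (extMap (homX (R.map (W.left U))) g).hom ≫ (W.retr N').hom =
    toExtTo R N (W.left U) ≫ (W.retr N).hom ≫ g.hom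
  rw [reassoc_of% (W.toExtTo_retr N), reassoc_of% (extUnit_extMap (homX (R.map (W.left U))) g)]
  exact (congrArg (g.hom ≫ ·) (W.toExtTo_retr N')).trans (Category.comp_id _)

/-- Sections over `U` are left adjoint to the direct image. -/
noncomputable def dirAdj : qsections R U ⊣ W.dir :=
  Adjunction.mkOfHomEquiv
    { homEquiv := fun M N ↦ (W.dirEquiv M N).symm
      homEquiv_naturality_left_symm := fun f g ↦ by
        change (qsections R U).map (f ≫ g) ≫ _ = (qsections R U).map f ≫ (qsections R U).map g ≫ _
        rw [Functor.map_comp, Category.assoc]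
      homEquiv_naturality_right := fun {M N N'} f g ↦ by
        rw [Equiv.symm_apply_eq]
        obtain ⟨ψ, rfl⟩ := (W.dirEquiv M N).surjective f
        rw [Equiv.symm_apply_apply]
        change ((qsections R U).map ψ ≫ W.dirCounit N) ≫ g =
          (qsections R U).map (ψ ≫ W.dir.map g) ≫ W.dirCounit N'
        rw [Functor.map_comp, Category.assoc, Category.assoc, dirCounit_naturality] }

instance : IsIso W.dirAdj.counit := by
  have h (N : Mod C (R.obj U).X) : IsIso (W.dirAdj.counit.app N) := by
    have e : W.dirAdj.counit.app N = (qsections R U).map (𝟙 _) ≫ W.dirCounit N := rfl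
    rw [e, CategoryTheory.Functor.map_id]
    exact IsIso.comp_isIso' (inferInstanceAs (IsIso (𝟙 _)))
      (inferInstanceAs (IsIso (JoinsWith.dirCounit W N)))
  exact NatIso.isIso_of_isIso_app _

lemma isIso_map_unit (M : QMod R) : IsIso ((qsections R U).map (W.dirAdj.unit.app M)) := by
  have h := W.dirAdj.left_triangle_components M
  have : IsIso ((qsections R U).map (W.dirAdj.unit.app M) ≫
      W.dirAdj.counit.app ((qsections R U).obj M)) := by
    rw [h]
    exact inferInstanceAs (IsIso (𝟙 _))
  exact IsIso.of_isIso_comp_right _ (W.dirAdj.counit.app ((qsections R U).obj M))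

lemma preservesColimitsOfShape_dir {K : Type u₃} [Category.{v₃} K] [HasColimitsOfShape K C]
    [∀ X : C, PreservesColimitsOfShape K (tensorLeft X)] : PreservesColimitsOfShape K W.dir := by
  have : PreservesColimitsOfShape K (W.dir ⋙ (quasiCoherent R).ι ⋙ PMod.forget R) :=
    preservesColimitsOfShape_of_evaluation _ _ fun i ↦
      inferInstanceAs (PreservesColimitsOfShape K
        (ext (R.map (W.left i)) ⋙ Mod.forget (R.obj (W.obj i)).X))
  have : ReflectsColimitsOfShape K ((quasiCoherent R).ι ⋙ PMod.forget R) :=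
    reflectsColimitsOfShape_of_reflectsIsomorphisms
  exact preservesColimitsOfShape_of_reflects_of_preserves _ ((quasiCoherent R).ι ⋙ PMod.forget R)

/-- If the sections of `M` over `i` vanish, so do those of the direct image of `M(U)`. -/
lemma isZero_dir {M : QMod R} {i : J} (h : IsZero ((qsections R i).obj M)) :
    IsZero ((qsections R i).obj (W.dir.obj ((qsections R U).obj M))) := by
  have e {k j : J} (s : k ⟶ j) : IsIso ((compare R s).app M.obj) :=
    (quasiCoherent_iff R M.obj).1 M.property s
  -- the sections over `U ∨ i` are a base change both of `M(i) = 0` and of `M(U)`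
  have h₁ : IsZero ((sections R (W.obj i)).obj M.obj) :=
    (Functor.map_isZero (ext (R.map (W.right i))) h).of_iso
      (@asIso _ _ _ _ ((compare R (W.right i)).app M.obj) (e _)).symm
  have h₂ : IsZero ((ext (R.map (W.left i))).obj ((qsections R U).obj M)) :=
    h₁.of_iso (@asIso _ _ _ _ ((compare R (W.left i)).app M.obj) (e _))
  exact Functor.map_isZero (res (R.map (W.right i))) h₂

end JoinsWith

end DirectImage

section

variable {C : Type u} [Category.{v} C] [MonoidalCategory C] [SymmetricCategory C] [Abelian C]
  [∀ X : C, PreservesFiniteColimits (tensorLeft X)] {X : ZarSheaf C}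

instance : Quiver.IsThin (ZarAff X)ᵒᵖ := fun _ _ ↦
  ⟨fun a b ↦ Quiver.Hom.unop_inj (Subsingleton.elim a.unop b.unop)⟩

/-- Intersections with an affine open `U`, as joins in the opposite category. -/
noncomputable def interJoins (hss : IsSemiSeparated X) (U : ZarAff X) :
    JoinsWith (structureSheaf (X := X)) (op U) where
  obj V := op (inter hss U V.unop)
  left V := (interLeft hss U V.unop).op
  right V := (interRight hss U V.unop).op
  desc a b := (exists_hom_inter hss a.unop b.unop).some.op
  isPushout a c := isPushout_resRing a.unop _ _ (interLeft hss U _) _ c.unop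
    (inter_isPullback hss U _) (inter_isPullback hss U _)

end

/-! ### Filtered colimits and finitely generated objects -/

section Filtered

variable {E : Type u₁} [Category.{v₁} E]

section Connected

variable {K : Type u₂} [Category.{v₂} K] [IsConnected K]

/-- If a cone over the members of a connected diagram with colimit `M` consists of isomorphisms
`P ⟶ S k`, then the induced morphism `P ⟶ M` is an isomorphism. -/
lemma isIso_of_isColimit_const {S : K ⥤ E} {M P : E} {θ : S ⟶ (Functor.const K).obj M}
    (h : IsColimit (Cocone.mk M θ)) (ν : (Functor.const K).obj P ⟶ S) [∀ k, IsIso (ν.app k)]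
    (m : P ⟶ M) (hm : ∀ k, ν.app k ≫ θ.app k = m) : IsIso m := by
  have : IsIso ν := NatIso.isIso_of_isIso_app ν
  have e : m = (IsColimit.coconePointsIsoOfNatIso (isColimitConstCocone K P) h (asIso ν)).hom :=
    (isColimitConstCocone K P).hom_ext fun k ↦ by
      rw [IsColimit.comp_coconePointsIsoOfNatIso_hom]
      exact (Category.id_comp _).trans (hm k).symm
  rw [e]
  exact Iso.isIso_hom _

variable [HasColimitsOfShape K E]

/-- Over a connected category, a cocone is a colimit if and only if its structure transformation
becomes an isomorphism on colimits. -/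
lemma nonempty_isColimit_iff_isIso {S : K ⥤ E} {M : E} (θ : S ⟶ (Functor.const K).obj M) :
    Nonempty (IsColimit (Cocone.mk M θ)) ↔ IsIso (colim.map θ) := by
  let d : colimit ((Functor.const K).obj M) ≅ M :=
    (colimit.isColimit ((Functor.const K).obj M)).coconePointUniqueUpToIso
      (isColimitConstCocone K M)
  have e : (colimit.isColimit S).desc (Cocone.mk M θ) = colim.map θ ≫ d.hom := by
    refine (colimit.isColimit S).hom_ext fun k ↦ ?_
    rw [IsColimit.fac]
    change _ = colimit.ι S k ≫ colimMap θ ≫ d.hom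
    rw [ι_colimMap_assoc]
    have := (colimit.isColimit ((Functor.const K).obj M)).comp_coconePointUniqueUpToIso_hom
      (isColimitConstCocone K M) k
    refine Eq.trans ?_ (congrArg (θ.app k ≫ ·) this).symm
    exact (Category.comp_id _).symm
  constructor
  · rintro ⟨h⟩
    have h₁ : IsIso ((colimit.isColimit S).desc (Cocone.mk M θ)) :=
      inferInstanceAs (IsIso ((colimit.isColimit S).coconePointUniqueUpToIso h).hom)
    rw [e] at h₁
    exact @IsIso.of_isIso_comp_right _ _ _ _ _ _ d.hom (Iso.isIso_hom d) h₁
  · intro h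
    have : IsIso ((colimit.isColimit S).desc (Cocone.mk M θ)) := by
      rw [e]
      exact IsIso.comp_isIso' h (Iso.isIso_hom d)
    exact ⟨IsColimit.ofPointIso (colimit.isColimit S)⟩

/-- Exact colimits over a connected category are stable under pullback. -/
lemma nonempty_isColimit_pullback [HasFiniteLimits E] [HasExactColimitsOfShape K E] {S : K ⥤ E}
    {M P : E} {θ : S ⟶ (Functor.const K).obj M} (h : IsColimit (Cocone.mk M θ)) (f : P ⟶ M) :
    Nonempty (IsColimit (Cocone.mk P (pullback.fst ((Functor.const K).map f) θ))) := by
  have h' := (nonempty_isColimit_iff_isIso θ).1 ⟨h⟩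
  refine (nonempty_isColimit_iff_isIso _).2 ?_
  exact ((IsPullback.of_hasPullback ((Functor.const K).map f) θ).map colim).isIso_fst_of_isIso

end Connected

lemma isPullback_app {K : Type u₂} [Category.{v₂} K] {S : K ⥤ E} [HasFiniteLimits E] {M P : E}
    (θ : S ⟶ (Functor.const K).obj M) (f : P ⟶ M) (k : K) : IsPullback ((pullback.fst ((Functor.const K).map f) θ).app k)
      ((pullback.snd ((Functor.const K).map f) θ).app k) f (θ.app k) :=
  (IsPullback.of_hasPullback ((Functor.const K).map f) θ).map ((evaluation K E).obj k)

/-- In an abelian category with exact filtered colimits, a directed system of subobjects of `M`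
which is jointly epimorphic has colimit `M`. -/
lemma nonempty_isColimit_of_mono [Abelian E] {K : Type u₂} [Category.{v₂} K] [IsFiltered K]
    [HasColimitsOfShape K E] [HasExactColimitsOfShape K E] {S : K ⥤ E} {M : E}
    (θ : S ⟶ (Functor.const K).obj M) [∀ k, Mono (θ.app k)]
    (h : ∀ ⦃Z : E⦄ (f g : M ⟶ Z), (∀ k, θ.app k ≫ f = θ.app k ≫ g) → f = g) :
    Nonempty (IsColimit (Cocone.mk M θ)) := by
  have := IsFiltered.isConnected K
  have := NatTrans.mono_of_mono_app θ
  let d := (colimit.isColimit S).desc (Cocone.mk M θ)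
  have hd (k : K) : colimit.ι S k ≫ d = θ.app k := (colimit.isColimit S).fac (Cocone.mk M θ) k
  have : Mono d := colim.map_mono' θ (colimit.isColimit S) (isColimitConstCocone K M) d
    fun k ↦ (hd k).trans (Category.comp_id _).symm
  have : Epi d := ⟨fun f g hfg ↦ h f g fun k ↦ by
    rw [← hd, Category.assoc, Category.assoc, hfg]⟩
  have : IsIso d := isIso_of_mono_of_epi d
  exact ⟨IsColimit.ofPointIso (colimit.isColimit S)⟩

end Filtered

section FinGen

variable {E : Type u₁} [Category.{v} E]

lemma IsFinGen.of_iso {M N : E} (hM : IsFinGen.{v} M) (e : M ≅ N) : IsFinGen.{v} N :=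
  fun J _ _ S hS ↦ by
    have := hM J S hS
    exact preservesColimit_of_natIso S (coyoneda.mapIso e.symm.op)

/-- A morphism from a finitely generated object to a filtered colimit of monomorphisms factors
through a member of the diagram. -/
lemma IsFinGen.exists_factor {M : E} (hM : IsFinGen.{v} M) {J : Type v} [SmallCategory J]
    [IsFiltered J] {S : J ⥤ E} (hS : ∀ ⦃i j : J⦄ (s : i ⟶ j), Mono (S.map s)) {c : Cocone S}
    (hc : IsColimit c) (f : M ⟶ c.pt) : ∃ j, ∃ g : M ⟶ S.obj j, g ≫ c.ι.app j = f := by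
  have := hM J S hS
  exact Types.jointly_surjective_of_isColimit (isColimitOfPreserves (coyoneda.obj (op M)) hc) f

variable [Abelian E] [HasFilteredColimitsOfSize.{v, v} E] [AB5OfSize.{v, v} E]

/-- The converse of `IsFinGen.exists_factor`: uniqueness of the factorisations is automatic, as the
members of the diagram are subobjects of the colimit. -/
lemma isFinGen_of_exists_factor {M : E} (h : ∀ (J : Type v) [SmallCategory J] [IsFiltered J]
    (S : J ⥤ E), (∀ ⦃i j : J⦄ (s : i ⟶ j), Mono (S.map s)) → ∀ (c : Cocone S), IsColimit c →
      ∀ f : M ⟶ c.pt, ∃ j, ∃ g : M ⟶ S.obj j, g ≫ c.ι.app j = f) : IsFinGen.{v} M :=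
  fun J _ _ S hS ↦ ⟨fun {c} hc ↦ ⟨Types.FilteredColimit.isColimitOf' _ _ (fun f ↦ by
    obtain ⟨j, g, hg⟩ := h J S hS c hc f
    exact ⟨j, g, hg.symm⟩) fun i x y hxy ↦ by
      have : ∀ (j j' : J) (φ : j ⟶ j'), Mono (S.map φ) := fun _ _ s ↦ hS s
      have := hc.mono_ι_app_of_isFiltered i
      have hxy' : (x : M ⟶ S.obj i) ≫ c.ι.app i = (y : M ⟶ S.obj i) ≫ c.ι.app i := hxy
      have e : x = y := (cancel_mono (c.ι.app i)).1 hxy'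
      exact ⟨i, 𝟙 i, by rw [e]⟩⟩⟩

/-- Quotients of finitely generated objects are finitely generated. -/
lemma IsFinGen.of_epi {M N : E} (hM : IsFinGen.{v} M) (e : M ⟶ N) [Epi e] : IsFinGen.{v} N := by
  refine isFinGen_of_exists_factor fun J _ _ S hS c hc f ↦ ?_
  obtain ⟨j, g, hg⟩ := hM.exists_factor hS hc (e ≫ f)
  have : ∀ (j j' : J) (φ : j ⟶ j'), Mono (S.map φ) := fun _ _ s ↦ hS s
  have := hc.mono_ι_app_of_isFiltered j
  have h0 : kernel.ι e ≫ g = 0 := by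
    rw [← cancel_mono (c.ι.app j), Category.assoc, hg, kernel.condition_assoc, zero_comp, zero_comp]
  refine ⟨j, Abelian.epiDesc e g h0, ?_⟩
  rw [← cancel_epi e, ← Category.assoc, Abelian.comp_epiDesc, hg]

end FinGen

/-- A finitely generated module over a Noetherian commutative monoid is generated by finitely many
sections. -/
lemma exists_generators {C : Type u} [Category.{v} C] [MonoidalCategory C] [SymmetricCategory C]
    {A : CommMon C} (hA : IsNoetherian A) {M : Mod C A.X}
    (hM : IsFinGen.{v} M) : ∃ (n : ℕ) (s : Fin n → (Mod.regular A.X ⟶ M)),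
      ∀ ⦃Z : Mod C A.X⦄ (f g : M ⟶ Z), (∀ k, s k ≫ f = s k ≫ g) → f = g := by
  obtain ⟨m, n, -, -, P, hP, Q, hQ, Z, hZ, q, p, t, z, h⟩ := hA M hM
  refine ⟨n, fun k ↦ Q.inj k ≫ p, fun T f g hfg ↦ h.hom_ext ?_ (hZ.eq_of_src _ _)⟩
  exact hQ.hom_ext fun k ↦ by
    have := hfg k.as
    rw [Category.assoc, Category.assoc] at this
    exact this

section Modules

variable {C : Type u} [Category.{v} C] [MonoidalCategory C] [SymmetricCategory C] [Abelian C]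
  [∀ X : C, PreservesFiniteColimits (tensorLeft X)] {A : C} [MonObj A] [IsCommMonObj A]

section Free

set_option linter.unusedSectionVars false

variable (A) in
/-- The free `A`-module `A ⊗ S`. -/
abbrev freeMod (S : C) : Mod C A :=
  mkMod (A ⊗ S) ((α_ A A S).inv ≫ μ[A] ▷ S)
    (by
      rw [associator_inv_naturality_left_assoc, ← comp_whiskerRight, MonObj.one_mul]
      monoidal)
    (by
      rw [associator_inv_naturality_left_assoc, ← comp_whiskerRight, MonObj.mul_assoc]
      simp only [comp_whiskerRight, whiskerLeft_comp, Category.assoc]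
      monoidal)

variable {S : C} {M : Mod C A}

/-- The morphism of modules `A ⊗ S ⟶ M` extending `S ⟶ M`. -/
def freeDesc (φ : S ⟶ M.X) : freeMod A S ⟶ M :=
  mkHom (M := freeMod A S) (A ◁ φ ≫ act M) (by
    change ((α_ A A S).inv ≫ μ[A] ▷ S) ≫ A ◁ φ ≫ act M = A ◁ (A ◁ φ ≫ act M) ≫ act M
    rw [Category.assoc, ← whisker_exchange_assoc, mul_act, associator_naturality_right_assoc,
      Iso.inv_hom_id_assoc, whiskerLeft_comp_assoc])

variable (A S) in
/-- The inclusion of the generators in a free module. -/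
def freeUnit : S ⟶ (freeMod A S).X := (λ_ S).inv ≫ η[A] ▷ S

lemma freeUnit_freeDesc (φ : S ⟶ M.X) : freeUnit A S ≫ (freeDesc φ).hom = φ := by
  change ((λ_ S).inv ≫ η[A] ▷ S) ≫ A ◁ φ ≫ act M = φ
  rw [Category.assoc, ← whisker_exchange_assoc, one_act]
  simp

lemma freeDesc_freeUnit (f : freeMod A S ⟶ M) : freeDesc (freeUnit A S ≫ f.hom) = f := by
  refine Mod.hom_ext _ _ ?_
  change A ◁ (((λ_ S).inv ≫ η[A] ▷ S) ≫ f.hom) ≫ act M = f.hom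
  rw [whiskerLeft_comp_assoc, ← act_hom f]
  change _ ≫ ((α_ A A S).inv ≫ μ[A] ▷ S) ≫ f.hom = f.hom
  rw [whiskerLeft_comp_assoc, Category.assoc, associator_inv_naturality_middle_assoc,
    ← comp_whiskerRight_assoc, MonObj.mul_one]
  simp

lemma freeDesc_comp {N : Mod C A} (φ : S ⟶ M.X) (g : M ⟶ N) :
    freeDesc φ ≫ g = freeDesc (φ ≫ g.hom) := by
  rw [← freeDesc_freeUnit (freeDesc φ ≫ g), Mod.comp_hom', reassoc_of% (freeUnit_freeDesc φ)]

end Free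

variable [HasColimitsOfSize.{v, v} C] [AB5OfSize.{v, v} C]
  [∀ X : C, PreservesColimitsOfSize.{v, v} (tensorLeft X)]

instance : HasColimitsOfSize.{v, v} (Mod C A) := ⟨fun _ _ ↦ inferInstance⟩

instance : AB5OfSize.{v, v} (Mod C A) := ⟨fun _ _ _ ↦ inferInstance⟩

lemma isFinGen_freeMod {S : C} (hS : IsFinGen.{v} S) : IsFinGen.{v} (freeMod A S) := by
  refine isFinGen_of_exists_factor fun J _ _ T hT c hc f ↦ ?_
  obtain ⟨j, g, hg⟩ := hS.exists_factor (S := T ⋙ Mod.forget A)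
    (fun i j s ↦ have := hT s; inferInstanceAs (Mono ((Mod.forget A).map (T.map s))))
    (isColimitOfPreserves (Mod.forget A) hc) (freeUnit A S ≫ f.hom)
  refine ⟨j, freeDesc (M := T.obj j) g, ?_⟩
  rw [← freeDesc_freeUnit f]
  exact (freeDesc_comp (M := T.obj j) g (c.ι.app j)).trans (congrArg (freeDesc (M := c.pt)) hg)

/-- Every module is a filtered colimit of finitely generated submodules. -/
lemma exists_filtered_isFinGen (hC : IsLocallyFinGen.{v} C) (M : Mod C A) :
    ∃ (J : Type v) (_ : SmallCategory J) (_ : IsFiltered J) (S : J ⥤ Mod C A)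
      (θ : S ⟶ (Functor.const J).obj M), Nonempty (IsColimit (Cocone.mk M θ)) ∧
      (∀ j, IsFinGen.{v} (S.obj j)) ∧ ∀ j, Mono (θ.app j) := by
  obtain ⟨J, _, _, _, S, c, hc, e, hS⟩ := hC M.X
  let φ (j : J) : S.obj j ⟶ M.X := c.ι.app j ≫ e.hom
  let G (j : J) : Subobject M := imageSubobject (freeDesc (φ j))
  have hG : Monotone G := fun j k hjk ↦ by
    have h : freeDesc (φ j) = freeDesc (S.map (homOfLE hjk) ≫ freeUnit A _) ≫ freeDesc (φ k) := by
      rw [freeDesc_comp, Category.assoc, freeUnit_freeDesc]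
      exact congrArg freeDesc (c.w_assoc (homOfLE hjk) e.hom).symm
    change imageSubobject (freeDesc (φ j)) ≤ _
    rw [h]
    exact imageSubobject_comp_le _ _
  let θ : hG.functor ⋙ Subobject.underlying ⟶ (Functor.const J).obj M :=
    { app := fun j ↦ (G j).arrow
      naturality := fun _ _ _ ↦ (Subobject.underlying_arrow _).trans (Category.comp_id _).symm }
  have hθ (j : J) : Mono (θ.app j) := inferInstanceAs (Mono (G j).arrow)
  refine ⟨J, inferInstance, inferInstance, hG.functor ⋙ Subobject.underlying, θ, ?_, fun j ↦ ?_, hθ⟩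
  · refine nonempty_isColimit_of_mono θ fun Z f g hfg ↦ ?_
    refine Mod.hom_ext _ _ ?_
    rw [← cancel_epi e.hom]
    refine hc.hom_ext fun j ↦ ?_
    have h₁ : freeDesc (φ j) = factorThruImageSubobject _ ≫ (G j).arrow :=
      (imageSubobject_arrow_comp _).symm
    have h₂ : freeDesc (φ j) ≫ f = freeDesc (φ j) ≫ g := by
      rw [h₁, Category.assoc, Category.assoc]
      exact congrArg (_ ≫ ·) (hfg j)
    have h₃ : φ j ≫ f.hom = φ j ≫ g.hom := by
      rw [← freeUnit_freeDesc (φ j), Category.assoc, Category.assoc]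
      exact congrArg (fun x ↦ freeUnit A _ ≫ Mod.Hom.hom x) h₂
    simpa only [φ, Category.assoc] using h₃
  · exact (isFinGen_freeMod (A := A) (hS j).1).of_epi
      (N := (imageSubobject (freeDesc (φ j)) : Mod C A)) (factorThruImageSubobject (freeDesc (φ j)))

end Modules

open ZeroObject

/-! ### Reduction to quotients with finitely generated sections -/

section Reduction

variable {E : Type u₁} [Category.{v₁} E] [Abelian E]

/-- The pullback of a short exact sequence along a morphism to its cokernel is short exact. -/
lemma shortExact_of_isPullback {S : ShortComplex E} (hS : S.ShortExact) {P Q : E} {a : P ⟶ S.X₂}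
    {b : P ⟶ Q} {q : Q ⟶ S.X₃} (h : IsPullback a b S.g q) (n : S.X₁ ⟶ P) (hn : n ≫ a = S.f)
    (hn' : n ≫ b = 0) : (ShortComplex.mk n b hn').ShortExact := by
  have := hS.mono_f
  have := hS.epi_g
  have : Mono (n ≫ a) := by rw [hn]; infer_instance
  have hmono : Mono n := mono_of_mono n a
  have hepi : Epi b := by
    rw [← h.isoPullback_hom_snd]
    infer_instance
  refine ShortComplex.ShortExact.mk' (ShortComplex.exact_of_f_is_kernel _ ?_) hmono hepi
  refine KernelFork.IsLimit.ofι' n hn' fun {W} k hk ↦ ?_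
  have hk' : (k ≫ a) ≫ S.g = 0 := by rw [Category.assoc, h.w, reassoc_of% hk, zero_comp]
  refine ⟨hS.exact.lift (k ≫ a) hk', h.hom_ext ?_ ?_⟩
  · rw [Category.assoc, hn, hS.exact.lift_f]
  · rw [Category.assoc, hn', comp_zero, hk]

section Colimit

variable {T : Type u₂} [Category.{v₂} T] (F : E ⥤ T)

/-- If a filtered diagram with colimit `S.X₃` is such that `F` inverts the pullbacks of the
extension `S` to all its members, then `F` inverts `S.f`. -/
lemma isIso_map_of_isColimit {K : Type w} [Category.{w} K] [IsFiltered K] [HasColimitsOfShape K E]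
    [HasExactColimitsOfShape K E] [PreservesColimitsOfShape K F] {S : ShortComplex E}
    (hS : S.ShortExact) {Q : K ⥤ E} {θ : Q ⟶ (Functor.const K).obj S.X₃}
    (hθ : IsColimit (Cocone.mk S.X₃ θ))
    (h : ∀ k {P : E} (f : S.X₁ ⟶ P) (g : P ⟶ Q.obj k) (w : f ≫ g = 0),
      (ShortComplex.mk f g w).ShortExact → IsIso (F.map f)) : IsIso (F.map S.f) := by
  have := IsFiltered.isConnected K
  let p := pullback.fst ((Functor.const K).map S.g) θ
  obtain ⟨hp⟩ := nonempty_isColimit_pullback hθ S.g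
  let ν : (Functor.const K).obj S.X₁ ⟶ pullback ((Functor.const K).map S.g) θ :=
    pullback.lift ((Functor.const K).map S.f) 0 (by rw [← Functor.map_comp, S.zero]; simp)
  have hν : ν ≫ p = (Functor.const K).map S.f := pullback.lift_fst _ _ _
  have hν' : ν ≫ pullback.snd ((Functor.const K).map S.g) θ = 0 := pullback.lift_snd _ _ _
  have hi (k : K) : IsIso (F.map (ν.app k)) :=
    h k (ν.app k) _ (congr_app hν' k) (shortExact_of_isPullback hS (isPullback_app θ S.g k) _
      (congr_app hν k) (congr_app hν' k))
  let p' : pullback ((Functor.const K).map S.g) θ ⋙ F ⟶ (Functor.const K).obj (F.obj S.X₂) :=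
    { app := fun k ↦ F.map (p.app k)
      naturality := fun _ _ s ↦ by
        rw [Functor.comp_map, ← F.map_comp, p.naturality]
        simp }
  let ν' : (Functor.const K).obj (F.obj S.X₁) ⟶ pullback ((Functor.const K).map S.g) θ ⋙ F :=
    { app := fun k ↦ F.map (ν.app k)
      naturality := fun _ _ s ↦ by
        rw [Functor.comp_map, ← F.map_comp, ← ν.naturality]
        simp }
  have hp' : IsColimit (Cocone.mk (F.obj S.X₂) p') := isColimitOfPreserves F hp
  have hν'' (k : K) : IsIso (ν'.app k) := hi k
  refine isIso_of_isColimit_const hp' ν' _ fun k ↦ ?_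
  change F.map (ν.app k) ≫ F.map (p.app k) = F.map S.f
  rw [← F.map_comp]
  exact congrArg F.map (congr_app hν k)

end Colimit

variable {D : Type u₃} [Category.{v} D] {L : E ⥤ D}

omit [Abelian E] in
/-- If `L Q` is finitely generated and `Q` is a filtered union of subobjects, then these
subobjects eventually have the same image as `Q` under `L`. -/
lemma exists_isIso_map_app {K : Type v} [SmallCategory K] [IsFiltered K]
    [L.PreservesMonomorphisms] [PreservesColimitsOfShape K L] [CategoryTheory.Balanced D] {Q : E}
    {S : K ⥤ E} {θ : S ⟶ (Functor.const K).obj Q} (hθ : IsColimit (Cocone.mk Q θ)) [∀ k, Mono (θ.app k)]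
    (hQ : IsFinGen.{v} (L.obj Q)) :
    ∃ k, ∀ ⦃j⦄ (_ : k ⟶ j), IsIso (L.map (θ.app j)) := by
  have hS ⦃i j : K⦄ (s : i ⟶ j) : Mono (S.map s) := by
    have h : S.map s ≫ θ.app j = θ.app i := (θ.naturality s).trans (Category.comp_id _)
    exact mono_of_mono_fac h
  obtain ⟨k, g, hg⟩ := hQ.exists_factor (S := S ⋙ L)
    (fun i j s ↦ have := hS s; inferInstanceAs (Mono (L.map (S.map s))))
    (isColimitOfPreserves L hθ) (𝟙 _)
  refine ⟨k, fun j s ↦ ?_⟩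
  have h : S.map s ≫ θ.app j = θ.app k := (θ.naturality s).trans (Category.comp_id _)
  have hg' : g ≫ L.map (θ.app k) = 𝟙 _ := hg
  have : IsSplitEpi (L.map (θ.app j)) := ⟨⟨⟨g ≫ L.map (S.map s), by
    rw [Category.assoc, ← L.map_comp, h, hg']
    rfl⟩⟩⟩
  exact isIso_of_mono_of_epi _

/-- If `L` has a fully faithful right adjoint `R` and `L Q` is a filtered union of finitely generated
subobjects `G k`, then `Q` is the filtered union of the subobjects `Q ×_{R L Q} R (G k)`, which
have finitely generated images under `L`. -/
lemma exists_filtered_pullback {R : D ⥤ E} (adj : L ⊣ R) [PreservesFiniteLimits L] [IsIso adj.counit]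
    (Q : E) {K : Type v} [SmallCategory K] [IsFiltered K] [HasColimitsOfShape K E]
    [HasExactColimitsOfShape K E] [PreservesColimitsOfShape K R] {G : K ⥤ D}
    {ψ : G ⟶ (Functor.const K).obj (L.obj Q)} (hψ : IsColimit (Cocone.mk (L.obj Q) ψ))
    (hG : ∀ k, IsFinGen.{v} (G.obj k)) [∀ k, Mono (ψ.app k)] :
    ∃ (S : K ⥤ E) (θ : S ⟶ (Functor.const K).obj Q), Nonempty (IsColimit (Cocone.mk Q θ)) ∧
      (∀ k, Mono (θ.app k)) ∧ ∀ k, IsFinGen.{v} (L.obj (S.obj k)) := by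
  have := IsFiltered.isConnected K
  have := adj.isRightAdjoint
  let φ : G ⋙ R ⟶ (Functor.const K).obj (R.obj (L.obj Q)) :=
    { app := fun k ↦ R.map (ψ.app k)
      naturality := fun i j s ↦ by
        rw [Functor.comp_map, ← R.map_comp, ψ.naturality]
        simp }
  have hφ : IsColimit (Cocone.mk _ φ) := isColimitOfPreserves R hψ
  have hφ' (k : K) : Mono (φ.app k) := inferInstanceAs (Mono (R.map (ψ.app k)))
  refine ⟨_, _, nonempty_isColimit_pullback hφ (adj.unit.app Q), fun k ↦ ?_, fun k ↦ ?_⟩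
  · exact (MorphismProperty.monomorphisms E).of_isPullback
      (isPullback_app φ (adj.unit.app Q) k).flip (hφ' k)
  · have hη : IsIso (L.map (adj.unit.app Q)) := by
      have h := adj.left_triangle_components Q
      have : IsIso (L.map (adj.unit.app Q) ≫ adj.counit.app (L.obj Q)) := by
        rw [h]
        exact inferInstanceAs (IsIso (𝟙 _))
      exact IsIso.of_isIso_comp_right _ (adj.counit.app (L.obj Q))
    have hi := ((isPullback_app φ (adj.unit.app Q) k).map L).isIso_snd_of_isIso
    exact ((hG k).of_iso (asIso (adj.counit.app (G.obj k))).symm).of_iso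
      (@asIso _ _ _ _ _ hi).symm

end Reduction

section Induction

variable {E : Type u₁} [Category.{v₁} E] [Abelian E] [HasFilteredColimitsOfSize.{v, v} E]
  [AB5OfSize.{v, v} E] {T : Type u₂} [Category.{v₂} T] (F : E ⥤ T)
  [PreservesColimitsOfSize.{v, v} F]

variable {κ : Type w} {D : κ → Type u₃} [∀ l, Category.{v} (D l)] [∀ l, Abelian (D l)]
  {L : ∀ l, E ⥤ D l} {R : ∀ l, D l ⥤ E} (adj : ∀ l, L l ⊣ R l)
  [∀ l, PreservesFiniteLimits (L l)] [∀ l, IsIso (adj l).counit]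
  [∀ l, PreservesColimitsOfSize.{v, v} (R l)]

/-- The functor `F` inverts the monomorphisms with cokernel in `Z`, provided that the images of
the cokernel under the functors `L l`, for `l ∈ t`, are finitely generated. -/
def InvertsFinGen (L : ∀ l, E ⥤ D l) (Z : E → Prop) (t : Finset κ) : Prop :=
  ∀ S : ShortComplex E, S.ShortExact → Z S.X₃ → (∀ l ∈ t, IsFinGen.{v} ((L l).obj S.X₃)) →
    IsIso (F.map S.f)

variable {F} in
include adj in
/-- One of the finiteness conditions can be dropped, by writing the cokernel as a filtered union
of subobjects satisfying it. -/
lemma InvertsFinGen.of_insert {Z : E → Prop} (hZ : ∀ ⦃M N : E⦄ (m : M ⟶ N) [Mono m], Z N → Z M)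
    [DecidableEq κ] {t : Finset κ} {m : κ}
    (hm : ∀ M : D m, ∃ (J : Type v) (_ : SmallCategory J) (_ : IsFiltered J) (S : J ⥤ D m)
      (θ : S ⟶ (Functor.const J).obj M), Nonempty (IsColimit (Cocone.mk M θ)) ∧
      (∀ j, IsFinGen.{v} (S.obj j)) ∧ ∀ j, Mono (θ.app j))
    (h : InvertsFinGen F L Z (insert m t)) : InvertsFinGen F L Z t := by
  intro S hS hSZ hSt
  obtain ⟨J, _, _, G, ψ, ⟨hψ⟩, hG, hψ'⟩ := hm ((L m).obj S.X₃)
  obtain ⟨Q, θ, ⟨hθ⟩, hθ', hQ⟩ := exists_filtered_pullback (adj m) S.X₃ hψ hG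
  have hL (l : κ) : PreservesColimitsOfSize.{v, v} (L l) := (adj l).leftAdjoint_preservesColimits
  have : Nonempty J := IsFiltered.nonempty
  choose! k hk using fun l (hl : l ∈ t) ↦ exists_isIso_map_app (L := L l) hθ (hSt l hl)
  classical
  obtain ⟨j₀, hj₀⟩ := IsFiltered.sup_objs_exists (t.image k)
  -- restricting to a final subdiagram, on which the conditions indexed by `t` hold
  let θ' : Under.forget j₀ ⋙ Q ⟶ (Functor.const (Under j₀)).obj S.X₃ :=
    { app := fun j ↦ θ.app j.right
      naturality := fun _ _ s ↦ θ.naturality s.right }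
  have hcol : IsColimit (Cocone.mk S.X₃ θ') :=
    (Functor.Final.isColimitWhiskerEquiv (Under.forget j₀) _).symm hθ
  refine isIso_map_of_isColimit F hS hcol fun j P f g w hfg ↦ h _ hfg ?_ ?_
  · exact @hZ (Q.obj j.right) S.X₃ (θ.app j.right) (hθ' j.right) hSZ
  · intro l hl
    rcases Finset.mem_insert.1 hl with rfl | hl
    · exact hQ j.right
    · have s : k l ⟶ j.right := (hj₀ (Finset.mem_image_of_mem k hl)).some ≫ j.hom
      have := hk l hl s
      exact (hSt l hl).of_iso (asIso ((L l).map (θ.app j.right))).symm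

variable {F} in
include adj in
/-- All the finiteness conditions can be dropped. -/
lemma InvertsFinGen.of_univ {Z : E → Prop} (hZ : ∀ ⦃M N : E⦄ (m : M ⟶ N) [Mono m], Z N → Z M)
    [Fintype κ]
    (hm : ∀ m, ∀ M : D m, ∃ (J : Type v) (_ : SmallCategory J) (_ : IsFiltered J) (S : J ⥤ D m)
      (θ : S ⟶ (Functor.const J).obj M), Nonempty (IsColimit (Cocone.mk M θ)) ∧
      (∀ j, IsFinGen.{v} (S.obj j)) ∧ ∀ j, Mono (θ.app j))
    (h : InvertsFinGen F L Z Finset.univ) {S : ShortComplex E} (hS : S.ShortExact)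
    (hSZ : Z S.X₃) : IsIso (F.map S.f) := by
  classical
  have key (s : Finset κ) : InvertsFinGen F L Z sᶜ := by
    induction s using Finset.induction_on with
    | empty => rwa [Finset.compl_empty]
    | insert m s _ ih =>
      refine InvertsFinGen.of_insert adj hZ (hm m) (m := m) fun S hS hSZ hSt ↦ ih S hS hSZ ?_
      intro l hl
      refine hSt l ?_
      simp only [Finset.mem_insert, Finset.mem_compl] at hl ⊢
      tauto
  exact key Finset.univ S hS hSZ fun l hl ↦ by simp at hl

end Induction

section

variable {E : Type u₁} [Category.{v₁} E] [Abelian E] {T : Type u₂} [Category.{v₂} T] [Abelian T]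
  {D : Type u₃} [Category.{v₃} D] [Abelian D]

/-- If a right exact functor `F` inverts the monomorphisms with cokernel annihilated by an exact
functor `L`, then it inverts all morphisms inverted by `L`. -/
lemma isIso_map_of_isIso_map (F : E ⥤ T) [PreservesFiniteColimits F] (L : E ⥤ D)
    [PreservesFiniteLimits L] [PreservesFiniteColimits L]
    (h : ∀ S : ShortComplex E, S.ShortExact → IsZero (L.obj S.X₃) → IsIso (F.map S.f)) {M N : E}
    (g : M ⟶ N) [IsIso (L.map g)] : IsIso (F.map g) := by
  have := preservesBinaryBiproducts_of_preservesBinaryCoproducts F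
  have : F.Additive := Functor.additive_of_preservesBinaryBiproducts F
  have := preservesBinaryBiproducts_of_preservesBinaryCoproducts L
  have : L.Additive := Functor.additive_of_preservesBinaryBiproducts L
  have e : factorThruImage g ≫ image.ι g = g := image.fac g
  have e' : L.map (factorThruImage g) ≫ L.map (image.ι g) = L.map g := by rw [← L.map_comp, e]
  have h₁ : IsIso (L.map (image.ι g)) := by
    have : Epi (L.map (factorThruImage g) ≫ L.map (image.ι g)) := by rw [e']; infer_instance
    have := epi_of_epi (L.map (factorThruImage g)) (L.map (image.ι g))
    exact isIso_of_mono_of_epi _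
  have h₂ : IsIso (L.map (factorThruImage g)) := by
    have : IsIso (L.map (factorThruImage g) ≫ L.map (image.ι g)) := by rw [e']; infer_instance
    exact IsIso.of_isIso_comp_right _ (L.map (image.ι g))
  have h₃ : IsIso (F.map (image.ι g)) := by
    refine h (ShortComplex.mk _ _ (cokernel.condition (image.ι g)))
      { exact := ShortComplex.exact_cokernel _
        mono_f := inferInstance
        epi_g := inferInstance } ?_
    have h := (ShortComplex.exact_cokernel (image.ι g)).map L
    exact IsZero.of_epi_eq_zero (L.map (cokernel.π (image.ι g)))
      ((cancel_epi (L.map (image.ι g))).1 (by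
        rw [← L.map_comp, cokernel.condition, L.map_zero, comp_zero]))
  -- the kernel of `g` is annihilated by `L`, hence by `F`, because `F` inverts `0 ⟶ ker g`
  have h₄ : IsIso (F.map (factorThruImage g)) := by
    let k := kernel.ι (factorThruImage g)
    have hk : IsZero (L.obj (kernel (factorThruImage g))) :=
      IsZero.of_mono_eq_zero (L.map k) ((cancel_mono (L.map (factorThruImage g))).1 (by
        rw [← L.map_comp, kernel.condition, L.map_zero, zero_comp]))
    have hk' : IsZero (F.obj (kernel (factorThruImage g))) := by
      have w : (0 : (0 : E) ⟶ kernel (factorThruImage g)) ≫ 𝟙 _ = 0 := zero_comp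
      have hi : IsIso (F.map (0 : (0 : E) ⟶ kernel (factorThruImage g))) :=
        h (ShortComplex.mk _ _ w)
          { exact := (ShortComplex.exact_iff_mono _ rfl).2 (inferInstanceAs (Mono (𝟙 _)))
            mono_f := (isZero_zero E).mono _
            epi_g := inferInstanceAs (Epi (𝟙 _)) } hk
      exact (F.map_isZero (isZero_zero E)).of_iso (asIso (F.map (0 : (0 : E) ⟶ _))).symm
    have hS : (ShortComplex.mk k (factorThruImage g) (kernel.condition _)).ShortExact :=
      { exact := ShortComplex.exact_kernel _
        mono_f := inferInstance
        epi_g := inferInstance }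
    have tfae : PreservesFiniteColimits F ↔ ∀ S : ShortComplex E, S.ShortExact →
        (S.map F).Exact ∧ Epi (F.map S.g) := (Functor.preservesFiniteColimits_tfae F).out 3 0
    obtain ⟨hex, hepi⟩ := tfae.1 ‹_› _ hS
    have hmono := (ShortComplex.exact_iff_mono _ (hk'.eq_of_src _ _)).1 hex
    have : Mono (F.map (factorThruImage g)) := hmono
    have : Epi (F.map (factorThruImage g)) := hepi
    exact isIso_of_mono_of_epi _
  rw [← e, F.map_comp]
  infer_instance

end

/-! ### Subobjects of the unit and strong monoidal functors -/

section Monoidal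

variable {E : Type u₁} [Category.{v₁} E] [MonoidalCategory E]

/-- The two descriptions of the multiplication `I ⊗ I ⟶ I` of a subobject `I` of the unit agree. -/
lemma whiskerRight_comp_leftUnitor_hom {I : E} (ε : I ⟶ 𝟙_ E) [Mono ε] :
    ε ▷ I ≫ (λ_ I).hom = I ◁ ε ≫ (ρ_ I).hom := by
  rw [← cancel_mono ε, Category.assoc, Category.assoc, ← leftUnitor_naturality,
    ← rightUnitor_naturality, whisker_exchange_assoc, unitors_equal]

/-- Strong monoidal functors preserve the symmetry of `whiskerRight_comp_leftUnitor_hom`, although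
they need not preserve monomorphisms. -/
lemma map_whiskerRight_comp_leftUnitor_hom {T : Type u₂} [Category.{v₂} T] [MonoidalCategory T]
    (F : E ⥤ T) [F.Monoidal] {I : E} (ε : I ⟶ 𝟙_ E) [Mono ε] :
    (F.map ε ≫ Functor.OplaxMonoidal.η F) ▷ F.obj I ≫ (λ_ (F.obj I)).hom =
      F.obj I ◁ (F.map ε ≫ Functor.OplaxMonoidal.η F) ≫ (ρ_ (F.obj I)).hom := by
  have h := congrArg F.map (whiskerRight_comp_leftUnitor_hom ε)
  rw [F.map_comp, F.map_comp, Functor.Monoidal.map_leftUnitor, Functor.Monoidal.map_rightUnitor,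
    ← Functor.OplaxMonoidal.δ_natural_left_assoc, ← Functor.OplaxMonoidal.δ_natural_right_assoc,
    cancel_epi] at h
  simpa using h

/-- If `e` is an epimorphism to the unit, with kernel `Z`, then by the symmetry of `e` the
composition `Z ⊗ N ⟶ Z ⟶ N` of the epimorphism `Z ⊗ e` and the inclusion is multiplication by the
image of `Z` in the unit, which is zero. -/
lemma mono_of_whiskerRight_comp_leftUnitor_hom [Abelian E]
    [∀ X : E, (tensorLeft X).PreservesEpimorphisms]
    [∀ X : E, (tensorRight X).PreservesZeroMorphisms] {N : E} (e : N ⟶ 𝟙_ E) [Epi e]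
    (h : e ▷ N ≫ (λ_ N).hom = N ◁ e ≫ (ρ_ N).hom) : Mono e := by
  refine Preadditive.mono_of_cancel_zero _ fun {Z} k hk ↦ ?_
  have h₁ : Epi (Z ◁ e) := inferInstanceAs (Epi ((tensorLeft Z).map e))
  have h₀ : (0 : Z ⟶ 𝟙_ E) ▷ N = 0 := (tensorRight N).map_zero _ _
  rw [← cancel_epi (ρ_ Z).hom, ← cancel_epi (Z ◁ e), comp_zero, comp_zero,
    ← rightUnitor_naturality, whisker_exchange_assoc, ← h, ← comp_whiskerRight_assoc, hk, h₀,
    zero_comp]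

end Monoidal

/-! ### Annihilators -/

section Annihilator

variable {D : Type u₁} [Category.{v₁} D] [MonoidalCategory D] [SymmetricCategory D] [Abelian D]
  [∀ X : D, PreservesFiniteColimits (tensorLeft X)] {A : D} [MonObj A] [IsCommMonObj A]

instance (M : Mod D A) : (tensorLeft M).PreservesEpimorphisms where
  preserves {N N'} f _ := by
    have hf : Epi f.hom := inferInstanceAs (Epi ((Mod.forget A).map f))
    have := epi_whiskerLeft M.X f.hom
    have h : Epi (ten M N ≫ (tmap (𝟙 M) f).hom) := by
      rw [ten_tmap_id_left]
      infer_instance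
    have h' : Epi ((Mod.forget A).map (tmap (𝟙 M) f)) := epi_of_epi (ten M N) (tmap (𝟙 M) f).hom
    exact (Mod.forget A).epi_of_epi_map h'

instance (M : Mod D A) : (tensorRight M).PreservesZeroMorphisms where
  map_zero N N' := by
    refine Mod.hom_ext _ _ ((cancel_epi (ten N M)).1 ?_)
    refine (ten_tmap_id_right (0 : N ⟶ N') M).trans (Eq.trans ?_ comp_zero.symm)
    exact (congrArg (· ≫ _) (zero_whiskerRight' M.X)).trans zero_comp

/-- An ideal that annihilates generators of a module annihilates the module. -/
lemma whiskerRight_act_eq_zero {M Q : Mod D A} (ε : M ⟶ Mod.regular A) {n : ℕ}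
    (s : Fin n → (Mod.regular A ⟶ Q))
    (hs : ∀ ⦃Z : Mod D A⦄ (f g : Q ⟶ Z), (∀ k, s k ≫ f = s k ≫ g) → f = g)
    (h : ∀ k, ε ≫ s k = 0) : ε.hom ▷ Q.X ≫ act Q = 0 := by
  have hp : Epi (Sigma.desc s) := ⟨fun f g hfg ↦ hs f g fun k ↦ by
    rw [← Sigma.ι_desc s k, Category.assoc, hfg, Category.assoc]⟩
  have hp' : Epi (M.X ◁ (Sigma.desc s).hom) :=
    inferInstanceAs (Epi ((Mod.forget A ⋙ tensorLeft M.X).map (Sigma.desc s)))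
  rw [← cancel_epi (M.X ◁ (Sigma.desc s).hom), comp_zero]
  refine (isColimitOfPreserves (Mod.forget A ⋙ tensorLeft M.X)
    (coproductIsCoproduct fun _ : Fin n ↦ Mod.regular A)).hom_ext fun ⟨k⟩ ↦ ?_
  refine Eq.trans ?_ comp_zero.symm
  change M.X ◁ (Sigma.ι (fun _ : Fin n ↦ Mod.regular A) k).hom ≫ M.X ◁ (Sigma.desc s).hom ≫ _ = 0
  rw [← whiskerLeft_comp_assoc, ← Mod.comp_hom', Sigma.ι_desc]
  have h₁ : act (Mod.regular A) ≫ (s k).hom = A ◁ (s k).hom ≫ act Q := act_hom (s k)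
  have h₂ : ract M ≫ ε.hom = ε.hom ▷ A ≫ ract (Mod.regular A) := ract_hom ε
  have h₃ : ε.hom ≫ (s k).hom = 0 := congrArg Mod.Hom.hom (h k)
  rw [act_regular] at h₁
  rw [ract_regular] at h₂
  refine (whisker_exchange_assoc ε.hom (s k).hom (act Q)).trans ?_
  refine (congrArg (ε.hom ▷ A ≫ ·) h₁.symm).trans ?_
  refine (Category.assoc _ _ _).symm.trans ((congrArg (· ≫ (s k).hom) h₂.symm).trans ?_)
  exact (Category.assoc _ _ _).trans ((congrArg (ract M ≫ ·) h₃).trans comp_zero)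

end Annihilator

section

set_option linter.unusedSectionVars false
variable {J : Type u₂} [Category.{v₂} J]
variable {C : Type u₁} [Category.{v₁} C] [MonoidalCategory C] [SymmetricCategory C] [Abelian C]
variable [∀ X : C, PreservesFiniteColimits (tensorLeft X)] (R : J ⥤ CommMon C) [FlatDiagram R]

/-- An ideal whose sections over `j` annihilate generators of `Q(j)` annihilates `Q(j)`. -/
lemma qsections_map_whiskerRight_eq_zero {j : J} {I Q : QMod R} (ε : I ⟶ 𝟙_ (QMod R)) {n : ℕ}
    (s : Fin n → ((qsections R j).obj (𝟙_ (QMod R)) ⟶ (qsections R j).obj Q))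
    (hs : ∀ ⦃Z : Mod C (R.obj j).X⦄ (f g : (qsections R j).obj Q ⟶ Z),
      (∀ k, s k ≫ f = s k ≫ g) → f = g)
    (h : ∀ k, (qsections R j).map ε ≫ s k = 0) :
    (qsections R j).map (ε ▷ Q ≫ (λ_ Q).hom) = 0 := by
  have : Epi (tenApp R I.obj Q.obj j) :=
    inferInstanceAs (Epi (((evaluation J C).obj j).map (ten I.obj Q.obj)))
  refine Mod.hom_ext _ _ ((cancel_epi (tenApp R I.obj Q.obj j)).1 ?_)
  refine Eq.trans ?_ comp_zero.symm
  have h₁ : ten I.obj Q.obj ≫ (tmap ε.hom (𝟙 Q.obj)).hom =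
      ε.hom.hom ▷ Q.obj.X ≫ lten Q.obj := ten_tmap_id_right ε.hom Q.obj
  have h₂ := lten_leftUnitIso Q.obj
  have h₃ : ten I.obj Q.obj ≫ (tmap ε.hom (𝟙 Q.obj)).hom ≫ (leftUnitIso Q.obj).hom.hom =
      ε.hom.hom ▷ Q.obj.X ≫ act Q.obj :=
    (Category.assoc _ _ _).symm.trans ((congrArg (· ≫ _) h₁).trans
      ((Category.assoc _ _ _).trans (congrArg (_ ≫ ·) h₂)))
  refine (congr_app h₃ j).trans ?_
  exact whiskerRight_act_eq_zero (M := sectionsObj R j I.obj) (Q := sectionsObj R j Q.obj)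
    ((qsections R j).map ε) s hs h

end

section

variable {E : Type u₁} [Category.{v₁} E] [Abelian E] {D : Type u₂} [Category.{v₂} D] [Abelian D]

lemma isIso_map_kernel (L : E ⥤ D) [PreservesFiniteLimits L] [PreservesFiniteColimits L] {M N : E}
    (f : M ⟶ N) (h : L.map f = 0) : IsIso (L.map (kernel.ι f)) := by
  have := preservesBinaryBiproducts_of_preservesBinaryCoproducts L
  have : L.Additive := Functor.additive_of_preservesBinaryBiproducts L
  have hex := (ShortComplex.exact_kernel f).map L
  have : Epi (L.map (kernel.ι f)) := (ShortComplex.exact_iff_epi _ h).1 hex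
  exact isIso_of_mono_of_epi _

/-- The common kernel of a finite family of morphisms `M ⟶ N k` agrees with `M` after applying an
exact functor that annihilates all the `N k`. -/
lemma exists_common_kernel {κ : Type w} [Finite κ] {M : E} {N : κ → E} (f : ∀ k, M ⟶ N k) :
    ∃ (I : E) (ε : I ⟶ M), Mono ε ∧ (∀ k, ε ≫ f k = 0) ∧
      ∀ (L : E ⥤ D) [PreservesFiniteLimits L] [PreservesFiniteColimits L],
        (∀ k, IsZero (L.obj (N k))) → IsIso (L.map ε) := by
  refine ⟨_, kernel.ι (Pi.lift f), inferInstance, fun k ↦ ?_, fun L _ _ h ↦ ?_⟩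
  · rw [← Pi.lift_π f k, kernel.condition_assoc, zero_comp]
  · refine isIso_map_kernel L _ ?_
    exact (isLimitOfPreserves L (productIsProduct N)).hom_ext fun ⟨k⟩ ↦ (h k).eq_of_tgt _ _

end

section

variable {E : Type u₁} [Category.{v₁} E] [Abelian E] [MonoidalCategory E]

/-- Let `P ⟶ Q` be an epimorphism with kernel `M ⟶ P`. If an ideal inverted by `F` annihilates `Q`,
then `F` inverts `M ⟶ P`. -/
lemma isIso_map_of_annihilator {T : Type u₂} [Category.{v₂} T] [MonoidalCategory T] (F : E ⥤ T)
    [F.Monoidal] {S : ShortComplex E} (hS : S.ShortExact) {I : E} (ε : I ⟶ 𝟙_ E) [IsIso (F.map ε)]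
    (h : ε ▷ S.X₃ ≫ (λ_ S.X₃).hom = 0) : IsIso (F.map S.f) := by
  have := hS.mono_f
  have hε (M : E) : IsIso (F.map (ε ▷ M ≫ (λ_ M).hom)) := by
    have : IsIso (F.map (ε ▷ M)) := by
      rw [Functor.Monoidal.map_whiskerRight]
      infer_instance
    rw [F.map_comp]
    infer_instance
  -- multiplication `I ⊗ P ⟶ P` takes values in `M`, as `I` annihilates `Q`
  let t : I ⊗ S.X₂ ⟶ S.X₁ := hS.exact.lift (ε ▷ S.X₂ ≫ (λ_ S.X₂).hom) (by
    rw [Category.assoc, ← leftUnitor_naturality, ← whisker_exchange_assoc, h, comp_zero])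
  have ht : t ≫ S.f = ε ▷ S.X₂ ≫ (λ_ S.X₂).hom := hS.exact.lift_f _ _
  have ht' : I ◁ S.f ≫ t = ε ▷ S.X₁ ≫ (λ_ S.X₁).hom := by
    rw [← cancel_mono S.f, Category.assoc, ht, whisker_exchange_assoc, leftUnitor_naturality,
      Category.assoc]
  have h₁ : IsIso (F.map t ≫ F.map S.f) := by
    rw [← F.map_comp, ht]
    exact hε _
  have h₂ : IsIso (F.map (I ◁ S.f) ≫ F.map t) := by
    rw [← F.map_comp, ht']
    exact hε _
  have : IsSplitEpi (F.map t) := ⟨⟨⟨inv (F.map (I ◁ S.f) ≫ F.map t) ≫ F.map (I ◁ S.f), by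
    rw [Category.assoc, IsIso.inv_hom_id]⟩⟩⟩
  have : Mono (F.map t) := mono_of_mono _ (F.map S.f)
  have : IsIso (F.map t) := isIso_of_mono_of_isSplitEpi _
  exact IsIso.of_isIso_comp_left (F.map t) (F.map S.f)

variable {C : Type u} [Category.{v} C] [MonoidalCategory C] [SymmetricCategory C] [Abelian C]
  [∀ X : C, PreservesFiniteColimits (tensorLeft X)] {K : CommMon C}

lemma IsFieldObject.epi_or_eq_zero (hK : IsFieldObject K) {N : Mod C K.X}
    (e : N ⟶ Mod.regular K.X) : Epi e ∨ e = 0 := by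
  rcases hK.mono_iso_or_zero _ (image.ι e) inferInstance with h | h
  · left
    rw [← image.fac e]
    infer_instance
  · right
    have h' : image.ι e = 0 := Mod.hom_ext _ _ h
    rw [← image.fac e, h', comp_zero]

/-- Let `L k`, for `k` in a finite set, be right exact functors that do not all annihilate a nonzero
object. A right exact strong monoidal functor `F` to modules over a field object is concentrated on
one of them: for some `k`, the functor `F` inverts all ideals that become trivial under `L k`. -/
lemma IsFieldObject.exists_isIso_map (hK : IsFieldObject K) (F : E ⥤ Mod C K.X) [F.Monoidal]
    [PreservesFiniteColimits F] {κ : Type w} [Finite κ] {D : κ → Type u₃} [∀ k, Category.{v₃} (D k)]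
    [∀ k, Abelian (D k)] (L : ∀ k, E ⥤ D k) [∀ k, PreservesFiniteColimits (L k)]
    (hL : ∀ Q, (∀ k, IsZero ((L k).obj Q)) → IsZero Q) :
    ∃ k, ∀ ⦃I : E⦄ (ε : I ⟶ 𝟙_ E) [Mono ε], IsIso ((L k).map ε) → IsIso (F.map ε) := by
  have : F.PreservesZeroMorphisms :=
    have := preservesBinaryBiproducts_of_preservesBinaryCoproducts F
    have : F.Additive := Functor.additive_of_preservesBinaryBiproducts F
    inferInstance
  have key {I : E} (ε : I ⟶ 𝟙_ E) [Mono ε] : IsIso (F.map ε) ∨ F.map ε = 0 := by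
    rcases hK.epi_or_eq_zero (F.map ε ≫ Functor.OplaxMonoidal.η F) with h | h
    · left
      have := mono_of_whiskerRight_comp_leftUnitor_hom _ (map_whiskerRight_comp_leftUnitor_hom F ε)
      have : IsIso (F.map ε ≫ Functor.OplaxMonoidal.η F) := isIso_of_mono_of_epi _
      exact IsIso.of_isIso_comp_right _ (Functor.OplaxMonoidal.η F)
    · right
      rw [← cancel_mono (Functor.OplaxMonoidal.η F), zero_comp]
      exact h
  by_contra! h
  choose I ε hm hi hn using h
  have h₀ (k : κ) : F.map (ε k) = 0 := (key (ε k)).resolve_left (hn k)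
  -- the sum of the ideals `I k` is the unit ideal, since it is so on all members of the cover
  have hepi : Epi (Sigma.desc ε) := by
    refine Preadditive.epi_of_isZero_cokernel _ (hL _ fun k ↦ ?_)
    have h₁ : (L k).map (ε k) ≫ (L k).map (cokernel.π (Sigma.desc ε)) = 0 := by
      rw [← (L k).map_comp, ← Sigma.ι_desc ε k, Category.assoc, cokernel.condition, comp_zero]
      exact Functor.map_zero _ _ _
    exact IsZero.of_epi_eq_zero ((L k).map (cokernel.π (Sigma.desc ε)))
      ((cancel_epi ((L k).map (ε k))).1 (h₁.trans comp_zero.symm))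
  have h₂ : F.map (Sigma.desc ε) = 0 :=
    (isColimitOfPreserves F (coproductIsCoproduct I)).hom_ext fun ⟨k⟩ ↦ by
      refine Eq.trans ?_ comp_zero.symm
      change F.map (Sigma.ι I k) ≫ F.map (Sigma.desc ε) = 0
      rw [← F.map_comp, Sigma.ι_desc, h₀]
  have h₃ : IsZero (F.obj (𝟙_ E)) := IsZero.of_epi_eq_zero (F.map (Sigma.desc ε)) h₂
  have h₄ : IsZero (Mod.regular K.X) := h₃.of_iso (Functor.Monoidal.εIso F)
  exact hK.nonzero ((Mod.forget K.X).map_isZero h₄)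

end

section

variable {C : Type u} [Category.{v} C] [MonoidalCategory C] [SymmetricCategory C] [Abelian C]
  [∀ X : C, PreservesFiniteColimits (tensorLeft X)] {X : ZarSheaf C}

/-- A quasi-coherent module is zero if it vanishes on the members of an affine cover. -/
lemma IsAffineCover.isZero (hss : IsSemiSeparated X) {κ : Type w} {A : κ → Aff C}
    {f : ∀ k, Spec.obj (A k) ⟶ X.obj} (hf : IsAffineCover X f) {Q : QCoh X}
    (h : ∀ k, IsZero ((pullbackTo (hf.member k)).obj Q)) : IsZero Q := by
  have : IsIso (0 : (0 : QCoh X) ⟶ Q) := hf.isIso_of_pullbackTo hss _ fun k ↦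
    ((Functor.map_isZero (qsections _ _) (isZero_zero (QCoh X))).isIso (h k) _)
  exact (isZero_zero (QCoh X)).of_iso (asIso (0 : (0 : QCoh X) ⟶ Q)).symm

/-- A morphism of quasi-coherent modules is zero if it vanishes on the members of an affine cover. -/
lemma IsAffineCover.eq_zero (hss : IsSemiSeparated X) {κ : Type w} {A : κ → Aff C}
    {f : ∀ k, Spec.obj (A k) ⟶ X.obj} (hf : IsAffineCover X f) {M N : QCoh X} (g : M ⟶ N)
    (h : ∀ k, (qsections structureSheaf (op (hf.member k))).map g = 0) : g = 0 := by
  have : IsIso (kernel.ι g) := hf.isIso_of_pullbackTo hss _ fun k ↦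
    isIso_map_kernel (qsections structureSheaf (op (hf.member k))) g (h k)
  rw [← cancel_epi (kernel.ι g), kernel.condition, comp_zero]

/-- Let `Q` be quasi-coherent, with finitely generated sections over the members of a finite affine
cover of a Noetherian scheme. If `Q` vanishes on `U`, then it is annihilated by an ideal which is
the unit ideal on `U`. -/
lemma IsAffineCover.exists_annihilator (hss : IsSemiSeparated X) (hN : IsNoetherianScheme X)
    {κ : Type w} [Finite κ] {A : κ → Aff C} {f : ∀ k, Spec.obj (A k) ⟶ X.obj}
    (hf : IsAffineCover X f) {Q : QCoh X}
    (hQ : ∀ k, IsFinGen.{v} ((qsections structureSheaf (op (hf.member k))).obj Q)) (U : ZarAff X)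
    (hU : IsZero ((qsections structureSheaf (op U)).obj Q)) :
    ∃ (I : QCoh X) (ε : I ⟶ 𝟙_ (QCoh X)), Mono ε ∧
      IsIso ((qsections structureSheaf (op U)).map ε) ∧ ε ▷ Q ≫ (λ_ Q).hom = 0 := by
  choose n s hs using fun k ↦ exists_generators (hN (hf.member k)) (hQ k)
  -- the common kernel of the morphisms from the structure sheaf to the direct images of the `Q(V)`
  -- that correspond to generators of `Q(V)`, for `V` in the cover
  let adj (k : κ) := (interJoins hss (hf.member k)).dirAdj
  obtain ⟨I, ε, hε, h₀, hi⟩ := exists_common_kernel (D := Mod C (ringOf U).X)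
    (κ := Σ k, Fin (n k)) fun a ↦ (adj a.1).homEquiv (𝟙_ (QCoh X)) _ (s a.1 a.2)
  refine ⟨I, ε, hε, hi (qsections structureSheaf (op U)) fun a ↦ JoinsWith.isZero_dir _ hU,
    hf.eq_zero hss _ fun k ↦ qsections_map_whiskerRight_eq_zero structureSheaf ε (s k) (hs k)
      fun a ↦ ?_⟩
  refine ((adj k).homEquiv I _).injective ?_
  refine ((adj k).homEquiv_naturality_left ε (s k a)).trans ((h₀ ⟨k, a⟩).trans ?_)
  have := (adj k).isRightAdjoint
  have := Functor.preservesZeroMorphisms_of_isRightAdjoint (interJoins hss (hf.member k)).dir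
  rw [Adjunction.homEquiv_unit, Functor.map_zero, comp_zero]

end

/-! ### Locality on an affine open -/

section

variable {C : Type u} [Category.{v} C] [MonoidalCategory C] [SymmetricCategory C] [Abelian C]
  [∀ X : C, PreservesFiniteColimits (tensorLeft X)]
  [HasColimitsOfSize.{v, v} C] [AB5OfSize.{v, v} C]
  [∀ X : C, PreservesColimitsOfSize.{v, v} (tensorLeft X)] {X : ZarSheaf C}

/-- Some affine open `U` is such that `F` inverts the morphisms that are isomorphisms on `U`. -/
lemma exists_isIso_map_of_isIso_map_pullbackTo (hC : IsLocallyFinGen.{v} C) (hX : IsScheme X)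
    (hqc : IsQuasiCompact X) (hss : IsSemiSeparated X) (hN : IsNoetherianScheme X) {K : CommMon C}
    (hK : IsFieldObject K) (F : QCoh X ⥤ Mod C K.X) [F.Monoidal]
    [PreservesColimitsOfSize.{v, v} F] :
    ∃ U : ZarAff X, ∀ ⦃M N : QCoh X⦄ (g : M ⟶ N),
      IsIso ((qsections structureSheaf (op U)).map g) → IsIso (F.map g) := by
  obtain ⟨κ, A, f, hf⟩ := hX
  obtain ⟨s, hs, hf⟩ := hqc κ A f hf
  have := hs.to_subtype
  have := Fintype.ofFinite s
  have : PreservesFiniteColimits F := PreservesColimitsOfSize.preservesFiniteColimits F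
  let L (k : s) := qsections (structureSheaf (X := X)) (op (hf.member k))
  let W (k : s) := interJoins hss (hf.member k)
  have (k : s) : PreservesColimitsOfSize.{v, v} (W k).dir :=
    ⟨(W k).preservesColimitsOfShape_dir⟩
  have : HasFilteredColimitsOfSize.{v, v} (QCoh X) := ⟨fun _ _ _ ↦ inferInstance⟩
  have : AB5OfSize.{v, v} (QCoh X) := ⟨fun _ _ _ ↦ inferInstance⟩
  obtain ⟨k, hk⟩ := hK.exists_isIso_map F L fun Q ↦ hf.isZero hss
  refine ⟨hf.member k, fun M N g hg ↦ isIso_map_of_isIso_map F (L k) (fun S hS hSZ ↦ ?_) g⟩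
  refine InvertsFinGen.of_univ (F := F) (fun k ↦ (W k).dirAdj) (Z := fun Q ↦ IsZero ((L k).obj Q))
    (fun M N m _ hN ↦ IsZero.of_mono ((L k).map m) hN)
    (fun _ _ ↦ exists_filtered_isFinGen hC _) ?_ hS hSZ
  intro S hS hSZ hS'
  obtain ⟨I, ε, _, hi, h⟩ := hf.exists_annihilator hss hN (fun k ↦ hS' k (Finset.mem_univ k))
    (hf.member k) hSZ
  have := hk ε hi
  exact isIso_map_of_annihilator F hS ε h

end

end RelAG

theorem proposition5p12 {C : Type u} [Category.{v} C] [Abelian C] [MonoidalCategory C]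
    [SymmetricCategory C] [MonoidalClosed C] [HasLimitsOfSize.{v, v} C]
    [HasColimitsOfSize.{v, v} C] [AB5OfSize.{v, v} C] (hC : RelAG.IsLocallyFinGen.{v} C)
    (X : RelAG.ZarSheaf C) (hX : RelAG.IsScheme X) (hqc : RelAG.IsQuasiCompact X)
    (hss : RelAG.IsSemiSeparated X) (hN : RelAG.IsNoetherianScheme X)
    (K : CommMon C) (hK : RelAG.IsFieldObject K)
    (F : RelAG.QCoh X ⥤ Mod C K.X) [F.Braided] [PreservesColimitsOfSize.{v, v} F] :
    ∃ U : RelAG.ZarAff X, RelAG.IsLocalFor (RelAG.pullbackTo U) F ∧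
      ∀ ⦃M N : RelAG.QCoh X⦄ (g : M ⟶ N),
        IsIso ((RelAG.pullbackTo U).map g) → IsIso (F.map g) := by
  have hpres (Y : C) : PreservesColimitsOfSize.{v, v} (tensorLeft Y) := inferInstance
  obtain ⟨U, hU⟩ :=
    RelAG.exists_isIso_map_of_isIso_map_pullbackTo hC hX hqc hss hN hK F
  let W := RelAG.interJoins hss U
  have h (M : RelAG.QCoh X) : IsIso (F.map (W.dirAdj.unit.app M)) := hU _ (W.isIso_map_unit M)
  refine ⟨U, ⟨W.dir, W.dirAdj, inferInstanceAs (IsIso W.dirAdj.counit), ?_⟩, hU⟩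
  exact @NatIso.isIso_of_isIso_app _ _ _ _ _ _ _ h
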